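/- Let $n\ge 2$, $m_1,\dots,m_n>0$, $b>2$ and $h\in\mathbb R$, and put $M=\mathrm{diag}(m_1,\dots,m_n)$. On the space of collinear configurations $\{x\in\mathbb R^n:\sum_i m_ix_i=0,\ x_i\ne x_j \text{ for } i\neq j\}$ let $$W(x)=\sum_{i<j}\frac{m_im_j}{|x_i-x_j|},\qquad V(x)=\sum_{i<j}\frac{m_im_j}{|x_i-x_j|^b},\qquad I(x)=x^tMx .$$ In McGehee coordinates $(\rho,v,s,u)\in[0,\infty)\times\mathbb R\times\mathbb R^n\times\mathbb R^n$, with $s$ a collision-free configuration satisfying $\sum_i m_is_i=0$ and $s^tMs=1$, and with $\sum_iu_i=0$ and $u^ts=0$, the equations of motion of the collinear $n$-body problem with potential $W+V$ (in a rescaled time) are $$\rho'=\rho v,\qquad v'=\tfrac b2v^2+u^tM^{-1}u-\rho^{b-1}W(s)-bV(s),\qquad s'=M^{-1}u,$$ $$u'=\left(\tfrac b2-1\right)vu-(u^tM^{-1}u)Ms+\rho^{b-1}\left[W(s)Ms+\nabla W(s)\right]+bV(s)Ms+\nabla V(s),$$ and the energy surface $E_h$ is the set of all such $(\rho,v,s,u)$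 with $$\tfrac12\left(u^tM^{-1}u+v^2\right)-\rho^{b-1}W(s)-V(s)=h\rho^b .$$ Let $s_0$ be a central configuration for $V$, that is, $\nabla V(s_0)=\sigma\nabla I(s_0)$ for some $\sigma\in\mathbb R$, normalized by $I(s_0)=1$, and let $s_0^{\pm}=(0,\pm\sqrt{2V(s_0)},s_0,0)\in E_h$ be the corresponding equilibria. For an equilibrium $p\in E_h$ let $W^s(p)$ (respectively $W^u(p)$) be the set of the points of $E_h$ whose orbit in $E_h$ exists for all $\tau\ge0$ (respectively $\tau\le0$) and converges to $p$ as $\tau\to+\infty$ (respectively $\tau\to-\infty$). Then $E_h$ is an embedded $C^1$ submanifold with boundary of dimension $2n-3$, and $W^u(s_0^\pm)$ and $W^s(s_0^\pm)$ are injectively immersed $C^1$ submanifolds (possibly with boundary, in $\rho=0$) of dimensions $$\dim W^u(s_0^+)=\dim W^s(s_0^-)=n-1,\qquad \dim W^s(s_0^+)=\dim W^u(s_0^-)=n-2 .$$ -/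

import Mathlib

/-! The collinear `n`-body problem with the quasihomogeneous (Manev-type) potential `U = W + V`,
`W = ∑ m_i m_j / |x_i - x_j|`, `V = ∑ m_i m_j / |x_i - x_j| ^ b`, in McGehee coordinates. -/

namespace CollinearNBody

noncomputable section

/-! ### Configurations and potentials -/

/-- Positions (or momenta) of `n` bodies on a line. -/
abbrev Conf (n : ℕ) : Type := EuclideanSpace ℝ (Fin n)

/-- The homogeneous potential of degree `-a`: `∑_{i<j} m_i m_j / |x_i - x_j| ^ a`.
Thus `W = pot m 1` and `V = pot m b`. -/
def pot {n : ℕ} (m : Fin n → ℝ) (a : ℝ) (x : Conf n) : ℝ :=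
  ∑ i : Fin n, ∑ j ∈ Finset.Ioi i, m i * m j / |x i - x j| ^ a

/-- The moment of inertia `xᵗ M x`. -/
def inertia {n : ℕ} (m : Fin n → ℝ) (x : Conf n) : ℝ := ∑ i : Fin n, m i * x i ^ 2

/-- `M x`, with `M = diag (m_1, …, m_n)`. -/
def massMul {n : ℕ} (m : Fin n → ℝ) (x : Conf n) : Conf n :=
  WithLp.toLp 2 fun i => m i * x i

/-- `M⁻¹ u`. -/
def massInv {n : ℕ} (m : Fin n → ℝ) (u : Conf n) : Conf n :=
  WithLp.toLp 2 fun i => u i / m i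

/-- `uᵗ M⁻¹ u`. -/
def kin {n : ℕ} (m : Fin n → ℝ) (u : Conf n) : ℝ := ∑ i : Fin n, u i ^ 2 / m i

/-- The configuration space: centre of mass at the origin and no collisions. -/
def configSpace {n : ℕ} (m : Fin n → ℝ) : Set (Conf n) :=
  {x | ∑ i, m i * x i = 0 ∧ ∀ i j, i ≠ j → x i ≠ x j}

/-- `x` is a central configuration of the collinear problem with potential `pot m a`. -/
def IsCentral {n : ℕ} (m : Fin n → ℝ) (a : ℝ) (x : Conf n) : Prop :=
  x ∈ configSpace m ∧ ∃ σ : ℝ, gradient (pot m a) x = σ • gradient (inertia m) x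

/-! ### The equations of motion in McGehee coordinates -/

/-- The McGehee coordinates `(ρ, v, s, u)`. -/
abbrev Phase (n : ℕ) : Type := ℝ × ℝ × Conf n × Conf n

/-- The regularized vector field, `(ρ', v', s', u')` as a function of `(ρ, v, s, u)`. -/
def field {n : ℕ} (m : Fin n → ℝ) (b : ℝ) : Phase n → Phase n
  | (ρ, v, s, u) =>
    (ρ * v,
     b / 2 * v ^ 2 + kin m u - ρ ^ (b - 1) * pot m 1 s - b * pot m b s,
     massInv m u,
     ((b / 2 - 1) * v) • u - kin m u • massMul m s
       + ρ ^ (b - 1) • (pot m 1 s • massMul m s + gradient (pot m 1) s)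
       + (b * pot m b s) • massMul m s + gradient (pot m b) s)

/-- The energy surface `E_h`, with the total collision manifold `ρ = 0` as its boundary. -/
def energySurface {n : ℕ} (m : Fin n → ℝ) (b h : ℝ) : Set (Phase n) :=
  {x | match x with
    | (ρ, v, s, u) =>
      0 ≤ ρ ∧ s ∈ configSpace m ∧ inertia m s = 1 ∧
      ∑ i, u i = 0 ∧ ∑ i, u i * s i = 0 ∧
      (kin m u + v ^ 2) / 2 - ρ ^ (b - 1) * pot m 1 s - pot m b s = h * ρ ^ b}

/-- The equilibrium `s₀⁺ = (0, √(2 V(s₀)), s₀, 0)`. -/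
def eqPlus {n : ℕ} (m : Fin n → ℝ) (b : ℝ) (s₀ : Conf n) : Phase n :=
  (0, √(2 * pot m b s₀), s₀, 0)

/-- The equilibrium `s₀⁻ = (0, -√(2 V(s₀)), s₀, 0)`. -/
def eqMinus {n : ℕ} (m : Fin n → ℝ) (b : ℝ) (s₀ : Conf n) : Phase n :=
  (0, -√(2 * pot m b s₀), s₀, 0)

/-- The (global) stable manifold of `p` in `E_h`: the points of `E_h` whose forward orbit exists
for all times `t ≥ 0` and converges to `p`. -/
def stableSet {n : ℕ} (m : Fin n → ℝ) (b h : ℝ) (p : Phase n) : Set (Phase n) :=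
  {x₀ | ∃ x : ℝ → Phase n, x 0 = x₀ ∧
    (∀ t ∈ Set.Ici (0 : ℝ), x t ∈ energySurface m b h ∧
      HasDerivWithinAt x (field m b (x t)) (Set.Ici 0) t) ∧
    Filter.Tendsto x Filter.atTop (nhds p)}

/-- The (global) unstable manifold of `p` in `E_h`: the points of `E_h` whose backward orbit exists
for all times `t ≤ 0` and converges to `p` as `t → -∞`. -/
def unstableSet {n : ℕ} (m : Fin n → ℝ) (b h : ℝ) (p : Phase n) : Set (Phase n) :=
  {x₀ | ∃ x : ℝ → Phase n, x 0 = x₀ ∧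
    (∀ t ∈ Set.Iic (0 : ℝ), x t ∈ energySurface m b h ∧
      HasDerivWithinAt x (field m b (x t)) (Set.Iic 0) t) ∧
    Filter.Tendsto x Filter.atBot (nhds p)}

/-! ### Submanifolds of a normed space and their dimension -/

/-- `S` is an embedded `C¹` submanifold of `F`, possibly with boundary, of dimension `k` at each of
its points: near `x ∈ S` it is the image, under a `C¹` embedding `φ` of an open neighbourhood `U` of
`0` in `ℝᵏ`, of `U ∩ {y | 0 ≤ ℓ y}`, where `ℓ` is a linear form. For `ℓ = 0` this is all of `U`
(`x` is an interior point), and for `ℓ ≠ 0` it is a half of `U` (`x` is a boundary point). The `C¹`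
left inverse `ψ` expresses that `φ` is an immersion and a homeomorphism onto its image. -/
def IsC1Submanifold {F : Type*} [NormedAddCommGroup F] [NormedSpace ℝ F]
    (k : ℕ) (S : Set F) : Prop :=
  ∀ x ∈ S, ∃ (U : Set (EuclideanSpace ℝ (Fin k))) (O : Set F)
    (φ : EuclideanSpace ℝ (Fin k) → F) (ψ : F → EuclideanSpace ℝ (Fin k))
    (ℓ : EuclideanSpace ℝ (Fin k) →ₗ[ℝ] ℝ),
    IsOpen U ∧ 0 ∈ U ∧ φ 0 = x ∧ IsOpen O ∧ Set.MapsTo φ U O ∧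
    ContDiffOn ℝ 1 φ U ∧ ContDiffOn ℝ 1 ψ O ∧ (∀ y ∈ U, ψ (φ y) = y) ∧
    S ∩ O = φ '' (U ∩ {y | 0 ≤ ℓ y})

/-- `S` is a nonempty embedded `C¹` submanifold, possibly with boundary, of dimension `k`. -/
def EmbeddedDim {F : Type*} [NormedAddCommGroup F] [NormedSpace ℝ F]
    (k : ℕ) (S : Set F) : Prop :=
  S.Nonempty ∧ IsC1Submanifold k S

/-- `S` is a nonempty injectively immersed (second countable) `C¹` manifold, possibly with boundary,
of dimension `k`: it is a countable union of embedded `k`-dimensional pieces any two of which meet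
in a relatively open subset of each. The relatively open subsets of the pieces then form a basis of
the manifold topology of `S`, in general finer than the subspace topology. -/
def ImmersedDim {F : Type*} [NormedAddCommGroup F] [NormedSpace ℝ F]
    (k : ℕ) (S : Set F) : Prop :=
  S.Nonempty ∧ ∃ P : ℕ → Set F,
    (∀ i, IsC1Submanifold k (P i)) ∧
    (∀ i j, ∃ O : Set F, IsOpen O ∧ P i ∩ P j = P i ∩ O) ∧
    S = ⋃ i, P i

end

end CollinearNBody

/-! The surface is the part `ρ ≥ 0` of the zero set of five constraints in dimension `2n + 2`. These
are independent. Along the velocity direction `(0, v, 0, u)` the energy varies at the rate `uᵗM⁻¹u +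
v²`, which is `2V(s) > 0` on `ρ = 0`, so the level is transverse to `ρ = 0`. Where the velocities
vanish at some `ρ > 0`, the energy varies with `ρ`.

At an equilibrium `(0, v₀, s₀, 0)` the tangent space consists of the vectors `(r, 0, ξ, η)` with `ξ`
and `M⁻¹η` orthogonal, for the mass inner product, to the translations and to `s₀`. Since `b > 2`,
the terms with `W` disappear from the linearization. The `ρ` axis is an eigenline with eigenvalue
`v₀`; on the rest `ξ' = M⁻¹η` and `η' = (b/2 - 1)v₀η + bV(s₀)Mξ + D²V(s₀)ξ`. On a line `D²V` is
positive semidefinite, because `|y| ^ (-b)` is convex on each side of `0`. So `M⁻¹D²V(s₀) + bV(s₀)`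
has `n - 2` eigenvectors with eigenvalues `α > 0` (`exists_normalModes`), and each gives the
exponents `μ² = (b/2 - 1)v₀μ + α`, one negative and one positive. The equilibrium is hyperbolic with
`n - 2` exponents of either sign in `ρ = 0`, and the sign of `v₀` decides to which side the last one
belongs.

It remains to have a `C¹` stable manifold theorem up to the boundary. The field extends to `ρ < 0`
as a `C¹` field, which preserves the full zero set of the constraints and the sign of `ρ`. The
stable manifold is built on this zero set and then cut by `ρ ≥ 0`. For `v₀ < 0`, `ρ` is one of the
stable coordinates and the cut leaves half of a graph; for `v₀ > 0`, `ρ` grows near the equilibrium,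
so all stable orbits lie in `ρ = 0`. Reversing time and velocities yields the unstable sets.

The local stable manifold comes from the inverse function theorem in the space of null sequences,
applied to the orbit equation of the time `ε` map (`exists_local_stable_manifold`). That this map is
`C¹`, with the expected derivative, comes from the inverse function theorem for the integral
equation on `C([0, 1])`. The flow then spreads the local manifold to the global one
(`immersedDim_stableSetOf`). -/

namespace CollinearNBody

open Set Filter Topology

/-! ### Inverse function theorem. -/

section InverseFunction

variable {E F : Type*} [NormedAddCommGroup E] [NormedSpace ℝ E] [CompleteSpace E]
  [NormedAddCommGroup F] [NormedSpace ℝ F]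

/-- The `C¹` inverse function theorem on a pair of open neighbourhoods. -/
theorem exists_local_inverse {f : E → F} {f' : E ≃L[ℝ] F} {a : E} {A : Set E}
    (hf : ContDiffAt ℝ 1 f a) (hf' : HasFDerivAt f (f' : E →L[ℝ] F) a) (hA : A ∈ 𝓝 a) :
    ∃ (U : Set E) (V : Set F) (g : F → E), IsOpen U ∧ IsOpen V ∧ a ∈ U ∧ f a ∈ V ∧ U ⊆ A ∧
      MapsTo f U V ∧ MapsTo g V U ∧ (∀ x ∈ U, g (f x) = x) ∧ (∀ y ∈ V, f (g y) = y) ∧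
      ContDiffOn ℝ 1 f U ∧ ContDiffOn ℝ 1 g V := by
  set e := hf.toOpenPartialHomeomorph f hf' one_ne_zero with he
  have hes : a ∈ e.source := hf.mem_toOpenPartialHomeomorph_source hf' one_ne_zero
  have het : f a ∈ e.target := hf.image_mem_toOpenPartialHomeomorph_target hf' one_ne_zero
  have hef : ∀ x, e x = f x := fun x => rfl
  have hg : ContDiffAt ℝ 1 e.symm (f a) := hf.to_localInverse hf' one_ne_zero
  have hga : e.symm (f a) = a := e.left_inv hes
  obtain ⟨A₁, hA₁, hfA⟩ := hf.contDiffOn (m := 1) le_rfl (by simp)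
  obtain ⟨B₁, hB₁, hgB⟩ := hg.contDiffOn (m := 1) le_rfl (by simp)
  obtain ⟨A₂, hA₂s, hA₂o, haA₂⟩ := mem_nhds_iff.1 (inter_mem hA hA₁)
  obtain ⟨B₂, hB₂s, hB₂o, haB₂⟩ := mem_nhds_iff.1 hB₁
  have hVo : IsOpen (e.target ∩ e.symm ⁻¹' A₂ ∩ B₂) :=
    (e.symm.isOpen_inter_preimage hA₂o).inter hB₂o
  refine ⟨e.source ∩ e ⁻¹' (e.target ∩ e.symm ⁻¹' A₂ ∩ B₂), e.target ∩ e.symm ⁻¹' A₂ ∩ B₂,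
    e.symm, e.isOpen_inter_preimage hVo, hVo, ⟨hes, ⟨het, ?_⟩, haB₂⟩, ⟨⟨het, ?_⟩, haB₂⟩,
    ?_, ?_, ?_, ?_, ?_, ?_, ?_⟩
  · simpa [hef, hga] using haA₂
  · simpa [hga] using haA₂
  · rintro x ⟨hx, ⟨-, hx2⟩, -⟩
    rw [mem_preimage, e.left_inv hx] at hx2
    exact (hA₂s hx2).1
  · rintro x ⟨hx, hx2⟩
    exact hx2
  · rintro y ⟨⟨hy, hy2⟩, hy3⟩
    refine ⟨e.map_target hy, ?_⟩
    rw [mem_preimage, e.right_inv hy]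
    exact ⟨⟨hy, hy2⟩, hy3⟩
  · rintro x ⟨hx, -⟩
    exact e.left_inv hx
  · rintro y ⟨⟨hy, -⟩, -⟩
    exact e.right_inv hy
  · refine hfA.mono ?_
    rintro x ⟨hx, ⟨-, hx2⟩, -⟩
    rw [mem_preimage, e.left_inv hx] at hx2
    exact (hA₂s hx2).2
  · exact hgB.mono fun y hy => hB₂s hy.2

end InverseFunction

/-! ### Charts of submanifolds with boundary. -/

section Charts

variable {F : Type*} [NormedAddCommGroup F] [NormedSpace ℝ F]

/-- `S` is a `k`-dimensional `C¹` submanifold, possibly with boundary, near its point `x`. -/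
def HasC1Chart (k : ℕ) (S : Set F) (x : F) : Prop :=
  ∃ (U : Set (EuclideanSpace ℝ (Fin k))) (O : Set F)
    (φ : EuclideanSpace ℝ (Fin k) → F) (ψ : F → EuclideanSpace ℝ (Fin k))
    (ℓ : EuclideanSpace ℝ (Fin k) →ₗ[ℝ] ℝ),
    IsOpen U ∧ 0 ∈ U ∧ φ 0 = x ∧ IsOpen O ∧ MapsTo φ U O ∧
    ContDiffOn ℝ 1 φ U ∧ ContDiffOn ℝ 1 ψ O ∧ (∀ y ∈ U, ψ (φ y) = y) ∧
    S ∩ O = φ '' (U ∩ {y | 0 ≤ ℓ y})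

variable {Z : Type*} [NormedAddCommGroup Z] [NormedSpace ℝ Z] [FiniteDimensional ℝ Z]
  {k : ℕ} {S : Set F} {U : Set Z} {O : Set F} {φ : Z → F} {ψ : F → Z} {ℓ : Z →ₗ[ℝ] ℝ} {a : Z}

/-- When `a` lies on the hyperplane `ℓ = 0`, translating `a` to the origin leaves the linear
condition `0 ≤ ℓ` unchanged, as the form of a chart must be linear and not affine. -/
theorem HasC1Chart.of_model_of_eq_zero (hk : Module.finrank ℝ Z = k) (hU : IsOpen U) (ha : a ∈ U)
    (hO : IsOpen O) (hφO : MapsTo φ U O) (hφ : ContDiffOn ℝ 1 φ U) (hψ : ContDiffOn ℝ 1 ψ O)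
    (hψφ : ∀ y ∈ U, ψ (φ y) = y) (hS : S ∩ O = φ '' (U ∩ {y | 0 ≤ ℓ y})) (hℓ : ℓ a = 0) :
    HasC1Chart k S (φ a) := by
  have e : EuclideanSpace ℝ (Fin k) ≃L[ℝ] Z :=
    ContinuousLinearEquiv.ofFinrankEq (by simp [hk])
  have hc : ContDiff ℝ 1 fun y => a + e y := contDiff_const.add e.contDiff
  refine ⟨(fun y => a + e y) ⁻¹' U, O, fun y => φ (a + e y), fun x => e.symm (ψ x - a),
    ℓ ∘ₗ (e : EuclideanSpace ℝ (Fin k) →ₗ[ℝ] Z), hU.preimage hc.continuous, by simpa using ha,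
    by simp, hO, fun y hy => hφO hy, hφ.comp hc.contDiffOn (fun y hy => hy),
    e.symm.contDiff.comp_contDiffOn (hψ.sub contDiffOn_const), ?_, ?_⟩
  · intro y hy
    simp only [hψφ _ hy, add_sub_cancel_left, e.symm_apply_apply]
  · rw [hS]
    ext x
    constructor
    · rintro ⟨z, ⟨hz, hz2⟩, rfl⟩
      have h1 : a + e (e.symm (z - a)) = z := by simp
      refine ⟨e.symm (z - a), ⟨?_, ?_⟩, ?_⟩
      · simpa [h1] using hz
      · simpa [hℓ] using hz2
      · simp
    · rintro ⟨y, ⟨hy, hy2⟩, rfl⟩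
      refine ⟨a + e y, ⟨hy, ?_⟩, rfl⟩
      simpa [hℓ] using hy2

/-- A chart on a half of an open subset of any `k`-dimensional space gives a chart at each of the
points that it covers. -/
theorem HasC1Chart.of_model (hk : Module.finrank ℝ Z = k) (hU : IsOpen U) (ha : a ∈ U)
    (hO : IsOpen O) (hφO : MapsTo φ U O) (hφ : ContDiffOn ℝ 1 φ U) (hψ : ContDiffOn ℝ 1 ψ O)
    (hψφ : ∀ y ∈ U, ψ (φ y) = y) (hS : S ∩ O = φ '' (U ∩ {y | 0 ≤ ℓ y})) (hℓ : 0 ≤ ℓ a) :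
    HasC1Chart k S (φ a) := by
  rcases hℓ.eq_or_lt with hℓ | hℓ
  · exact HasC1Chart.of_model_of_eq_zero hk hU ha hO hφO hφ hψ hψφ hS hℓ.symm
  -- At an interior point of the half space, shrinking to `ℓ > 0` makes the condition void, and the
  -- zero form describes the chart.
  · have hℓo : IsOpen {z : Z | 0 < ℓ z} :=
      isOpen_lt continuous_const ℓ.continuous_of_finiteDimensional
    refine HasC1Chart.of_model_of_eq_zero (U := U ∩ {z | 0 < ℓ z}) (O := O ∩ ψ ⁻¹' {z | 0 < ℓ z})
      (ψ := ψ) (ℓ := 0) hk (hU.inter hℓo) ⟨ha, hℓ⟩ (hψ.continuousOn.isOpen_inter_preimage hO hℓo) ?_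
      (hφ.mono inter_subset_left) (hψ.mono inter_subset_left) (fun y hy => hψφ y hy.1) ?_ rfl
    · rintro z ⟨hz, hz2⟩
      refine ⟨hφO hz, ?_⟩
      simpa [hψφ z hz] using hz2
    · rw [← inter_assoc, hS]
      ext x
      constructor
      · rintro ⟨⟨z, ⟨hz, hz2⟩, rfl⟩, hx⟩
        rw [mem_preimage, hψφ z hz] at hx
        exact ⟨z, ⟨⟨hz, hx⟩, by simp⟩, rfl⟩
      · rintro ⟨z, ⟨⟨hz, hz2⟩, -⟩, rfl⟩
        refine ⟨⟨z, ⟨hz, (show 0 < ℓ z from hz2).le⟩, rfl⟩, ?_⟩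
        rw [mem_preimage, hψφ z hz]
        exact hz2

/-- Carries charts back along a diffeomorphism `Θ`. The set is known to correspond to `W` only on
`D`, which is what the flow of a cut-off field provides. -/
theorem HasC1Chart.preimage {G : Type*} [NormedAddCommGroup G] [NormedSpace ℝ G] {W : Set F}
    {S : Set G} {Θ : G → F} {Θ' : F → G} {D : Set G} {x : G}
    (hW : HasC1Chart k W (Θ x)) (hΘ : ContDiff ℝ 1 Θ) (hΘ' : ContDiff ℝ 1 Θ')
    (hl : ∀ y, Θ' (Θ y) = y) (hr : ∀ y, Θ (Θ' y) = y) (hD : IsOpen D) (hx : x ∈ D)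
    (hS : ∀ y ∈ D, y ∈ S ↔ Θ y ∈ W) : HasC1Chart k S x := by
  obtain ⟨U, O, φ, ψ, ℓ, hU, h0, hφ0, hO, hφO, hφ, hψ, hψφ, hWO⟩ := hW
  refine ⟨U ∩ φ ⁻¹' (Θ' ⁻¹' D), Θ ⁻¹' O ∩ D, fun y => Θ' (φ y), fun y => ψ (Θ y), ℓ,
    hφ.continuousOn.isOpen_inter_preimage hU (hD.preimage hΘ'.continuous), ⟨h0, ?_⟩, ?_,
    (hO.preimage hΘ.continuous).inter hD, ?_, hΘ'.comp_contDiffOn (hφ.mono inter_subset_left),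
    hψ.comp hΘ.contDiffOn fun y hy => hy.1, ?_, ?_⟩
  · simpa [hφ0, hl] using hx
  · simp [hφ0, hl]
  · rintro y ⟨hy, hy2⟩
    exact ⟨by simpa [hr] using hφO hy, hy2⟩
  · rintro y ⟨hy, -⟩
    simp [hr, hψφ y hy]
  · ext z
    constructor
    · rintro ⟨hz, hz2, hz3⟩
      have : Θ z ∈ W ∩ O := ⟨(hS z hz3).1 hz, hz2⟩
      rw [hWO] at this
      obtain ⟨y, ⟨hy, hy2⟩, hyz⟩ := this
      have hz' : Θ' (φ y) = z := by rw [hyz, hl]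
      exact ⟨y, ⟨⟨hy, by simpa [hz'] using hz3⟩, hy2⟩, hz'⟩
    · rintro ⟨y, ⟨⟨hy, hy3⟩, hy2⟩, rfl⟩
      have : φ y ∈ W ∩ O := by rw [hWO]; exact ⟨y, ⟨hy, hy2⟩, rfl⟩
      exact ⟨(hS _ hy3).2 (by simpa [hr] using this.1), by simpa [hr] using this.2, hy3⟩

/-- A local straightening `(G, π)` of a level set of `G` gives a parametrization of the
level set. -/
theorem exists_parametrization {Z : Type*} [NormedAddCommGroup Z] [NormedSpace ℝ Z] {a : Z}
    [CompleteSpace F] {W : Type*} [NormedAddCommGroup W]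
    [NormedSpace ℝ W] {Ψ : F → W × Z} {Ψ' : F ≃L[ℝ] W × Z} {x : F} {A : Set F}
    (hΨ : ContDiffAt ℝ 1 Ψ x) (hΨ' : HasFDerivAt Ψ (Ψ' : F →L[ℝ] W × Z) x)
    (hx : Ψ x = (0, a)) (hA : A ∈ 𝓝 x) :
    ∃ (U : Set Z) (O : Set F) (φ : Z → F), IsOpen U ∧ a ∈ U ∧ IsOpen O ∧ x ∈ O ∧ O ⊆ A ∧
      φ a = x ∧ MapsTo φ U O ∧ ContDiffOn ℝ 1 φ U ∧ ContDiffOn ℝ 1 Ψ O ∧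
      (∀ z ∈ U, Ψ (φ z) = (0, z)) ∧
      (∀ y ∈ O, (Ψ y).1 = 0 → (Ψ y).2 ∈ U ∧ φ (Ψ y).2 = y) := by
  obtain ⟨O, V, g, hO, hV, hxO, hxV, hOA, hOV, hVO, hl, hr, hc, hgc⟩ :=
    exists_local_inverse hΨ hΨ' hA
  have hi : ContDiff ℝ 1 fun z : Z => ((0 : W), z) := contDiff_const.prodMk contDiff_id
  refine ⟨(fun z : Z => ((0 : W), z)) ⁻¹' V, O, fun z => g (0, z), hV.preimage hi.continuous,
    by simpa [hx] using hxV, hO, hxO, hOA, ?_, fun z hz => hVO hz,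
    hgc.comp hi.contDiffOn fun z hz => hz, hc, fun z hz => hr _ hz, ?_⟩
  · simp only
    rw [← hx, hl x hxO]
  · intro y hy hy0
    have : Ψ y = (0, (Ψ y).2) := by rw [← hy0]
    refine ⟨?_, ?_⟩
    · rw [mem_preimage, ← this]
      exact hOV hy
    · simp only
      rw [← this, hl y hy]

/-- The first component of `Ψ` cuts out the level and the second one serves as its coordinates; the
inequality is imposed on the coordinates. -/
theorem HasC1Chart.of_straightening [CompleteSpace F] {W : Type*} [NormedAddCommGroup W]
    [NormedSpace ℝ W] {Ψ : F → W × Z} {Ψ' : F ≃L[ℝ] W × Z} {x : F}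
    (hk : Module.finrank ℝ Z = k)
    (hΨ : ContDiffAt ℝ 1 Ψ x) (hΨ' : HasFDerivAt Ψ (Ψ' : F →L[ℝ] W × Z) x)
    (hx : Ψ x = (0, a)) (hℓ : 0 ≤ ℓ a)
    (hS : ∀ᶠ y in 𝓝 x, y ∈ S ↔ (Ψ y).1 = 0 ∧ 0 ≤ ℓ (Ψ y).2) : HasC1Chart k S x := by
  obtain ⟨U, O, φ, hU, haU, hO, hxO, hOS, hφa, hφO, hφ, hΨO, hr, hl⟩ :=
    exists_parametrization hΨ hΨ' hx hS
  rw [← hφa]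
  refine HasC1Chart.of_model (ψ := fun y => (Ψ y).2) (ℓ := ℓ) hk hU haU hO hφO hφ hΨO.snd
    (fun z hz => by simp [hr z hz]) ?_ hℓ
  ext y
  constructor
  · rintro ⟨hyS, hyO⟩
    obtain ⟨h1, h2⟩ := (hOS hyO).1 hyS
    obtain ⟨h3, h4⟩ := hl y hyO h1
    exact ⟨_, ⟨h3, h2⟩, h4⟩
  · rintro ⟨z, ⟨hz, hz2⟩, rfl⟩
    exact ⟨(hOS (hφO hz)).2 (by simpa [hr z hz] using hz2), hφO hz⟩

theorem IsC1Submanifold.image_equiv {G : Type*} [NormedAddCommGroup G] [NormedSpace ℝ G]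
    {S : Set F} (hS : IsC1Submanifold k S) (e : F ≃L[ℝ] G) : IsC1Submanifold k (e '' S) := by
  rintro _ ⟨x, hx, rfl⟩
  have h : HasC1Chart k S (e.symm (e x)) := by
    rw [e.symm_apply_apply]
    exact hS x hx
  exact h.preimage (Θ := e.symm) (Θ' := e) e.symm.contDiff e.contDiff (by simp) (by simp)
    isOpen_univ (mem_univ _) fun y _ => ⟨by rintro ⟨z, hz, rfl⟩; simpa using hz,
      fun hy => ⟨_, hy, by simp⟩⟩

theorem ImmersedDim.image_equiv {G : Type*} [NormedAddCommGroup G] [NormedSpace ℝ G]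
    {S : Set F} (hS : ImmersedDim k S) (e : F ≃L[ℝ] G) : ImmersedDim k (e '' S) := by
  obtain ⟨hne, P, hP, hPO, rfl⟩ := hS
  refine ⟨hne.image e, fun i => e '' P i, fun i => (hP i).image_equiv e, fun i j => ?_,
    image_iUnion⟩
  obtain ⟨O, hO, h⟩ := hPO i j
  refine ⟨e '' O, e.toHomeomorph.isOpenMap O hO, ?_⟩
  rw [← image_inter e.injective, ← image_inter e.injective, h]

end Charts

/-! ### Superposition operators and null sequences. -/

section

open scoped ZeroAtInfty

section Superposition

variable {α E F : Type*} [NormedAddCommGroup E] [NormedSpace ℝ E]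
  [NormedAddCommGroup F] [NormedSpace ℝ F]

/-- A superposition operator between spaces of functions with the supremum norm, which are given
through their evaluation maps, is `C¹` if its symbol is `C¹` with a uniformly continuous
derivative. -/
theorem contDiff_superposition {X Y : Type*} [NormedAddCommGroup X] [NormedSpace ℝ X]
    [NormedAddCommGroup Y] [NormedSpace ℝ Y] (ev : α → X →L[ℝ] E) (ev' : α → Y →L[ℝ] F)
    (hev : ∀ t x, ‖ev t x‖ ≤ ‖x‖) (hev' : ∀ y C, 0 ≤ C → (∀ t, ‖ev' t y‖ ≤ C) → ‖y‖ ≤ C)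
    {f : E → F} (hf : ContDiff ℝ 1 f) (huc : UniformContinuous (fderiv ℝ f))
    {N : X → Y} {D : X → X →L[ℝ] Y} (hN : ∀ t x, ev' t (N x) = f (ev t x))
    (hD : ∀ t x h, ev' t (D x h) = fderiv ℝ f (ev t x) (ev t h)) :
    ContDiff ℝ 1 N ∧ ∀ x, HasFDerivAt N (D x) x := by
  have hN' : ∀ x, HasFDerivAt N (D x) x := by
    intro x
    rw [hasFDerivAt_iff_isLittleO_nhds_zero, Asymptotics.isLittleO_iff]
    intro ε hε
    obtain ⟨δ, hδ, hδε⟩ := Metric.uniformContinuous_iff.1 huc ε hε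
    filter_upwards [Metric.ball_mem_nhds (0 : X) hδ] with h hh
    rw [mem_ball_zero_iff] at hh
    refine hev' _ _ (by positivity) fun t => ?_
    rw [map_sub, map_sub, hN, hN, hD, map_add]
    -- Uniform continuity of the derivative provides one radius `δ` for all `t`, so that the mean
    -- value inequality bounds the remainder in the supremum norm.
    have := (convex_ball (ev t x) δ).norm_image_sub_le_of_norm_fderiv_le'
      (f := f) (φ := fderiv ℝ f (ev t x)) (C := ε) (x := ev t x) (y := ev t x + ev t h)
      (fun z _ => (hf.differentiable one_ne_zero) z)
      (fun z hz => by
        rw [← dist_eq_norm]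
        exact (hδε hz).le)
      (Metric.mem_ball_self hδ) (by
        rw [mem_ball_iff_norm, add_sub_cancel_left]
        exact (hev t h).trans_lt hh)
    rw [add_sub_cancel_left] at this
    exact this.trans (by gcongr; exact hev t h)
  refine ⟨contDiff_one_iff_hasFDerivAt.2 ⟨D, ?_, hN'⟩, hN'⟩
  rw [Metric.continuous_iff]
  intro x ε hε
  obtain ⟨δ, hδ, hδε⟩ := Metric.uniformContinuous_iff.1 huc (ε / 2) (half_pos hε)
  refine ⟨δ, hδ, fun y hy => ?_⟩
  rw [dist_eq_norm]
  refine lt_of_le_of_lt (ContinuousLinearMap.opNorm_le_bound _ (half_pos hε).le fun h => ?_)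
    (half_lt_self hε)
  refine hev' _ _ (by positivity) fun t => ?_
  rw [sub_apply, map_sub, hD, hD, ← sub_apply]
  refine (ContinuousLinearMap.le_opNorm _ _).trans ?_
  have h1 : dist (ev t y) (ev t x) < δ := by
    rw [dist_eq_norm, ← map_sub]
    rw [dist_eq_norm] at hy
    exact (hev t _).trans_lt hy
  have h2 := (hδε h1).le
  rw [dist_eq_norm] at h2
  gcongr
  exact hev t h

/-- `C¹` maps with a bounded and uniformly continuous derivative. -/
structure UniformC1 (f : E → F) : Prop where
  contDiff : ContDiff ℝ 1 f
  uniformContinuous : UniformContinuous (fderiv ℝ f)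
  bound : ∃ C, ∀ x, ‖fderiv ℝ f x‖ ≤ C

theorem UniformC1.of_hasCompactSupport {f : E → F} (hf : ContDiff ℝ 1 f)
    (hs : HasCompactSupport f) : UniformC1 f where
  contDiff := hf
  uniformContinuous :=
    (hs.fderiv ℝ).uniformContinuous_of_continuous (hf.continuous_fderiv one_ne_zero)
  bound := (hs.fderiv ℝ).exists_bound_of_continuous (hf.continuous_fderiv one_ne_zero)

/-- Makes the nonlinear part of a cut-off map admissible, although a linear map has no compact
support. -/
theorem UniformC1.sub_clm {f : E → F} (hf : UniformC1 f) (A : E →L[ℝ] F) :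
    UniformC1 (fun x => f x - A x) := by
  have h : fderiv ℝ (fun x => f x - A x) = fun x => fderiv ℝ f x - A := by
    ext1 x
    rw [fderiv_fun_sub ((hf.contDiff.differentiable one_ne_zero) x) A.differentiableAt, A.fderiv]
  refine ⟨hf.contDiff.sub A.contDiff, ?_, ?_⟩
  · rw [h]
    exact hf.uniformContinuous.sub uniformContinuous_const
  · obtain ⟨C, hC⟩ := hf.bound
    refine ⟨C + ‖A‖, fun x => ?_⟩
    rw [h]
    exact (norm_sub_le _ _).trans (by gcongr; exact hC x)

/-- The superposition operator on continuous functions on a compact space. -/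
def superposition [TopologicalSpace α] (f : C(E, F)) (γ : C(α, E)) : C(α, F) := f.comp γ

theorem exists_hasFDerivAt_superposition [TopologicalSpace α] [CompactSpace α] {f : C(E, F)}
    (hf : UniformC1 f) :
    ContDiff ℝ 1 (superposition (α := α) f) ∧ ∃ D : C(α, E) → C(α, E) →L[ℝ] C(α, F),
      (∀ γ, HasFDerivAt (superposition f) (D γ) γ) ∧
      ∀ γ h t, D γ h t = fderiv ℝ f (γ t) (h t) := by
  obtain ⟨C, hC⟩ := hf.bound
  have hC0 : 0 ≤ C := (norm_nonneg _).trans (hC 0)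
  have hcf := hf.contDiff.continuous_fderiv one_ne_zero
  let D : C(α, E) → C(α, E) →L[ℝ] C(α, F) := fun γ =>
    LinearMap.mkContinuous
      { toFun := fun h => ⟨fun t => fderiv ℝ f (γ t) (h t),
          (hcf.comp γ.continuous).clm_apply h.continuous⟩
        map_add' := fun h k => by ext t; simp
        map_smul' := fun c h => by ext t; simp }
      C (fun h => by
        rw [ContinuousMap.norm_le _ (by positivity)]
        intro t
        exact (ContinuousLinearMap.le_opNorm _ _).trans (by
          gcongr
          · exact hC _
          · exact h.norm_coe_le_norm t))
  have hD : ∀ γ h t, D γ h t = fderiv ℝ f (γ t) (h t) := fun γ h t => rfl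
  have := contDiff_superposition (X := C(α, E)) (Y := C(α, F)) (α := α)
    (fun t => ContinuousMap.evalCLM ℝ t) (fun t => ContinuousMap.evalCLM ℝ t)
    (fun t x => x.norm_coe_le_norm t) (fun y C hC h => (ContinuousMap.norm_le _ hC).2 h)
    hf.contDiff hf.uniformContinuous (N := superposition f) (D := D) (fun t x => rfl)
    (fun t x h => hD x h t)
  exact ⟨this.1, D, this.2, hD⟩

end Superposition

section NullSequences

variable {E F : Type*} [NormedAddCommGroup E] [NormedAddCommGroup F]

/-- A sequence that tends to zero, as an element of `C₀(ℕ, E)`. -/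
def nullSeq (x : ℕ → E) (hx : Tendsto x atTop (𝓝 0)) : C₀(ℕ, E) where
  toFun := x
  continuous_toFun := continuous_of_discreteTopology
  zero_at_infty' := by rwa [cocompact_eq_atTop]

@[simp]
theorem nullSeq_apply (x : ℕ → E) (hx : Tendsto x atTop (𝓝 0)) (j : ℕ) :
    nullSeq x hx j = x j := rfl

theorem tendsto_nullSeq (x : C₀(ℕ, E)) : Tendsto x atTop (𝓝 0) := by
  rw [← cocompact_eq_atTop]
  exact x.zero_at_infty'

theorem norm_apply_le_norm (x : C₀(ℕ, E)) (j : ℕ) : ‖x j‖ ≤ ‖x‖ :=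
  x.toBCF.norm_coe_le_norm j

theorem nullSeq_norm_le {x : C₀(ℕ, E)} {C : ℝ} (hC : 0 ≤ C) (h : ∀ j, ‖x j‖ ≤ C) : ‖x‖ ≤ C :=
  (BoundedContinuousFunction.norm_le hC).2 h

/-- The supremum of a null sequence is attained or at most `C / 2`, so strict bounds on the terms
pass to the norm. This lets orbits in an open ball be points of the open ball of the sequence space.
-/
theorem nullSeq_norm_lt {x : C₀(ℕ, E)} {C : ℝ} (h : ∀ j, ‖x j‖ < C) : ‖x‖ < C := by
  have hC : 0 < C := (norm_nonneg _).trans_lt (h 0)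
  obtain ⟨k, hk⟩ := (((tendsto_nullSeq x).norm.eventually_lt_const
    (by simpa using half_pos hC : ‖(0 : E)‖ < C / 2)).exists_forall_of_atTop)
  obtain ⟨i, -, hi⟩ := Finset.exists_max_image (Finset.range (k + 1)) (fun j => ‖x j‖) ⟨0, by simp⟩
  refine lt_of_le_of_lt (nullSeq_norm_le (C := max ‖x i‖ (C / 2)) (by positivity) fun j => ?_)
    (max_lt (h i) (half_lt_self hC))
  rcases le_total k j with hj | hj
  · exact (hk j hj).le.trans (le_max_right _ _)
  · exact (hi j (by simp; omega)).trans (le_max_left _ _)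

variable [NormedSpace ℝ E] [NormedSpace ℝ F]

/-- Evaluation of null sequences. -/
noncomputable def evalNull (j : ℕ) : C₀(ℕ, E) →L[ℝ] E :=
  LinearMap.mkContinuous
    { toFun := fun x => x j
      map_add' := fun _ _ => rfl
      map_smul' := fun _ _ => rfl } 1 fun x => by simpa using norm_apply_le_norm x j

theorem UniformC1.tendsto_comp {f : E → F} (hf : UniformC1 f) (h0 : f 0 = 0) (x : C₀(ℕ, E)) :
    Tendsto (fun j => f (x j)) atTop (𝓝 0) := by
  rw [← h0]
  exact (hf.contDiff.continuous.tendsto 0).comp (tendsto_nullSeq x)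

/-- The superposition operator on null sequences. -/
theorem exists_superposition_nullSeq {f : E → F} (hf : UniformC1 f) (h0 : f 0 = 0) :
    ∃ (N : C₀(ℕ, E) → C₀(ℕ, F)) (D : C₀(ℕ, E) → C₀(ℕ, E) →L[ℝ] C₀(ℕ, F)), ContDiff ℝ 1 N ∧
      (∀ x, HasFDerivAt N (D x) x) ∧ (∀ x j, N x j = f (x j)) ∧
      ∀ x h j, D x h j = fderiv ℝ f (x j) (h j) := by
  obtain ⟨C, hC⟩ := hf.bound
  have hC0 : 0 ≤ C := (norm_nonneg _).trans (hC 0)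
  have ht : ∀ x h : C₀(ℕ, E), Tendsto (fun j => fderiv ℝ f (x j) (h j)) atTop (𝓝 0) := by
    intro x h
    have h2 : Tendsto (fun j => C * ‖h j‖) atTop (𝓝 0) := by
      simpa using (tendsto_nullSeq h).norm.const_mul C
    exact squeeze_zero_norm (fun j => (ContinuousLinearMap.le_opNorm _ _).trans
      (by gcongr; exact hC _)) h2
  let D : C₀(ℕ, E) → C₀(ℕ, E) →L[ℝ] C₀(ℕ, F) := fun x =>
    LinearMap.mkContinuous
      { toFun := fun h => nullSeq _ (ht x h)
        map_add' := fun h k => by ext j; simp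
        map_smul' := fun c h => by ext j; simp }
      C (fun h => nullSeq_norm_le (by positivity) fun j =>
        (ContinuousLinearMap.le_opNorm _ _).trans (by
          gcongr
          · exact hC _
          · exact norm_apply_le_norm h j))
  let N : C₀(ℕ, E) → C₀(ℕ, F) := fun x => nullSeq _ (hf.tendsto_comp h0 x)
  have hD : ∀ x h j, D x h j = fderiv ℝ f (x j) (h j) := fun x h j => rfl
  have := contDiff_superposition (evalNull (E := E)) (evalNull (E := F))
    (fun t x => norm_apply_le_norm x t) (fun y C hC h => nullSeq_norm_le hC h)
    hf.contDiff hf.uniformContinuous (N := N) (D := D) (fun t x => rfl)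
    (fun t x h => hD x h t)
  exact ⟨N, D, this.1, this.2, fun x j => rfl, hD⟩

end NullSequences

end

/-! ### Local stable manifold of a hyperbolic fixed point. -/

section

open scoped ZeroAtInfty Manifold

/-- A `C¹` map on an open set agrees near a given compact set with a compactly supported
`C¹` map. -/
theorem exists_compactSupport_extension {E F : Type*} [NormedAddCommGroup E] [NormedSpace ℝ E]
    [FiniteDimensional ℝ E] [NormedAddCommGroup F] [NormedSpace ℝ F] {f : E → F} {Ω C : Set E}
    (hΩ : IsOpen Ω) (hf : ContDiffOn ℝ 1 f Ω) (hC : IsCompact C) (hCΩ : C ⊆ Ω) :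
    ∃ (g : E → F) (V : Set E), ContDiff ℝ 1 g ∧ HasCompactSupport g ∧ IsOpen V ∧ C ⊆ V ∧ V ⊆ Ω ∧
      ∀ x ∈ V, g x = f x := by
  obtain ⟨K, hK, hCK, hKΩ⟩ := exists_compact_between hC hΩ hCΩ
  obtain ⟨χ, hχ1, hχ0, -⟩ := exists_contMDiffMap_one_nhds_of_subset_interior (n := 1) 𝓘(ℝ, E)
    hC.isClosed hCK
  have hχ : ContDiff ℝ 1 χ := χ.contMDiff.contDiff
  obtain ⟨V, hV, hCV, hVχ⟩ := mem_nhdsSet_iff_exists.1 hχ1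
  refine ⟨fun x => χ x • f x, V ∩ Ω, contDiff_iff_contDiffAt.2 fun x => ?_, ?_, hV.inter hΩ,
    subset_inter hCV hCΩ, inter_subset_right, fun x hx => ?_⟩
  · by_cases hx : x ∈ Ω
    · exact hχ.contDiffAt.smul (hf.contDiffAt (hΩ.mem_nhds hx))
    · have hxK : Kᶜ ∈ 𝓝 x := hK.isClosed.isOpen_compl.mem_nhds fun h => hx (hKΩ h)
      refine contDiffAt_const (c := 0) |>.congr_of_eventuallyEq ?_
      filter_upwards [hxK] with y hy
      simp [hχ0 y hy]
  · refine HasCompactSupport.intro hK fun x hx => ?_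
    simp [hχ0 x hx]
  · have : χ x = 1 := hVχ hx.1
    simp [this]

section Sequences

variable {Es Eu : Type*} [NormedAddCommGroup Es] [NormedSpace ℝ Es] [NormedAddCommGroup Eu]
  [NormedSpace ℝ Eu]

/-- The shift operator which moves the first component forward and the second one backward. -/
theorem exists_shift (a : Es × Eu →L[ℝ] Es) (b c : Es × Eu →L[ℝ] Eu) :
    ∃ T : C₀(ℕ, Es × Eu) →L[ℝ] C₀(ℕ, Es × Eu), ‖T‖ ≤ max ‖a‖ (‖b‖ + ‖c‖) ∧
      (∀ x, T x 0 = (0, b (x 1) + c (x 0))) ∧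
      ∀ x j, T x (j + 1) = (a (x j), b (x (j + 2)) + c (x (j + 1))) := by
  have ht1 : ∀ x : C₀(ℕ, Es × Eu),
      Tendsto (fun j : ℕ => (Nat.casesOn j 0 fun i => a (x i) : Es)) atTop (𝓝 0) := by
    intro x
    rw [← tendsto_add_atTop_iff_nat 1]
    simpa [Function.comp_def] using (a.continuous.tendsto 0).comp (tendsto_nullSeq x)
  have ht2 : ∀ x : C₀(ℕ, Es × Eu),
      Tendsto (fun j : ℕ => b (x (j + 1)) + c (x j)) atTop (𝓝 0) := by
    intro x
    have h1 := (b.continuous.tendsto 0).comp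
      ((tendsto_add_atTop_iff_nat 1).2 (tendsto_nullSeq x))
    have h2 := (c.continuous.tendsto 0).comp (tendsto_nullSeq x)
    simpa using h1.add h2
  let T : C₀(ℕ, Es × Eu) →ₗ[ℝ] C₀(ℕ, Es × Eu) :=
    { toFun := fun x => nullSeq (fun j => ((Nat.casesOn j 0 fun i => a (x i) : Es),
        b (x (j + 1)) + c (x j))) ((ht1 x).prodMk_nhds (ht2 x))
      map_add' := fun x y => by
        ext j
        · cases j <;> simp
        · simp; abel
      map_smul' := fun r x => by
        ext j
        · cases j <;> simp
        · simp }
  refine ⟨T.mkContinuous (max ‖a‖ (‖b‖ + ‖c‖)) fun x => ?_, ?_, fun x => rfl, fun x j => rfl⟩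
  · refine nullSeq_norm_le (by positivity) fun j => ?_
    refine norm_prod_le_iff.2 ⟨?_, ?_⟩
    · cases j with
      | zero => simpa [T] using (by positivity)
      | succ i =>
        refine (a.le_opNorm _).trans ?_
        gcongr
        · exact le_max_left _ _
        · exact norm_apply_le_norm x i
    · refine (norm_add_le _ _).trans ((add_le_add (b.le_opNorm _) (c.le_opNorm _)).trans ?_)
      calc ‖b‖ * ‖x (j + 1)‖ + ‖c‖ * ‖x j‖ ≤ ‖b‖ * ‖x‖ + ‖c‖ * ‖x‖ := by
            gcongr <;> exact norm_apply_le_norm x _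
        _ = (‖b‖ + ‖c‖) * ‖x‖ := by ring
        _ ≤ _ := by gcongr; exact le_max_right _ _
  · exact LinearMap.mkContinuous_norm_le _ (by positivity) _

/-- The null sequence `((ξ, 0), 0, 0, …)`. -/
theorem exists_initial : ∃ T : Es →L[ℝ] C₀(ℕ, Es × Eu),
    (∀ ξ, T ξ 0 = (ξ, 0)) ∧ ∀ ξ j, T ξ (j + 1) = 0 := by
  have ht : ∀ ξ : Es,
      Tendsto (fun j : ℕ => (Nat.casesOn j (ξ, 0) fun _ => 0 : Es × Eu)) atTop (𝓝 0) := by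
    intro ξ
    rw [← tendsto_add_atTop_iff_nat 1]
    simp
  let T : Es →ₗ[ℝ] C₀(ℕ, Es × Eu) :=
    { toFun := fun ξ => nullSeq _ (ht ξ)
      map_add' := fun x y => by
        ext j <;> cases j <;> simp
      map_smul' := fun r x => by
        ext j <;> cases j <;> simp }
  refine ⟨T.mkContinuous 1 fun ξ => ?_, fun ξ => rfl, fun ξ j => rfl⟩
  refine nullSeq_norm_le (by positivity) fun j => ?_
  cases j <;> simp [T, Prod.norm_def]

/-- The local stable manifold theorem for a hyperbolic fixed point of a `C¹` map. The points of the
local stable manifold are those whose orbit remains in a ball and tends to the fixed point; they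
form the graph of a `C¹` map over the stable subspace. -/
theorem exists_local_stable_manifold [FiniteDimensional ℝ Es] [FiniteDimensional ℝ Eu]
    {As : Es →L[ℝ] Es} {Au Bu : Eu →L[ℝ] Eu} (hAs : ‖As‖ < 1) (hBu : ‖Bu‖ < 1)
    (hAB : ∀ u, Au (Bu u) = u) (hBA : ∀ u, Bu (Au u) = u) {g : Es × Eu → Es × Eu}
    (hg : ContDiffAt ℝ 1 g 0) (hg0 : g 0 = 0) (hg' : HasFDerivAt g (As.prodMap Au) 0)
    {A : Set (Es × Eu)} (hA : A ∈ 𝓝 0) :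
    ∃ (r : ℝ) (U : Set Es) (φ : Es → Es × Eu), 0 < r ∧ Metric.ball 0 r ⊆ A ∧ IsOpen U ∧ 0 ∈ U ∧
      ContDiffOn ℝ 1 φ U ∧ MapsTo φ U (Metric.ball 0 r) ∧ φ 0 = 0 ∧ (∀ ξ ∈ U, (φ ξ).1 = ξ) ∧
      ∀ z, (∃ x : ℕ → Es × Eu, x 0 = z ∧ (∀ j, x (j + 1) = g (x j)) ∧
        (∀ j, x j ∈ Metric.ball 0 r) ∧ Tendsto x atTop (𝓝 0)) ↔ z.1 ∈ U ∧ φ z.1 = z := by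
  obtain ⟨V₀, hV₀, hgV₀⟩ := hg.contDiffOn (m := 1) le_rfl (by simp)
  obtain ⟨g', V, hg'c, hg's, hV, h0V, -, hgV⟩ := exists_compactSupport_extension isOpen_interior
    (hgV₀.mono interior_subset) (isCompact_singleton (x := (0 : Es × Eu)))
    (by simpa using mem_interior_iff_mem_nhds.2 hV₀)
  have h0V : V ∈ 𝓝 (0 : Es × Eu) := hV.mem_nhds (h0V rfl)
  have hg'0 : g' 0 = 0 := by rw [hgV 0 (mem_of_mem_nhds h0V), hg0]
  have hder : HasFDerivAt g' (As.prodMap Au) 0 :=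
    hg'.congr_of_eventuallyEq (by filter_upwards [h0V] with x hx using hgV x hx)
  have hU1 : UniformC1 fun x => g' x - As.prodMap Au x :=
    (UniformC1.of_hasCompactSupport hg'c hg's).sub_clm _
  obtain ⟨N, D, hN, hND, hNe, hDe⟩ := exists_superposition_nullSeq hU1
    (by rw [hg'0, map_zero, sub_zero])
  have hD0 : D 0 = 0 := by
    ext1 h
    refine ZeroAtInftyContinuousMap.ext fun j => ?_
    rw [hDe]
    have : HasFDerivAt (fun x => g' x - As.prodMap Au x) (As.prodMap Au - As.prodMap Au) 0 :=
      hder.sub (As.prodMap Au).hasFDerivAt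
    rw [sub_self] at this
    change fderiv ℝ _ 0 (h j) = 0
    rw [this.fderiv]
    rfl
  -- The orbit equation is solved forward in the stable component and backward in the unstable one:
  -- `x_{j+1}.1 = As x_j.1 + …` and `x_j.2 = Bu x_{j+1}.2 - Bu (…)`. `K` is the linear part, a
  -- contraction, and `J` places the nonlinear terms.
  obtain ⟨K, hK, hK0, hKs⟩ := exists_shift (As ∘L .fst ℝ Es Eu) (Bu ∘L .snd ℝ Es Eu) 0
  obtain ⟨J, -, hJ0, hJs⟩ := exists_shift (.fst ℝ Es Eu) 0 (-(Bu ∘L .snd ℝ Es Eu))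
  obtain ⟨ι, hι0, hιs⟩ := exists_initial (Es := Es) (Eu := Eu)
  have hK1 : ‖K‖ < 1 := by
    refine hK.trans_lt (max_lt ?_ ?_)
    · refine (ContinuousLinearMap.opNorm_comp_le _ _).trans_lt ?_
      calc ‖As‖ * ‖ContinuousLinearMap.fst ℝ Es Eu‖ ≤ ‖As‖ * 1 := by
            gcongr; exact ContinuousLinearMap.norm_fst_le ..
        _ < 1 := by simpa
    · rw [norm_zero, add_zero]
      refine (ContinuousLinearMap.opNorm_comp_le _ _).trans_lt ?_
      calc ‖Bu‖ * ‖ContinuousLinearMap.snd ℝ Es Eu‖ ≤ ‖Bu‖ * 1 := by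
            gcongr; exact ContinuousLinearMap.norm_snd_le ..
        _ < 1 := by simpa
  set H : C₀(ℕ, Es × Eu) → C₀(ℕ, Es × Eu) := fun x => x - K x - J (N x) with hH
  have hHc : ContDiff ℝ 1 H := (contDiff_id.sub K.contDiff).sub (J.contDiff.comp hN)
  let e : C₀(ℕ, Es × Eu) ≃L[ℝ] C₀(ℕ, Es × Eu) :=
    ContinuousLinearEquiv.unitsEquiv ℝ _ (Units.oneSub K hK1)
  have hHd : HasFDerivAt H (e : C₀(ℕ, Es × Eu) →L[ℝ] C₀(ℕ, Es × Eu)) 0 := by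
    have h1 := ((hasFDerivAt_id (𝕜 := ℝ) (0 : C₀(ℕ, Es × Eu))).sub K.hasFDerivAt).sub
      (J.hasFDerivAt.comp 0 (hND 0))
    rw [hD0, ContinuousLinearMap.comp_zero, sub_zero] at h1
    exact h1
  have hH0 : H 0 = 0 := by
    have hN0 : N 0 = 0 := ZeroAtInftyContinuousMap.ext fun j => by
      rw [hNe]
      change g' 0 - As.prodMap Au 0 = 0
      rw [hg'0, map_zero, sub_zero]
    simp [hH, hN0]
  -- `H x = ι ξ` encodes the orbits that tend to zero and have stable component `ξ` at time zero;
  -- the initial unstable component is left free.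
  have horb : ∀ (x : C₀(ℕ, Es × Eu)) (ξ : Es),
      H x = ι ξ ↔ (x 0).1 = ξ ∧ ∀ j, x (j + 1) = g' (x j) := by
    intro x ξ
    have key : ∀ j, ((x j).2 = Bu ((x (j + 1)).2) - Bu ((g' (x j)).2 - Au (x j).2)) ↔
        (x (j + 1)).2 = (g' (x j)).2 := by
      intro j
      rw [map_sub, hBA]
      constructor
      · intro h
        have h2 : Bu (x (j + 1)).2 = Bu (g' (x j)).2 := by
          have h3 := sub_eq_zero.2 h
          rw [← sub_eq_zero, ← neg_eq_zero, ← h3]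
          abel
        rw [← hAB (x (j + 1)).2, h2, hAB]
      · intro h
        rw [h]
        abel
    have h0 : H x 0 = ι ξ 0 ↔ (x 0).1 = ξ ∧ (x 1).2 = (g' (x 0)).2 := by
      rw [← key 0]
      simp only [hH, ZeroAtInftyContinuousMap.sub_apply, hK0, hJ0, hι0, hNe, Prod.ext_iff,
        Prod.fst_sub, Prod.snd_sub]
      simp [sub_eq_iff_eq_add]
      exact fun _ => Eq.congr_right (by abel)
    have hs : ∀ j, H x (j + 1) = ι ξ (j + 1) ↔
        (x (j + 1)).1 = (g' (x j)).1 ∧ (x (j + 2)).2 = (g' (x (j + 1))).2 := by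
      intro j
      rw [← key (j + 1)]
      simp only [hH, ZeroAtInftyContinuousMap.sub_apply, hKs, hJs, hιs, hNe, Prod.ext_iff,
        Prod.fst_sub, Prod.snd_sub]
      simp [sub_eq_iff_eq_add]
      exact fun _ => Eq.congr_right (by abel)
    constructor
    · intro h
      refine ⟨(h0.1 (by rw [h])).1, fun j => Prod.ext ((hs j).1 (by rw [h])).1 ?_⟩
      cases j with
      | zero => exact (h0.1 (by rw [h])).2
      | succ i => exact ((hs i).1 (by rw [h])).2
    · rintro ⟨h1, h2⟩
      refine ZeroAtInftyContinuousMap.ext fun j => ?_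
      cases j with
      | zero => exact h0.2 ⟨h1, by rw [h2 0]⟩
      | succ i => exact (hs i).2 ⟨by rw [h2 i], by rw [h2 (i + 1)]⟩
  obtain ⟨U, W, G, hU, hW, h0U, h0W, -, hUW, hWU, hl, hr, -, hGc⟩ :=
    exists_local_inverse hHc.contDiffAt hHd univ_mem
  rw [hH0] at h0W
  have hG0 : G 0 = 0 := by
    have := hl 0 h0U
    rwa [hH0] at this
  -- `r₁` keeps sequences in the domain where `H` is inverted, `r₂` keeps their terms where `g'`
  -- agrees with `g`.
  obtain ⟨r₁, hr₁, hr₁U⟩ := Metric.isOpen_iff.1 hU 0 h0U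
  obtain ⟨r₂, hr₂, hr₂V⟩ := Metric.mem_nhds_iff.1 (inter_mem hA h0V)
  have hrr : Metric.ball (0 : Es × Eu) (min r₁ r₂) ⊆ A ∩ V :=
    (Metric.ball_subset_ball (min_le_right _ _)).trans hr₂V
  have hGo : IsOpen (W ∩ G ⁻¹' Metric.ball 0 (min r₁ r₂)) :=
    hGc.continuousOn.isOpen_inter_preimage hW Metric.isOpen_ball
  have hφ1 : ∀ ξ, ι ξ ∈ W → (G (ι ξ) 0).1 = ξ := fun ξ hξ => ((horb _ ξ).1 (hr _ hξ)).1
  have hGr : ∀ x : C₀(ℕ, Es × Eu), x ∈ Metric.ball 0 (min r₁ r₂) →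
      ∀ j, x j ∈ Metric.ball 0 (min r₁ r₂) := by
    intro x hx j
    rw [mem_ball_zero_iff] at hx ⊢
    exact (norm_apply_le_norm _ _).trans_lt hx
  refine ⟨min r₁ r₂, ι ⁻¹' (W ∩ G ⁻¹' Metric.ball 0 (min r₁ r₂)), fun ξ => G (ι ξ) 0,
    lt_min hr₁ hr₂, hrr.trans inter_subset_left, hGo.preimage ι.continuous, ?_, ?_, ?_, ?_, ?_, ?_⟩
  · simpa [h0W, hG0] using ⟨hr₁, hr₂⟩
  · exact (evalNull (E := Es × Eu) 0).contDiff.comp_contDiffOn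
      (hGc.comp ι.contDiff.contDiffOn fun ξ hξ => hξ.1)
  · intro ξ hξ
    exact hGr _ hξ.2 0
  · simp [hG0]
  · intro ξ hξ
    exact hφ1 ξ hξ.1
  · intro z
    constructor
    · rintro ⟨x, rfl, hxg, hxr, hx0⟩
      have h1 : ‖nullSeq x hx0‖ < min r₁ r₂ :=
        nullSeq_norm_lt fun j => by simpa only [nullSeq_apply, mem_ball_zero_iff] using hxr j
      have h2 : nullSeq x hx0 ∈ U := hr₁U (by
        rw [mem_ball_zero_iff]
        exact h1.trans_le (min_le_left _ _))
      have h3 : H (nullSeq x hx0) = ι (x 0).1 := (horb _ _).2 ⟨rfl, fun j => by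
        simp only [nullSeq_apply]
        rw [hxg, hgV _ (hrr (hxr j)).2]⟩
      have h4 : G (ι (x 0).1) = nullSeq x hx0 := by rw [← h3, hl _ h2]
      refine ⟨⟨h3 ▸ hUW h2, ?_⟩, ?_⟩
      · rw [mem_preimage, h4, mem_ball_zero_iff]
        exact h1
      · simp only [h4, nullSeq_apply]
    · rintro ⟨⟨h1, h2⟩, h3⟩
      refine ⟨G (ι z.1), h3, fun j => ?_, hGr _ h2, tendsto_nullSeq _⟩
      rw [((horb _ _).1 (hr _ h1)).2 j, hgV _ (hrr (hGr _ h2 j)).2]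

end Sequences

end

/-! ### Flows of Lipschitz fields and their differentiability. -/

section

open scoped NNReal unitInterval

section Flow

variable {E : Type*} [NormedAddCommGroup E] [NormedSpace ℝ E]

/-- `Φ x` is the global integral curve of `f` that starts at `x`. -/
structure IsFlow (f : E → E) (Φ : E → ℝ → E) : Prop where
  apply_zero : ∀ x, Φ x 0 = x
  hasDerivAt : ∀ x t, HasDerivAt (Φ x) (f (Φ x t)) t

variable {f : E → E} {Φ : E → ℝ → E} {K : ℝ≥0}

/-- A field bounded by `C` moves a point by at most `C * T` in time `T`, so Picard-Lindelöf on a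
ball of that radius works on every interval; uniqueness glues the solutions. -/
theorem exists_isFlow [CompleteSpace E] (hf : LipschitzWith K f) {C : ℝ} (hC : ∀ x, ‖f x‖ ≤ C) :
    ∃ Φ, IsFlow f Φ := by
  have hex : ∀ (x : E) (T : ℝ), ∃ α : ℝ → E, 0 < T → α 0 = x ∧
      ∀ t ∈ Ioo (-T) T, HasDerivAt α (f (α t)) t := by
    intro x T
    rcases lt_or_ge 0 T with hT | hT
    · have hC0 : 0 ≤ C := (norm_nonneg _).trans (hC 0)
      have hpl : IsPicardLindelof (fun _ => f) (tmin := -T) (tmax := T)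
          ⟨0, by constructor <;> linarith⟩ x (C * T).toNNReal 0 C.toNNReal K :=
        IsPicardLindelof.of_time_independent
          (fun y _ => by rw [Real.coe_toNNReal C hC0]; exact hC y)
          hf.lipschitzOnWith (by
            simp only [sub_zero, zero_sub, neg_neg, max_self, NNReal.coe_zero]
            rw [Real.coe_toNNReal C hC0, Real.coe_toNNReal _ (by positivity)])
      obtain ⟨α, h0, hα⟩ := hpl.exists_eq_forall_mem_Icc_hasDerivWithinAt₀
      exact ⟨α, fun _ => ⟨h0, fun t ht =>
        (hα t (Ioo_subset_Icc_self ht)).hasDerivAt (Icc_mem_nhds ht.1 ht.2)⟩⟩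
    · exact ⟨fun _ => 0, fun h => absurd h hT.not_gt⟩
  choose α hα using hex
  -- The solution on a window of half-length `|t| + 1` is read at `t`. Near `t` all these solutions
  -- agree with the one on the window of half-length `|t| + 2`, which gives the derivative.
  refine ⟨fun x t => α x (|t| + 1) t, fun x => (hα x _ (by positivity)).1, fun x t => ?_⟩
  have hT : (0 : ℝ) < |t| + 2 := by positivity
  have huniq : ∀ s ∈ Ioo (-(|t| + 1)) (|t| + 1), α x (|s| + 1) s = α x (|t| + 2) s := by
    intro s hs
    have hs' : |s| + 1 < |t| + 2 := by
      have : |s| < |t| + 1 := abs_lt.2 hs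
      linarith
    refine ODE_solution_unique_of_mem_Ioo (v := fun _ => f) (s := fun _ => univ) (K := K)
      (a := -(|s| + 1)) (b := |s| + 1) (t₀ := 0)
      (fun _ _ => hf.lipschitzOnWith) (abs_lt.1 (by rw [abs_zero]; positivity))
      (fun r hr => ⟨(hα x _ (by positivity)).2 r hr, mem_univ _⟩)
      (fun r hr => ⟨(hα x _ hT).2 r ⟨by linarith [hr.1], by linarith [hr.2]⟩, mem_univ _⟩)
      ?_ (abs_lt.1 (lt_add_one _))
    rw [(hα x _ (by positivity)).1, (hα x _ hT).1]
  have htm : t ∈ Ioo (-(|t| + 1)) (|t| + 1) := abs_lt.1 (lt_add_one _)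
  have h1 : HasDerivAt (α x (|t| + 2)) (f (α x (|t| + 1) t)) t := by
    rw [huniq t htm]
    exact (hα x _ hT).2 t (abs_lt.1 (by linarith))
  refine h1.congr_of_eventuallyEq ?_
  filter_upwards [Ioo_mem_nhds htm.1 htm.2] with s hs using huniq s hs

namespace IsFlow

theorem continuous_right (hΦ : IsFlow f Φ) (x : E) : Continuous (Φ x) :=
  continuous_iff_continuousAt.2 fun t => (hΦ.hasDerivAt x t).continuousAt

theorem apply_add (hΦ : IsFlow f Φ) (hf : LipschitzWith K f) (x : E) (s t : ℝ) :
    Φ x (s + t) = Φ (Φ x s) t := by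
  have := ODE_solution_unique_univ (v := fun _ => f) (s := fun _ => univ) (K := K) (t₀ := 0)
    (f := fun t => Φ x (s + t)) (g := Φ (Φ x s)) (fun _ => hf.lipschitzOnWith)
    (fun t => ⟨(hΦ.hasDerivAt x (s + t)).comp_const_add s t, mem_univ _⟩)
    (fun t => ⟨hΦ.hasDerivAt _ t, mem_univ _⟩) (by simp [hΦ.apply_zero])
  exact congrFun this t

theorem apply_neg (hΦ : IsFlow f Φ) (hf : LipschitzWith K f) (x : E) (t : ℝ) :
    Φ (Φ x t) (-t) = x := by
  rw [← hΦ.apply_add hf, add_neg_cancel, hΦ.apply_zero]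

theorem apply_neg' (hΦ : IsFlow f Φ) (hf : LipschitzWith K f) (x : E) (t : ℝ) :
    Φ (Φ x (-t)) t = x := by
  rw [← hΦ.apply_add hf, neg_add_cancel, hΦ.apply_zero]

theorem eq_of_hasDerivWithinAt (hΦ : IsFlow f Φ) (hf : LipschitzWith K f) {γ : ℝ → E} {T : ℝ}
    (hγ : ∀ t ∈ Icc 0 T, HasDerivWithinAt γ (f (γ t)) (Icc 0 T) t) {t : ℝ} (ht : t ∈ Icc 0 T) :
    γ t = Φ (γ 0) t := by
  refine ODE_solution_unique (v := fun _ => f) (K := K) (a := 0) (b := T) (fun _ => hf)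
    (fun s hs => (hγ s hs).continuousWithinAt)
    (fun s hs => (hγ s (Ico_subset_Icc_self hs)).mono_of_mem_nhdsWithin
      (Icc_mem_nhdsGE_of_mem hs))
    (hΦ.continuous_right _).continuousOn (fun s _ => (hΦ.hasDerivAt _ s).hasDerivWithinAt)
    (hΦ.apply_zero _).symm ht

/-- Grönwall's inequality. It keeps nearby orbits in a tube and controls them between the grid
times. -/
theorem dist_le (hΦ : IsFlow f Φ) (hf : LipschitzWith K f) (x y : E) {t : ℝ} (ht : 0 ≤ t) :
    dist (Φ x t) (Φ y t) ≤ dist x y * Real.exp (K * t) := by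
  have := dist_le_of_trajectories_ODE (v := fun _ => f) (K := K) (a := 0) (b := t) (fun _ => hf)
    (hΦ.continuous_right x).continuousOn (fun s _ => (hΦ.hasDerivAt _ s).hasDerivWithinAt)
    (hΦ.continuous_right y).continuousOn (fun s _ => (hΦ.hasDerivAt _ s).hasDerivWithinAt)
    (δ := dist x y) (by rw [hΦ.apply_zero, hΦ.apply_zero]) t (right_mem_Icc.2 ht)
  rwa [sub_zero] at this

theorem apply_of_eq_zero (hΦ : IsFlow f Φ) (hf : LipschitzWith K f) {p : E} (hp : f p = 0)
    (t : ℝ) : Φ p t = p := by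
  have := ODE_solution_unique_univ (v := fun _ => f) (s := fun _ => univ) (K := K) (t₀ := 0)
    (f := Φ p) (g := fun _ => p) (fun _ => hf.lipschitzOnWith)
    (fun t => ⟨hΦ.hasDerivAt p t, mem_univ _⟩)
    (fun t => ⟨by rw [hp]; exact hasDerivAt_const t p, mem_univ _⟩) (by simp [hΦ.apply_zero])
  exact congrFun this t

end IsFlow

section Volterra

/-- The Volterra operator `γ ↦ ∫₀ᵗ γ`. -/
theorem exists_volterra : ∃ V : C(I, E) →L[ℝ] C(I, E), ‖V‖ ≤ 1 ∧
    ∀ γ (t : I), V γ t = ∫ s in (0 : ℝ)..t, γ (projIcc 0 1 zero_le_one s) := by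
  have hc : ∀ γ : C(I, E), Continuous fun s : ℝ => γ (projIcc 0 1 zero_le_one s) :=
    fun γ => γ.continuous.comp continuous_projIcc
  have hi : ∀ (γ : C(I, E)) (a b : ℝ),
      IntervalIntegrable (fun s : ℝ => γ (projIcc 0 1 zero_le_one s)) MeasureTheory.volume a b :=
    fun γ a b => (hc γ).intervalIntegrable a b
  let V : C(I, E) →ₗ[ℝ] C(I, E) :=
    { toFun := fun γ => ⟨fun t : I => ∫ s in (0 : ℝ)..t, γ (projIcc 0 1 zero_le_one s),
        (intervalIntegral.continuous_primitive (hi γ) 0).comp continuous_subtype_val⟩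
      map_add' := fun γ δ => by
        ext t
        simp [intervalIntegral.integral_add (hi γ _ _) (hi δ _ _)]
      map_smul' := fun c γ => by
        ext t
        simp }
  refine ⟨V.mkContinuous 1 fun γ => ?_, V.mkContinuous_norm_le zero_le_one _, fun γ t => rfl⟩
  rw [one_mul, ContinuousMap.norm_le _ (norm_nonneg _)]
  intro t
  refine (intervalIntegral.norm_integral_le_of_norm_le_const (C := ‖γ‖)
    fun s _ => γ.norm_coe_le_norm _).trans ?_
  rw [sub_zero, abs_of_nonneg t.2.1]
  exact mul_le_of_le_one_right (norm_nonneg _) t.2.2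

theorem integral_projIcc_eq [CompleteSpace E] {γ γ' : ℝ → E} (h : ∀ s, HasDerivAt γ (γ' s) s) (hc : Continuous γ')
    {δ : C(I, E)} (hδ : ∀ s : I, δ s = γ' s) (t : I) :
    ∫ s in (0 : ℝ)..t, δ (projIcc 0 1 zero_le_one s) = γ t - γ 0 := by
  rw [← intervalIntegral.integral_eq_sub_of_hasDerivAt (fun s _ => h s)
    (hc.intervalIntegrable 0 t)]
  refine intervalIntegral.integral_congr fun s hs => ?_
  rw [uIcc_of_le t.2.1] at hs
  have hs' : s ∈ Icc (0 : ℝ) 1 := ⟨hs.1, hs.2.trans t.2.2⟩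
  rw [projIcc_of_mem _ hs', hδ]

/-- The flow of a `C¹` vector field for a short time is `C¹`, and its derivative at an equilibrium
is determined by that of the field. -/
theorem IsFlow.exists_contDiff_of_small [CompleteSpace E] (hΦ : IsFlow f Φ) (hf : UniformC1 f) :
    ∃ ε₀ > 0, ∀ ε, |ε| ≤ ε₀ → ContDiff ℝ 1 (fun x => Φ x ε) ∧
      ∀ p w (c : ℝ), f p = 0 → fderiv ℝ f p w = c • w →
        fderiv ℝ (fun x => Φ x ε) p w = Real.exp (ε * c) • w := by
  obtain ⟨C, hC⟩ := hf.bound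
  have hC0 : 0 ≤ C := (norm_nonneg _).trans (hC 0)
  have hfd : Differentiable ℝ f := hf.contDiff.differentiable one_ne_zero
  have hfL : ∀ x y, ‖f x - f y‖ ≤ C * ‖x - y‖ := fun x y =>
    convex_univ.norm_image_sub_le_of_norm_fderiv_le (fun z _ => hfd z) (fun z _ => hC z)
      (mem_univ _) (mem_univ _)
  have hfK : LipschitzWith C.toNNReal f := LipschitzWith.of_dist_le_mul fun x y => by
    rw [dist_eq_norm, dist_eq_norm, Real.coe_toNNReal C hC0]
    exact hfL x y
  obtain ⟨V, hV, hVe⟩ := exists_volterra (E := E)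
  let f' : C(E, E) := ⟨f, hfd.continuous⟩
  obtain ⟨hN, D, hND, hDe⟩ := exists_hasFDerivAt_superposition (α := I) (f := f') hf
  set N : C(I, E) → C(I, E) := superposition f' with hNdef
  have hVle : ∀ γ, ‖V γ‖ ≤ ‖γ‖ := fun γ => by simpa using V.le_of_opNorm_le hV γ
  -- This size makes `ε` times the integral operator a contraction at every base curve.
  refine ⟨1 / (2 * (C + 1)), by positivity, fun ε hε => ?_⟩
  have hεC : |ε| * C < 1 := by
    calc |ε| * C ≤ 1 / (2 * (C + 1)) * C := by gcongr
      _ < 1 := by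
        rw [div_mul_eq_mul_div, div_lt_one (by positivity)]
        linarith
  -- With time rescaled to `[0, 1]`, `H γ = const x` is the integral equation of the curve from `x`
  -- with speed `ε`.
  set H : C(I, E) → C(I, E) := fun γ => γ - ε • V (N γ) with hH
  have hHc : ContDiff ℝ 1 H := contDiff_id.sub ((V.contDiff.comp hN).const_smul ε)
  have hHinj : Function.Injective H := by
    intro γ δ h
    have h1 : γ - δ = ε • V (N γ - N δ) := by
      have : γ - ε • V (N γ) = δ - ε • V (N δ) := h
      rw [map_sub, smul_sub, sub_eq_sub_iff_add_eq_add, add_comm, ← sub_eq_sub_iff_add_eq_add]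
      rw [sub_eq_sub_iff_add_eq_add] at this ⊢
      rw [add_comm, this, add_comm]
    have h2 : ‖N γ - N δ‖ ≤ C * ‖γ - δ‖ := by
      rw [ContinuousMap.norm_le _ (by positivity)]
      intro t
      exact (hfL _ _).trans (by gcongr; exact (γ - δ).norm_coe_le_norm t)
    have h3 : ‖γ - δ‖ ≤ |ε| * C * ‖γ - δ‖ := by
      calc ‖γ - δ‖ = |ε| * ‖V (N γ - N δ)‖ := by rw [h1, norm_smul, Real.norm_eq_abs]
        _ ≤ |ε| * (C * ‖γ - δ‖) := by
          gcongr
          exact (hVle _).trans h2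
        _ = _ := by ring
    by_contra hne
    have : 0 < ‖γ - δ‖ := norm_pos_iff.2 (sub_ne_zero.2 hne)
    nlinarith
  have hVD : ∀ γ, ‖ε • V ∘L D γ‖ < 1 := by
    intro γ
    have hDn : ‖D γ‖ ≤ C := by
      refine ContinuousLinearMap.opNorm_le_bound _ hC0 fun h => ?_
      rw [ContinuousMap.norm_le _ (by positivity)]
      intro t
      rw [hDe]
      refine (ContinuousLinearMap.le_opNorm _ _).trans ?_
      gcongr
      · exact hC _
      · exact h.norm_coe_le_norm t
    refine lt_of_le_of_lt (ContinuousLinearMap.opNorm_le_bound _ (by positivity) fun h => ?_) hεC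
    change ‖ε • V (D γ h)‖ ≤ _
    rw [norm_smul, Real.norm_eq_abs, mul_assoc]
    gcongr
    exact (hVle _).trans ((D γ).le_of_opNorm_le hDn h)
  let e : C(I, E) → C(I, E) ≃L[ℝ] C(I, E) := fun γ =>
    ContinuousLinearEquiv.unitsEquiv ℝ _ (Units.oneSub (ε • V ∘L D γ) (hVD γ))
  have hHd : ∀ γ, HasFDerivAt H (e γ : C(I, E) →L[ℝ] C(I, E)) γ := fun γ =>
    (hasFDerivAt_id (𝕜 := ℝ) γ).sub ((V.hasFDerivAt.comp γ (hND γ)).const_smul ε)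
  have hee : ∀ γ h, e γ h = h - ε • V (D γ h) := fun γ h => rfl
  let S : E → C(I, E) := fun x =>
    ⟨fun t => Φ x (ε * t), (hΦ.continuous_right x).comp (by fun_prop)⟩
  have hSe : ∀ x (t : I), S x t = Φ x (ε * t) := fun x t => rfl
  let κ : E →L[ℝ] C(I, E) := ContinuousLinearMap.const ℝ I
  have hκe : ∀ x (t : I), κ x t = x := fun x t => rfl
  have hS : ∀ x, H (S x) = κ x := by
    intro x
    ext t
    have hd : ∀ s : ℝ, HasDerivAt (fun s => Φ x (ε * s)) (ε • f (Φ x (ε * s))) s := fun s => by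
      have := (hΦ.hasDerivAt x (ε * s)).scomp s ((hasDerivAt_id s).const_mul ε)
      simpa [Function.comp_def] using this
    have hd' : Continuous fun s : ℝ => ε • f (Φ x (ε * s)) :=
      (hfd.continuous.comp ((hΦ.continuous_right x).comp (by fun_prop))).const_smul ε
    have := integral_projIcc_eq hd hd' (δ := ε • N (S x)) (fun s => rfl) t
    rw [← hVe, map_smul] at this
    change S x t - (ε • V (N (S x))) t = x
    rw [this, hSe, mul_zero, hΦ.apply_zero]
    abel
  -- Injectivity of `H` identifies the local inverse at the constant curves with the solution map
  -- `S`.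
  have hScd : ContDiff ℝ 1 S := by
    refine contDiff_iff_contDiffAt.2 fun x => ?_
    obtain ⟨U, W, G, hU, hW, h0U, h0W, -, -, -, hl, hr, -, hGc⟩ :=
      exists_local_inverse hHc.contDiffAt (hHd (S x)) univ_mem
    rw [hS] at h0W
    refine ((hGc.contDiffAt (hW.mem_nhds h0W)).comp x κ.contDiff.contDiffAt).congr_of_eventuallyEq ?_
    filter_upwards [(hW.preimage κ.continuous).mem_nhds h0W] with y hy
    exact hHinj (by rw [hS, Function.comp_apply, hr _ hy])
  let ev : C(I, E) →L[ℝ] E := ContinuousMap.evalCLM ℝ (1 : I)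
  have hΦS : (fun x => Φ x ε) = fun x => ev (S x) := by
    ext x
    change Φ x ε = Φ x (ε * ((1 : I) : ℝ))
    simp
  refine ⟨by rw [hΦS]; exact ev.contDiff.comp hScd, fun p w c hp hw => ?_⟩
  have hSp : ∀ t, S p t = p := fun t => hΦ.apply_of_eq_zero hfK hp _
  have hSd := ((hScd.differentiable one_ne_zero) p).hasFDerivAt
  have h1 : (e (S p) : C(I, E) →L[ℝ] C(I, E)) ∘L fderiv ℝ S p = κ := by
    refine ((hHd (S p)).comp p hSd).unique ?_
    rw [show H ∘ S = κ from funext hS]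
    exact κ.hasFDerivAt
  -- At an equilibrium the derivative of `S` solves the linearized integral equation, whose solution
  -- along an eigenvector `w` is exponential.
  let z : C(I, E) := ⟨fun t => Real.exp (ε * c * t) • w, by fun_prop⟩
  have hz : ∀ t : I, z t = Real.exp (ε * c * t) • w := fun t => rfl
  have h2 : e (S p) z = κ w := by
    ext t
    rw [hee, hκe]
    have hd : ∀ s : ℝ, HasDerivAt (fun s => Real.exp (ε * c * s) • w)
        ((Real.exp (ε * c * s) * (ε * c)) • w) s := fun s => by
      have := (((hasDerivAt_id s).const_mul (ε * c)).exp).smul_const w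
      simpa using this
    have hd' : Continuous fun s : ℝ => (Real.exp (ε * c * s) * (ε * c)) • w := by fun_prop
    have := integral_projIcc_eq hd hd' (δ := ε • D (S p) z) (fun s => by
      rw [ContinuousMap.smul_apply, hDe, hSp, hz]
      change ε • fderiv ℝ f p _ = _
      rw [map_smul, hw, smul_smul, smul_smul]
      ring_nf) t
    rw [← hVe, map_smul] at this
    rw [ContinuousMap.sub_apply, this, hz]
    simp
  have h3 : fderiv ℝ S p w = z := by
    apply (e (S p)).injective
    rw [h2]
    exact DFunLike.congr_fun h1 w
  rw [hΦS, HasFDerivAt.fderiv (f := fun x => ev (S x)) (ev.hasFDerivAt.comp p hSd)]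
  change ev (fderiv ℝ S p w) = _
  rw [h3]
  change Real.exp (ε * c * ((1 : I) : ℝ)) • w = _
  simp

/-- The group law composes the time `t` map from `N + 1` maps of a time that is short enough. -/
theorem IsFlow.contDiff [CompleteSpace E] (hΦ : IsFlow f Φ) (hf : UniformC1 f) (hfK : LipschitzWith K f) (t : ℝ) :
    ContDiff ℝ 1 (fun x => Φ x t) := by
  obtain ⟨ε, hε, h⟩ := hΦ.exists_contDiff_of_small hf
  obtain ⟨N, hN⟩ := exists_nat_ge (|t| / ε)
  have hN1 : (0 : ℝ) < N + 1 := by positivity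
  have h1 : |t / (N + 1)| ≤ ε := by
    rw [abs_div, abs_of_pos hN1, div_le_iff₀ hN1]
    rw [div_le_iff₀ hε] at hN
    nlinarith
  have h2 : ∀ k : ℕ, ContDiff ℝ 1 fun x => Φ x (k * (t / (N + 1))) := by
    intro k
    induction k with
    | zero => simpa [hΦ.apply_zero] using contDiff_fun_id
    | succ k ih =>
      have : (fun x => Φ x (((k + 1 : ℕ) : ℝ) * (t / (N + 1)))) =
          fun x => Φ (Φ x (k * (t / (N + 1)))) (t / (N + 1)) := by
        ext x
        rw [← hΦ.apply_add hfK]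
        congr 1
        push_cast
        ring
      rw [this]
      exact (h _ h1).1.comp ih
  have h3 := h2 (N + 1)
  have h4 : ((N + 1 : ℕ) : ℝ) * (t / (N + 1)) = t := by
    push_cast
    field_simp
  rwa [h4] at h3

end Volterra

end Flow

end

/-! ### Stable curves and the global stable set. -/

section

open scoped NNReal

section Curves

variable {F : Type*} [NormedAddCommGroup F] [NormedSpace ℝ F]

/-- `γ` is an integral curve of `f` on `[0, T]` that remains in `Ω`. -/
def IsCurveOn (f : F → F) (Ω : Set F) (T : ℝ) (γ : ℝ → F) : Prop :=
  ∀ t ∈ Icc 0 T, γ t ∈ Ω ∧ HasDerivWithinAt γ (f (γ t)) (Icc 0 T) t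

/-- `γ` is an integral curve of `f` on `[0, ∞)` that remains in `S` and converges to `p`. -/
def IsStableCurve (f : F → F) (S : Set F) (p : F) (γ : ℝ → F) : Prop :=
  (∀ t ∈ Ici (0 : ℝ), γ t ∈ S ∧ HasDerivWithinAt γ (f (γ t)) (Ici 0) t) ∧
    Tendsto γ atTop (𝓝 p)

/-- The stable set of `p` for the restriction of the field `f` to `S`. -/
def stableSetOf (f : F → F) (S : Set F) (p : F) : Set F :=
  {x | ∃ γ : ℝ → F, γ 0 = x ∧ IsStableCurve f S p γ}

/-- Integral curves of `f` in `Ω` that meet `S` remain in `S`. -/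
def IsInvariant (f : F → F) (Ω S : Set F) : Prop :=
  ∀ γ T, 0 ≤ T → IsCurveOn f Ω T γ → (γ 0 ∈ S ↔ γ T ∈ S)

variable {f : F → F} {Ω S M : Set F} {p : F} {γ α β : ℝ → F} {T : ℝ}

theorem IsCurveOn.mono_time (h : IsCurveOn f Ω T γ) {T' : ℝ} (hT : T' ≤ T) :
    IsCurveOn f Ω T' γ := fun t ht =>
  have ht' : t ∈ Icc 0 T := ⟨ht.1, ht.2.trans hT⟩
  ⟨(h t ht').1, (h t ht').2.mono (Icc_subset_Icc_right hT)⟩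

theorem IsInvariant.mem_iff (hS : IsInvariant f Ω S) (h : IsCurveOn f Ω T γ) {t : ℝ}
    (ht : t ∈ Icc 0 T) : γ 0 ∈ S ↔ γ t ∈ S :=
  hS γ t ht.1 (h.mono_time ht.2)

theorem IsInvariant.isCurveOn (hS : IsInvariant f Ω S) (h : IsCurveOn f Ω T γ) (hT : 0 ≤ T)
    (hγ : γ T ∈ S) : IsCurveOn f S T γ := fun t ht =>
  ⟨(hS.mem_iff h ht).1 ((hS γ T hT h).2 hγ), (h t ht).2⟩

theorem IsStableCurve.mono_set (h : IsStableCurve f S p γ) (hS : S ⊆ Ω) :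
    IsStableCurve f Ω p γ :=
  ⟨fun t ht => ⟨hS (h.1 t ht).1, (h.1 t ht).2⟩, h.2⟩

theorem IsStableCurve.isCurveOn (h : IsStableCurve f S p γ) (T : ℝ) : IsCurveOn f S T γ :=
  fun t ht => ⟨(h.1 t ht.1).1, (h.1 t ht.1).2.mono Icc_subset_Ici_self⟩

theorem IsStableCurve.shift (h : IsStableCurve f S p γ) {s : ℝ} (hs : 0 ≤ s) :
    IsStableCurve f S p fun t => γ (s + t) := by
  refine ⟨fun t ht => ?_, h.2.comp (tendsto_atTop_add_const_left _ _ tendsto_id)⟩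
  have ht' : s + t ∈ Ici (0 : ℝ) := add_nonneg hs ht
  refine ⟨(h.1 _ ht').1, ?_⟩
  have h1 : HasDerivWithinAt (fun r : ℝ => s + r) 1 (Ici 0) t :=
    (hasDerivAt_id t).const_add s |>.hasDerivWithinAt
  have h2 := (h.1 _ ht').2.scomp t h1 fun r hr => add_nonneg hs hr
  simpa [Function.comp_def] using h2

/-- At the junction the one-sided derivatives agree, since both are the value of the field at the
same point. -/
theorem IsCurveOn.concat (hα : IsCurveOn f S T α) (hβ : IsStableCurve f S p β) (hT : 0 ≤ T)
    (h : α T = β 0) :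
    IsStableCurve f S p fun t => if t ≤ T then α t else β (t - T) := by
  set δ : ℝ → F := fun t => if t ≤ T then α t else β (t - T) with hδ
  have h1 : ∀ t, t ≤ T → δ t = α t := fun t ht => if_pos ht
  have h2 : ∀ t, T ≤ t → δ t = β (t - T) := by
    intro t ht
    rcases ht.eq_or_lt with rfl | ht
    · rw [h1 _ le_rfl, h, sub_self]
    · exact if_neg ht.not_ge
  have hα' : ∀ t ∈ Icc 0 T, HasDerivWithinAt δ (f (δ t)) (Icc 0 T) t := fun t ht => by
    rw [h1 t ht.2]
    exact (hα t ht).2.congr (fun s hs => h1 s hs.2) (h1 t ht.2)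
  have hβ' : ∀ t ∈ Ici T, HasDerivWithinAt δ (f (δ t)) (Ici T) t := fun t ht => by
    rw [h2 t ht]
    have h3 : HasDerivWithinAt (fun r : ℝ => r - T) 1 (Ici T) t :=
      (hasDerivAt_id t).sub_const T |>.hasDerivWithinAt
    have h4 := (hβ.1 (t - T) (mem_Ici.2 (sub_nonneg.2 ht))).2.scomp t h3 fun r hr => sub_nonneg.2 hr
    rw [one_smul] at h4
    exact h4.congr (fun s hs => h2 s hs) (h2 t ht)
  refine ⟨fun t ht => ⟨?_, ?_⟩, ?_⟩
  · rcases le_total t T with hc | hc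
    · rw [h1 t hc]
      exact (hα t ⟨ht, hc⟩).1
    · rw [h2 t hc]
      exact (hβ.1 _ (sub_nonneg.2 hc)).1
  · rcases lt_trichotomy t T with hc | hc | hc
    · exact (hα' t ⟨ht, hc.le⟩).mono_of_mem_nhdsWithin
        (mem_of_superset (inter_mem_nhdsWithin _ (Iio_mem_nhds hc))
          fun s hs => ⟨hs.1, (show s < T from hs.2).le⟩)
    · have := (hα' t ⟨ht, hc.le⟩).union (hβ' t hc.ge)
      rwa [Icc_union_Ici_eq_Ici hT] at this
    · exact (hβ' t hc.le).mono_of_mem_nhdsWithin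
        (mem_nhdsWithin_of_mem_nhds (Ici_mem_nhds hc))
  · refine (hβ.2.comp (tendsto_atTop_add_const_right _ (-T) tendsto_id)).congr' ?_
    filter_upwards [eventually_ge_atTop T] with t ht
    rw [h2 t ht]
    rfl

theorem IsCurveOn.continuousOn (h : IsCurveOn f Ω T γ) : ContinuousOn γ (Icc 0 T) :=
  fun t ht => (h t ht).2.continuousWithinAt

/-- The points whose stable curve visits `N` at all times `ε j` with `j ≥ k`. -/
def stablePiece (f : F → F) (S : Set F) (p : F) (ε : ℝ) (N : Set F) (k : ℕ) : Set F :=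
  {x | ∃ γ : ℝ → F, γ 0 = x ∧ IsStableCurve f S p γ ∧ ∀ j : ℕ, k ≤ j → γ (ε * j) ∈ N}

theorem stablePiece_mono {ε : ℝ} {N : Set F} {i j : ℕ} (hij : i ≤ j) :
    stablePiece f S p ε N i ⊆ stablePiece f S p ε N j := by
  rintro x ⟨γ, h0, hγ, h⟩
  exact ⟨γ, h0, hγ, fun l hl => h l (hij.trans hl)⟩

variable [FiniteDimensional ℝ F]

theorem exists_flow_of_hasCompactSupport {g : F → F} (hg : ContDiff ℝ 1 g)
    (hs : HasCompactSupport g) : ∃ (K : ℝ≥0) (Φ : F → ℝ → F), LipschitzWith K g ∧ IsFlow g Φ := by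
  obtain ⟨K, hK⟩ := hg.lipschitzWith_of_hasCompactSupport hs one_ne_zero
  obtain ⟨C, hC⟩ := hs.exists_bound_of_continuous hg.continuous
  obtain ⟨Φ, hΦ⟩ := exists_isFlow hK hC
  exact ⟨K, Φ, hK, hΦ⟩

/-- The field is not assumed Lipschitz on `Ω`, but both curves have compact images, near which it
agrees with a compactly supported field that has a flow. -/
theorem IsCurveOn.eqOn (hΩ : IsOpen Ω) (hf : ContDiffOn ℝ 1 f Ω) (hα : IsCurveOn f Ω T α)
    (hβ : IsCurveOn f Ω T β) (h : α 0 = β 0) {t : ℝ} (ht : t ∈ Icc 0 T) : α t = β t := by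
  obtain ⟨g, V, hg, hgs, hV, hCV, hVΩ, hgf⟩ := exists_compactSupport_extension hΩ hf
    ((isCompact_Icc.image_of_continuousOn hα.continuousOn).union
      (isCompact_Icc.image_of_continuousOn hβ.continuousOn))
    (union_subset (image_subset_iff.2 fun t ht => (hα t ht).1)
      (image_subset_iff.2 fun t ht => (hβ t ht).1))
  obtain ⟨K, Φ, hK, hΦ⟩ := exists_flow_of_hasCompactSupport hg hgs
  rw [hΦ.eq_of_hasDerivWithinAt hK (γ := α) (T := T) (fun s hs => ?_) ht,
    hΦ.eq_of_hasDerivWithinAt hK (γ := β) (T := T) (fun s hs => ?_) ht, h]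
  · rw [hgf _ (hCV (Or.inr (mem_image_of_mem _ hs)))]
    exact (hβ s hs).2
  · rw [hgf _ (hCV (Or.inl (mem_image_of_mem _ hs)))]
    exact (hα s hs).2

/-- Near an integral curve of a `C¹` field the integral curves are given by a `C¹` flow. -/
theorem IsCurveOn.exists_tube (hΩ : IsOpen Ω) (hf : ContDiffOn ℝ 1 f Ω)
    (hγ : IsCurveOn f Ω T γ) :
    ∃ (Φ : F → ℝ → F) (Θ' : F → F) (D : Set F), ContDiff ℝ 1 (fun x => Φ x T) ∧
      ContDiff ℝ 1 Θ' ∧ (∀ y, Θ' (Φ y T) = y) ∧ (∀ y, Φ (Θ' y) T = y) ∧ IsOpen D ∧ γ 0 ∈ D ∧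
      (∀ y ∈ D, IsCurveOn f Ω T (Φ y)) ∧ (∀ y, Φ y 0 = y) ∧
      ∀ t, Continuous fun x => Φ x t := by
  obtain ⟨g, V, hg, hgs, hV, hCV, hVΩ, hgf⟩ := exists_compactSupport_extension hΩ hf
    (isCompact_Icc.image_of_continuousOn hγ.continuousOn)
    (image_subset_iff.2 fun t ht => (hγ t ht).1)
  obtain ⟨K, Φ, hK, hΦ⟩ := exists_flow_of_hasCompactSupport hg hgs
  have hU := UniformC1.of_hasCompactSupport hg hgs
  have hγΦ : ∀ t ∈ Icc 0 T, γ t = Φ (γ 0) t := fun t ht =>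
    hΦ.eq_of_hasDerivWithinAt hK (fun s hs => by
      rw [hgf _ (hCV (mem_image_of_mem _ hs))]
      exact (hγ s hs).2) ht
  -- Up to time `T` distances grow at most by the factor `exp (K * T)`, which fixes the radius of
  -- `D` below.
  obtain ⟨δ, hδ, hδV⟩ := (isCompact_Icc.image_of_continuousOn
    hγ.continuousOn).exists_thickening_subset_open hV hCV
  refine ⟨Φ, fun y => Φ y (-T), Metric.ball (γ 0) (δ * Real.exp (-(K * T))),
    hΦ.contDiff hU hK T, hΦ.contDiff hU hK (-T), fun y => hΦ.apply_neg hK y T,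
    fun y => hΦ.apply_neg' hK y T, Metric.isOpen_ball, Metric.mem_ball_self (by positivity),
    fun y hy t ht => ?_, hΦ.apply_zero, fun t => (hΦ.contDiff hU hK t).continuous⟩
  have hyV : Φ y t ∈ V := by
    refine hδV (Metric.mem_thickening_iff.2 ⟨γ t, mem_image_of_mem _ ht, ?_⟩)
    rw [hγΦ t ht]
    refine (hΦ.dist_le hK y (γ 0) ht.1).trans_lt ?_
    calc dist y (γ 0) * Real.exp (K * t) ≤ dist y (γ 0) * Real.exp (K * T) := by
          gcongr
          exact ht.2
      _ < δ * Real.exp (-(K * T)) * Real.exp (K * T) := by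
          gcongr
          exact hy
      _ = δ := by rw [mul_assoc, ← Real.exp_add, neg_add_cancel, Real.exp_zero, mul_one]
  refine ⟨hVΩ hyV, ?_⟩
  rw [← hgf _ hyV]
  exact (hΦ.hasDerivAt y t).hasDerivWithinAt

/-- The global stable set is an injectively immersed manifold if its local part is an embedded
one. -/
theorem immersedDim_stableSetOf {d : ℕ} {ε : ℝ} {N : Set F} (hΩ : IsOpen Ω)
    (hf : ContDiffOn ℝ 1 f Ω) (hS : IsInvariant f Ω S) (hSΩ : S ⊆ Ω) (hpS : p ∈ S)
    (hfp : f p = 0) (hε : 0 < ε) (hN : IsOpen N) (hpN : p ∈ N)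
    (hloc : IsC1Submanifold d (stablePiece f S p ε N 0)) :
    ImmersedDim d (stableSetOf f S p) := by
  refine ⟨⟨p, fun _ => p, rfl, fun t _ => ⟨hpS, ?_⟩, tendsto_const_nhds⟩,
    stablePiece f S p ε N, fun k x hx => ?_, fun i j => ?_, ?_⟩
  · rw [hfp]
    exact hasDerivWithinAt_const _ _ _
  · obtain ⟨γ, h0, hγ, hγN⟩ := hx
    have hεk : 0 ≤ ε * k := by positivity
    obtain ⟨Φ, Θ', D, hΘ, hΘ', hl, hr, hD, hxD, hDΩ, hΦ0, -⟩ :=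
      ((hγ.mono_set hSΩ).isCurveOn (ε * k)).exists_tube hΩ hf
    rw [h0] at hxD
    have huniq : ∀ y ∈ D, ∀ α, IsStableCurve f S p α → α 0 = y → α (ε * k) = Φ y (ε * k) :=
      fun y hy α hα hα0 => ((hα.mono_set hSΩ).isCurveOn _).eqOn hΩ hf (hDΩ y hy)
        (by rw [hα0, hΦ0]) (right_mem_Icc.2 hεk)
    -- The `k`-th piece is locally the preimage of the zeroth one under the flow of time `ε * k`.
    have hS' : ∀ y ∈ D, y ∈ stablePiece f S p ε N k ↔ Φ y (ε * k) ∈ stablePiece f S p ε N 0 := by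
      intro y hy
      constructor
      · rintro ⟨α, hα0, hα, hαN⟩
        refine ⟨fun t => α (ε * k + t), ?_, hα.shift hεk, fun j _ => ?_⟩
        · simp only [add_zero]
          exact huniq y hy α hα hα0
        · have := hαN (k + j) (by omega)
          push_cast at this
          rwa [mul_add] at this
      · rintro ⟨β, hβ0, hβ, hβN⟩
        have hc := (hS.isCurveOn (hDΩ y hy) hεk
          (by rw [← hβ0]; exact (hβ.1 0 self_mem_Ici).1)).concat hβ hεk hβ0.symm
        refine ⟨_, ?_, hc, fun j hj => ?_⟩
        · simp only [hεk, if_true, hΦ0]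
        · obtain ⟨i, rfl⟩ := Nat.exists_eq_add_of_le hj
          have hi := hβN i (Nat.zero_le _)
          have he : ε * ((k + i : ℕ) : ℝ) - ε * k = ε * i := by push_cast; ring
          -- The first branch is the junction time itself, where both curves pass through `β 0`.
          split_ifs with hcond
          · have h1 : ε * i ≤ 0 := by rw [← he]; linarith
            have h2 : ε * (i : ℝ) = 0 := le_antisymm h1 (by positivity)
            have h3 : ε * ((k + i : ℕ) : ℝ) = ε * k := by linarith
            rw [h3, ← hβ0, ← h2]
            exact hi
          · rw [he]
            exact hi
    have hW : HasC1Chart d (stablePiece f S p ε N 0) (Φ x (ε * k)) :=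
      hloc _ ((hS' x hxD).1 ⟨γ, h0, hγ, hγN⟩)
    exact hW.preimage (Θ := fun y => Φ y (ε * k)) hΘ hΘ' hl hr hD hxD hS'
  · rcases le_total i j with hij | hij
    · refine ⟨univ, isOpen_univ, ?_⟩
      rw [inter_univ, inter_eq_left]
      exact stablePiece_mono hij
    -- A point of the larger piece `i` lies in piece `j` if it visits `N` at the finitely many times
    -- `ε * l`, `j ≤ l < i`, which is an open condition.
    · have hD : ∀ x ∈ stablePiece f S p ε N j, ∃ D, IsOpen D ∧ x ∈ D ∧
          stablePiece f S p ε N i ∩ D ⊆ stablePiece f S p ε N j := by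
        rintro x ⟨γ, h0, hγ, hγN⟩
        obtain ⟨Φ, Θ', D, -, -, -, -, hD, hxD, hDΩ, hΦ0, hΦc⟩ :=
          ((hγ.mono_set hSΩ).isCurveOn (ε * i)).exists_tube hΩ hf
        rw [h0] at hxD
        have hmem : ∀ l : ℕ, l ≤ i → ε * (l : ℝ) ∈ Icc 0 (ε * (i : ℝ)) := fun l hl =>
          ⟨by positivity, by gcongr⟩
        have huniq : ∀ y ∈ D, ∀ α, IsStableCurve f S p α → α 0 = y → ∀ l : ℕ, l ≤ i →
            α (ε * l) = Φ y (ε * l) := fun y hy α hα hα0 l hl =>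
          ((hα.mono_set hSΩ).isCurveOn _).eqOn hΩ hf (hDΩ y hy) (by rw [hα0, hΦ0]) (hmem l hl)
        refine ⟨D ∩ ⋂ l ∈ Finset.Ico j i, (fun y => Φ y (ε * l)) ⁻¹' N,
          hD.inter (isOpen_biInter_finset fun l _ => hN.preimage (hΦc _)), ⟨hxD, ?_⟩, ?_⟩
        · refine mem_iInter₂.2 fun l hl => ?_
          rw [Finset.mem_Ico] at hl
          rw [mem_preimage, ← huniq x hxD γ hγ h0 l hl.2.le]
          exact hγN l hl.1
        · rintro y ⟨⟨α, hα0, hα, hαN⟩, hyD, hy⟩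
          refine ⟨α, hα0, hα, fun l hl => ?_⟩
          rcases lt_or_ge l i with hli | hli
          · rw [huniq y hyD α hα hα0 l hli.le]
            exact mem_iInter₂.1 hy l (Finset.mem_Ico.2 ⟨hl, hli⟩)
          · exact hαN l hli
      choose! D hDo hxD hDs using hD
      refine ⟨⋃ x ∈ stablePiece f S p ε N j, D x, isOpen_biUnion hDo, ?_⟩
      refine Subset.antisymm (fun x hx => ⟨hx.1, mem_biUnion hx.2 (hxD x hx.2)⟩) ?_
      rintro y ⟨hy, hy2⟩
      obtain ⟨x, hx, hyx⟩ := mem_iUnion₂.1 hy2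
      exact ⟨hy, hDs x hx ⟨hy, hyx⟩⟩
  · refine Subset.antisymm ?_ (iUnion_subset fun k => ?_)
    · rintro x ⟨γ, h0, hγ⟩
      have h1 : Tendsto (fun j : ℕ => γ (ε * j)) atTop (𝓝 p) :=
        hγ.2.comp (tendsto_natCast_atTop_atTop.const_mul_atTop hε)
      obtain ⟨k, hk⟩ := (h1.eventually (hN.mem_nhds hpN)).exists_forall_of_atTop
      exact mem_iUnion.2 ⟨k, γ, h0, hγ, hk⟩
    · rintro x ⟨γ, h0, hγ, -⟩
      exact ⟨γ, h0, hγ⟩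

end Curves

end

/-! ### Stable manifold theorem for a hyperbolic equilibrium. -/

section

open scoped NNReal

section Diagonal

variable {ι κ : Type*} [Fintype ι] [Fintype κ]

/-- The diagonal operator with the given entries. -/
noncomputable def diagCLM (c : ι → ℝ) : (ι → ℝ) →L[ℝ] ι → ℝ :=
  ContinuousLinearMap.pi fun i => c i • ContinuousLinearMap.proj i

omit [Fintype ι] in
@[simp]
theorem diagCLM_apply (c ξ : ι → ℝ) (i : ι) : diagCLM c ξ i = c i * ξ i := rfl

theorem norm_diagCLM_lt_one {c : ι → ℝ} (hc : ∀ i, |c i| < 1) : ‖diagCLM c‖ < 1 := by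
  refine lt_of_le_of_lt (ContinuousLinearMap.opNorm_le_bound _ (norm_nonneg c) fun ξ => ?_)
    ((pi_norm_lt_iff zero_lt_one).2 hc)
  refine (pi_norm_le_iff_of_nonneg (by positivity)).2 fun i => ?_
  rw [diagCLM_apply, norm_mul]
  gcongr <;> exact norm_le_pi_norm _ i

/-- A linear map that has the coordinate vectors as eigenvectors, relative to another one. -/
theorem comp_prodMap_diagCLM [DecidableEq ι] [DecidableEq κ] {F : Type*} [NormedAddCommGroup F]
    [NormedSpace ℝ F] {B B' : (ι → ℝ) × (κ → ℝ) →L[ℝ] F} {c : ι → ℝ} {d : κ → ℝ}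
    (hc : ∀ i, B' (Pi.single i 1, 0) = c i • B (Pi.single i 1, 0))
    (hd : ∀ i, B' (0, Pi.single i 1) = d i • B (0, Pi.single i 1)) :
    B' = B ∘L (diagCLM c).prodMap (diagCLM d) := by
  have hdec : ∀ (L : (ι → ℝ) × (κ → ℝ) →L[ℝ] F) (ξ : ι → ℝ) (η : κ → ℝ),
      L (ξ, η) = ∑ i, ξ i • L (Pi.single i 1, 0) + ∑ i, η i • L (0, Pi.single i 1) := by
    intro L ξ η
    have h1 : (ξ, (0 : κ → ℝ)) = ∑ i, ξ i • ((Pi.single i 1 : ι → ℝ), (0 : κ → ℝ)) := by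
      refine Prod.ext ?_ ?_
      · rw [Prod.fst_sum]
        exact pi_eq_sum_univ' ξ
      · rw [Prod.snd_sum]
        simp
    have h2 : ((0 : ι → ℝ), η) = ∑ i, η i • ((0 : ι → ℝ), (Pi.single i 1 : κ → ℝ)) := by
      refine Prod.ext ?_ ?_
      · rw [Prod.fst_sum]
        simp
      · rw [Prod.snd_sum]
        exact pi_eq_sum_univ' η
    have h3 : (ξ, η) = (ξ, (0 : κ → ℝ)) + ((0 : ι → ℝ), η) := by simp
    rw [h3, map_add, h1, h2, map_sum, map_sum]
    simp_rw [map_smul]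
  refine ContinuousLinearMap.ext fun ⟨ξ, η⟩ => ?_
  rw [hdec B', ContinuousLinearMap.comp_apply]
  change _ = B (diagCLM c ξ, diagCLM d η)
  rw [hdec B]
  simp_rw [hc, hd, diagCLM_apply, smul_smul, mul_comm]

end Diagonal

section LocalStable

variable {F : Type*} [NormedAddCommGroup F] [NormedSpace ℝ F] [FiniteDimensional ℝ F]
  {ι κ : Type*} [Fintype ι] [Fintype κ] [DecidableEq ι] [DecidableEq κ]

/-- The stable manifold theorem for a hyperbolic equilibrium of a vector field on a submanifold
`M`, relative to an invariant subset `S` of `M` (a half of `M`, for instance). -/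
theorem immersedDim_stableSetOf_of_hyperbolic {f : F → F} {Ω M S O₀ : Set F} {p : F}
    {U₀ : Set ((ι → ℝ) × (κ → ℝ))} {φ : (ι → ℝ) × (κ → ℝ) → F} {ψ : F → (ι → ℝ) × (κ → ℝ)}
    {c : ι → ℝ} {d : κ → ℝ} {ℓ : (ι → ℝ) →ₗ[ℝ] ℝ}
    (hΩ : IsOpen Ω) (hf : ContDiffOn ℝ 1 f Ω) (hfp : f p = 0) (hpS : p ∈ S) (hSM : S ⊆ M)
    (hMΩ : M ⊆ Ω) (hM : IsInvariant f Ω M) (hS : IsInvariant f Ω S)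
    (hU₀ : IsOpen U₀) (h0U₀ : 0 ∈ U₀) (hO₀ : IsOpen O₀) (hφ0 : φ 0 = p) (hφO : MapsTo φ U₀ O₀)
    (hφ : ContDiffOn ℝ 1 φ U₀) (hψ : ContDiffOn ℝ 1 ψ O₀) (hψφ : ∀ z ∈ U₀, ψ (φ z) = z)
    (hMO : ∀ x ∈ O₀, x ∈ M ↔ ψ x ∈ U₀ ∧ φ (ψ x) = x)
    (hc0 : ∀ i, c i < 0) (hd0 : ∀ i, 0 < d i)
    (hc : ∀ i, fderiv ℝ f p (fderiv ℝ φ 0 (Pi.single i 1, 0)) =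
      c i • fderiv ℝ φ 0 (Pi.single i 1, 0))
    (hd : ∀ i, fderiv ℝ f p (fderiv ℝ φ 0 (0, Pi.single i 1)) =
      d i • fderiv ℝ φ 0 (0, Pi.single i 1))
    (hℓ : ∀ᶠ x in 𝓝 p, x ∈ stableSetOf f M p → (x ∈ S ↔ 0 ≤ ℓ (ψ x).1)) :
    ImmersedDim (Fintype.card ι) (stableSetOf f S p) := by
  have hpΩ : p ∈ Ω := hMΩ (hSM hpS)
  have hpO : p ∈ O₀ := hφ0 ▸ hφO h0U₀
  have hψp : ψ p = 0 := by rw [← hφ0, hψφ 0 h0U₀]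
  obtain ⟨g, V, hg, hgs, hV, hpV, hVΩ, hgf⟩ := exists_compactSupport_extension hΩ hf
    (isCompact_singleton (x := p)) (singleton_subset_iff.2 hpΩ)
  rw [singleton_subset_iff] at hpV
  obtain ⟨K, Φ, hK, hΦ⟩ := exists_flow_of_hasCompactSupport hg hgs
  have hgU := UniformC1.of_hasCompactSupport hg hgs
  have hgp : g p = 0 := by rw [hgf p hpV, hfp]
  have hgd : fderiv ℝ g p = fderiv ℝ f p :=
    Filter.EventuallyEq.fderiv_eq (by filter_upwards [hV.mem_nhds hpV] with x hx using hgf x hx)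
  obtain ⟨ε, hε, hsmall⟩ := hΦ.exists_contDiff_of_small hgU
  obtain ⟨hTc, hTd⟩ := hsmall ε (abs_of_pos hε).le
  have hΦp : ∀ t, Φ p t = p := hΦ.apply_of_eq_zero hK hgp
  have hφd : HasFDerivAt φ (fderiv ℝ φ 0) 0 :=
    ((hφ.contDiffAt (hU₀.mem_nhds h0U₀)).differentiableAt one_ne_zero).hasFDerivAt
  have hψd : HasFDerivAt ψ (fderiv ℝ ψ p) p :=
    ((hψ.contDiffAt (hO₀.mem_nhds hpO)).differentiableAt one_ne_zero).hasFDerivAt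
  have hψφd : fderiv ℝ ψ p ∘L fderiv ℝ φ 0 = .id ℝ _ := by
    rw [← hφ0] at hψd ⊢
    refine (hψd.comp 0 hφd).unique ((hasFDerivAt_id _).congr_of_eventuallyEq ?_)
    filter_upwards [hU₀.mem_nhds h0U₀] with z hz using hψφ z hz
  have hTφ0 : Φ (φ 0) ε = p := by rw [hφ0, hΦp]
  -- the time `ε` map of the flow in the chart
  set G : (ι → ℝ) × (κ → ℝ) → (ι → ℝ) × (κ → ℝ) := fun z => ψ (Φ (φ z) ε) with hG
  have hGc : ContDiffAt ℝ 1 G 0 := by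
    have h1 : ContDiffAt ℝ 1 ψ (Φ (φ 0) ε) := by
      rw [hTφ0]
      exact hψ.contDiffAt (hO₀.mem_nhds hpO)
    exact h1.comp (0 : (ι → ℝ) × (κ → ℝ))
      (hTc.contDiffAt.comp (0 : (ι → ℝ) × (κ → ℝ)) (hφ.contDiffAt (hU₀.mem_nhds h0U₀)))
  have hG0 : G 0 = 0 := by simp only [hG, hTφ0, hψp]
  have hGd : HasFDerivAt G ((diagCLM fun i => Real.exp (ε * c i)).prodMap
      (diagCLM fun i => Real.exp (ε * d i))) 0 := by
    have hTd' : HasFDerivAt (fun x => Φ x ε) (fderiv ℝ (fun x => Φ x ε) p) (φ 0) := by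
      rw [hφ0]
      exact ((hTc.differentiable one_ne_zero) p).hasFDerivAt
    have hψd' : HasFDerivAt ψ (fderiv ℝ ψ p) (Φ (φ 0) ε) := by rwa [hTφ0]
    have h1 := hψd'.comp (0 : (ι → ℝ) × (κ → ℝ)) (hTd'.comp (0 : (ι → ℝ) × (κ → ℝ)) hφd)
    have h2 : fderiv ℝ (fun x => Φ x ε) p ∘L fderiv ℝ φ 0 = fderiv ℝ φ 0 ∘L
        (diagCLM fun i => Real.exp (ε * c i)).prodMap (diagCLM fun i => Real.exp (ε * d i)) :=
      comp_prodMap_diagCLM (fun i => hTd p _ (c i) hgp (by rw [hgd]; exact hc i))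
        (fun i => hTd p _ (d i) hgp (by rw [hgd]; exact hd i))
    rw [h2, ← ContinuousLinearMap.comp_assoc, hψφd, ContinuousLinearMap.id_comp] at h1
    exact h1
  obtain ⟨δ, hδ, hδV⟩ := Metric.isOpen_iff.1 hV p hpV
  set N₁ : Set F := Metric.ball p (δ * Real.exp (-(K * ε))) with hN₁
  have hstay : ∀ x ∈ N₁, ∀ t ∈ Icc 0 ε, Φ x t ∈ V := by
    intro x hx t ht
    refine hδV ?_
    have := hΦ.dist_le hK x p ht.1
    rw [hΦp] at this
    refine this.trans_lt ?_
    calc dist x p * Real.exp (K * t) ≤ dist x p * Real.exp (K * ε) := by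
          gcongr
          exact ht.2
      _ < δ * Real.exp (-(K * ε)) * Real.exp (K * ε) := by
          gcongr
          exact hx
      _ = δ := by rw [mul_assoc, ← Real.exp_add, neg_add_cancel, Real.exp_zero, mul_one]
  have hcurve : ∀ x ∈ N₁, IsCurveOn f Ω ε (Φ x) := fun x hx t ht => by
    have := hstay x hx t ht
    refine ⟨hVΩ this, ?_⟩
    rw [← hgf _ this]
    exact (hΦ.hasDerivAt x t).hasDerivWithinAt
  have hN₁p : N₁ ∈ 𝓝 p := Metric.ball_mem_nhds _ (by positivity)
  have hφc : ContinuousAt φ 0 := hφd.continuousAt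
  have hTφc : ContinuousAt (fun z => Φ (φ z) ε) 0 := hTc.continuous.continuousAt.comp hφc
  -- In this neighbourhood the orbit follows `f` for a time `ε`, ends in the range of the chart, and
  -- the linear form decides membership in `S` for stable points.
  have hA : {z | z ∈ U₀ ∧ φ z ∈ N₁ ∧ Φ (φ z) ε ∈ O₀ ∧
      (φ z ∈ stableSetOf f M p → (φ z ∈ S ↔ 0 ≤ ℓ (ψ (φ z)).1))} ∈ 𝓝 0 := by
    refine (hU₀.eventually_mem h0U₀).and (Filter.Eventually.and ?_ (Filter.Eventually.and ?_ ?_))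
    · exact hφc.eventually_mem (by rwa [hφ0])
    · exact hTφc.eventually_mem (by simp only [hTφ0]; exact hO₀.mem_nhds hpO)
    · rw [← hφ0] at hℓ
      simpa only [hφ0] using hφc.eventually hℓ
  obtain ⟨r, U, φ', hr, hrA, hU, h0U, hφ'c, hφ'r, hφ'0, hφ'1, hiff⟩ :=
    exists_local_stable_manifold
      (As := diagCLM fun i => Real.exp (ε * c i)) (Au := diagCLM fun i => Real.exp (ε * d i))
      (Bu := diagCLM fun i => Real.exp (-(ε * d i)))
      (norm_diagCLM_lt_one fun i => by
        rw [abs_of_pos (Real.exp_pos _), Real.exp_lt_one_iff]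
        exact mul_neg_of_pos_of_neg hε (hc0 i))
      (norm_diagCLM_lt_one fun i => by
        rw [abs_of_pos (Real.exp_pos _), Real.exp_lt_one_iff, neg_lt_zero]
        exact mul_pos hε (hd0 i))
      (fun u => by ext i; simp [← mul_assoc, ← Real.exp_add])
      (fun u => by ext i; simp [← mul_assoc, ← Real.exp_add]) hGc hG0 hGd hA
  set N : Set F := (O₀ ∩ ψ ⁻¹' Metric.ball 0 r) ∩ N₁ with hN
  have hNo : IsOpen N :=
    (hψ.continuousOn.isOpen_inter_preimage hO₀ Metric.isOpen_ball).inter Metric.isOpen_ball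
  have hpN : p ∈ N := ⟨⟨hpO, by rw [mem_preimage, hψp]; exact Metric.mem_ball_self hr⟩,
    mem_of_mem_nhds hN₁p⟩
  have hφN : ∀ z ∈ Metric.ball 0 r, φ z ∈ N := fun z hz =>
    ⟨⟨hφO (hrA hz).1, by rw [mem_preimage, hψφ z (hrA hz).1]; exact hz⟩, (hrA hz).2.1⟩
  refine immersedDim_stableSetOf hΩ hf hS (hSM.trans hMΩ) hpS hfp hε hNo hpN ?_
  -- From a discrete orbit to a stable curve: the points at the times `ε * j` start near `p`, so the
  -- flow between them remains in `V` and converges by Grönwall's inequality.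
  have hmem : ∀ ξ ∈ U, 0 ≤ ℓ ξ → φ (φ' ξ) ∈ stablePiece f S p ε N 0 := by
    intro ξ hξ hξℓ
    obtain ⟨z, hz0, hzG, hzr, hzlim⟩ := (hiff (φ' ξ)).2
      ⟨by rw [hφ'1 ξ hξ]; exact hξ, by rw [hφ'1 ξ hξ]⟩
    have hstep : ∀ j, Φ (φ (z j)) ε = φ (z (j + 1)) := by
      intro j
      have h1 := hrA (hzr j)
      have h2 : φ (z j) ∈ M := (hMO _ (hφO h1.1)).2 ⟨by rw [hψφ _ h1.1]; exact h1.1,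
        by rw [hψφ _ h1.1]⟩
      -- Invariance of `M` is what allows the discrete orbit in coordinates to be lifted: on `M ∩
      -- O₀` the map `φ ∘ ψ` is the identity.
      have h3 : Φ (φ (z j)) ε ∈ M := by
        refine (hM.mem_iff (hcurve _ h1.2.1) (right_mem_Icc.2 hε.le)).1 ?_
        rwa [hΦ.apply_zero]
      rw [hzG]
      exact (((hMO _ h1.2.2.1).1 h3).2).symm
    have hgrid : ∀ j : ℕ, Φ (φ (z 0)) (ε * j) = φ (z j) := by
      intro j
      induction j with
      | zero => simp [hΦ.apply_zero]
      | succ j ih =>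
        rw [← hstep, ← ih, ← hΦ.apply_add hK]
        push_cast
        ring_nf
    have hdecomp : ∀ t : ℝ, 0 ≤ t → ∃ s ∈ Icc 0 ε,
        t = ε * (⌊t / ε⌋₊ : ℝ) + s := by
      intro t ht
      have h1 := Nat.floor_le (div_nonneg ht hε.le)
      have h2 := (Nat.lt_floor_add_one (t / ε)).le
      rw [le_div_iff₀ hε] at h1
      rw [div_le_iff₀ hε] at h2
      exact ⟨t - ε * ⌊t / ε⌋₊, ⟨by linarith, by linarith⟩, by ring⟩
    have hall : ∀ t : ℝ, 0 ≤ t → Φ (φ (z 0)) t ∈ V := by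
      intro t ht
      obtain ⟨s, hs, hts⟩ := hdecomp t ht
      rw [hts, hΦ.apply_add hK, hgrid]
      exact hstay _ (hrA (hzr _)).2.1 s hs
    have hcurve' : ∀ T, IsCurveOn f Ω T (Φ (φ (z 0))) := fun T t ht => by
      have := hall t ht.1
      refine ⟨hVΩ this, ?_⟩
      rw [← hgf _ this]
      exact (hΦ.hasDerivAt _ t).hasDerivWithinAt
    have hder : ∀ t ∈ Ici (0 : ℝ), HasDerivWithinAt (Φ (φ (z 0))) (f (Φ (φ (z 0)) t)) (Ici 0) t :=
      fun t ht => by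
        rw [← hgf _ (hall t ht)]
        exact (hΦ.hasDerivAt _ t).hasDerivWithinAt
    have hlim : Tendsto (Φ (φ (z 0))) atTop (𝓝 p) := by
      rw [tendsto_iff_dist_tendsto_zero]
      have h1 : Tendsto (fun t : ℝ => dist (φ (z ⌊t / ε⌋₊)) p * Real.exp (K * ε)) atTop (𝓝 0) := by
        have h2 : Tendsto (fun t : ℝ => ⌊t / ε⌋₊) atTop atTop :=
          tendsto_nat_floor_atTop.comp (tendsto_id.atTop_div_const hε)
        have h3 : Tendsto (fun j => φ (z j)) atTop (𝓝 p) := by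
          rw [← hφ0]
          exact hφc.tendsto.comp hzlim
        have h4 := ((tendsto_iff_dist_tendsto_zero.1 h3).comp h2).mul_const (Real.exp (K * ε))
        simpa using h4
      refine squeeze_zero' (Eventually.of_forall fun _ => dist_nonneg) ?_ h1
      filter_upwards [eventually_ge_atTop 0] with t ht
      obtain ⟨s, hs, hts⟩ := hdecomp t ht
      have h5 := hΦ.dist_le hK (φ (z ⌊t / ε⌋₊)) p hs.1
      rw [hΦp, ← hgrid, ← hΦ.apply_add hK, ← hts, hgrid] at h5
      refine h5.trans ?_
      gcongr
      exact hs.2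
    have h0 := hrA (hzr 0)
    have hM0 : φ (z 0) ∈ M := (hMO _ (hφO h0.1)).2 ⟨by rw [hψφ _ h0.1]; exact h0.1,
        by rw [hψφ _ h0.1]⟩
    have hMt : ∀ t ∈ Ici (0 : ℝ), Φ (φ (z 0)) t ∈ M := fun t ht => by
      refine (hM.mem_iff (hcurve' t) (right_mem_Icc.2 ht)).1 ?_
      rwa [hΦ.apply_zero]
    -- The hypothesis on `ℓ` applies only to points already known to be stable in `M`; invariance of
    -- `S` then settles all later times.
    have hS0 : φ (z 0) ∈ S := by
      refine (h0.2.2.2 ⟨Φ (φ (z 0)), hΦ.apply_zero _, fun t ht => ⟨hMt t ht, hder t ht⟩,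
        hlim⟩).2 ?_
      rw [hψφ _ h0.1, hz0, hφ'1 ξ hξ]
      exact hξℓ
    have hSt : ∀ t ∈ Ici (0 : ℝ), Φ (φ (z 0)) t ∈ S := fun t ht => by
      refine (hS.mem_iff (hcurve' t) (right_mem_Icc.2 ht)).1 ?_
      rwa [hΦ.apply_zero]
    rw [← hz0]
    exact ⟨Φ (φ (z 0)), hΦ.apply_zero _, ⟨fun t ht => ⟨hSt t ht, hder t ht⟩, hlim⟩,
      fun j _ => by rw [hgrid]; exact hφN _ (hzr j)⟩
  have hconv : ∀ x ∈ stablePiece f S p ε N 0,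
      (ψ x).1 ∈ U ∧ 0 ≤ ℓ (ψ x).1 ∧ φ (φ' (ψ x).1) = x := by
    rintro x ⟨γ, rfl, hγ, hγN⟩
    have hγN' : ∀ j : ℕ, γ (ε * j) ∈ N := fun j => hγN j (Nat.zero_le _)
    have hγM : ∀ j : ℕ, ψ (γ (ε * j)) ∈ U₀ ∧ φ (ψ (γ (ε * j))) = γ (ε * j) := fun j =>
      (hMO _ (hγN' j).1.1).1 (hSM (hγ.1 _ (mem_Ici.2 (by positivity))).1)
    have hstep : ∀ j : ℕ, γ (ε * (j + 1 : ℕ)) = Φ (γ (ε * j)) ε := by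
      intro j
      have h1 := ((hγ.mono_set (hSM.trans hMΩ)).shift
        (show 0 ≤ ε * (j : ℝ) by positivity)).isCurveOn ε
      have h2 := h1.eqOn hΩ hf (hcurve _ (hγN' j).2) (by simp [hΦ.apply_zero])
        (right_mem_Icc.2 hε.le)
      rw [← h2]
      push_cast
      ring_nf
    have hseq := (hiff (ψ (γ 0))).1 ⟨fun j => ψ (γ (ε * j)), by simp, fun j => by
        simp only [hG]
        rw [(hγM j).2, hstep], fun j => (hγN' j).1.2, by
        have h1 : Tendsto (fun j : ℕ => γ (ε * j)) atTop (𝓝 p) :=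
          hγ.2.comp (tendsto_natCast_atTop_atTop.const_mul_atTop hε)
        have h2 := hψd.continuousAt.tendsto.comp h1
        rwa [hψp] at h2⟩
    have h0 := hγM 0
    have h0N := hγN' 0
    simp only [Nat.cast_zero, mul_zero] at h0 h0N
    refine ⟨hseq.1, ?_, by rw [hseq.2, h0.2]⟩
    have h3 := (hrA h0N.1.2).2.2.2
    rw [h0.2] at h3
    exact (h3 ⟨γ, rfl, hγ.mono_set hSM⟩).1 (hγ.1 0 self_mem_Ici).1
  intro x hx
  obtain ⟨h1, h2, h3⟩ := hconv x hx
  have hφr : MapsTo φ' U U₀ := fun ξ hξ => (hrA (hφ'r hξ)).1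
  have hch := HasC1Chart.of_model (S := stablePiece f S p ε N 0) (U := U) (O := N)
    (φ := fun ξ => φ (φ' ξ)) (ψ := fun x => (ψ x).1) (ℓ := ℓ) (a := (ψ x).1)
    (Module.finrank_fintype_fun_eq_card ℝ) hU h1 hNo (fun ξ hξ => hφN _ (hφ'r hξ))
    (hφ.comp hφ'c hφr) ((hψ.mono fun y hy => hy.1.1).fst)
    (fun ξ hξ => by rw [hψφ _ (hφr hξ), hφ'1 ξ hξ]) ?_ h2
  · rwa [h3] at hch
  · ext y
    constructor
    · rintro ⟨hy, -⟩
      obtain ⟨h4, h5, h6⟩ := hconv y hy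
      exact ⟨_, ⟨h4, h5⟩, h6⟩
    · rintro ⟨ξ, ⟨hξ, hξℓ⟩, rfl⟩
      exact ⟨hmem ξ hξ hξℓ, hφN _ (hφ'r hξ)⟩

end LocalStable

end

/-! ### The potential, its gradient and its Hessian. -/

section Potential

variable {n : ℕ}

/-- Configurations without collisions. -/
def noCollision (n : ℕ) : Set (Conf n) := {x | ∀ i j, i ≠ j → x i ≠ x j}

theorem isOpen_noCollision : IsOpen (noCollision n) := by
  simp only [noCollision, ofPred_forall]
  refine isOpen_iInter_of_finite fun i => isOpen_iInter_of_finite fun j =>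
    isOpen_iInter_of_finite fun _ => ?_
  exact isOpen_ne_fun (by fun_prop) (by fun_prop)

/-- The kernel of the force, `y |y| ^ (-a - 2)`. -/
noncomputable def forceKernel (a y : ℝ) : ℝ := y * |y| ^ (-a - 2)

@[simp]
theorem forceKernel_zero (a : ℝ) : forceKernel a 0 = 0 := zero_mul _

theorem forceKernel_neg (a y : ℝ) : forceKernel a (-y) = -forceKernel a y := by
  simp [forceKernel]

theorem hasDerivAt_abs_rpow_of_ne (a : ℝ) {y : ℝ} (hy : y ≠ 0) :
    HasDerivAt (fun y : ℝ => |y| ^ a) (a * (y * |y| ^ (a - 2))) y := by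
  have hy' : 0 < |y| := abs_pos.2 hy
  refine ((hasDerivAt_abs hy).rpow_const (p := a) (Or.inl hy'.ne')).congr_deriv ?_
  have h1 : |y| ^ (a - 1) = |y| ^ (a - 2) * |y| := by
    rw [← Real.rpow_add_one hy'.ne']
    ring_nf
  have h2 : (SignType.sign y : ℝ) * |y| = y := sign_mul_abs y
  rw [h1]
  linear_combination a * |y| ^ (a - 2) * h2

theorem hasDerivAt_forceKernel (a : ℝ) {y : ℝ} (hy : y ≠ 0) :
    HasDerivAt (forceKernel a) (-(a + 1) * |y| ^ (-a - 2)) y := by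
  refine ((hasDerivAt_id y).mul (hasDerivAt_abs_rpow_of_ne (-a - 2) hy)).congr_deriv ?_
  have hy' : 0 < |y| := abs_pos.2 hy
  have h1 : |y| ^ (-a - 2) = |y| ^ (-a - 2 - 2) * y ^ 2 := by
    rw [← sq_abs y, ← Real.rpow_natCast, ← Real.rpow_add hy']
    norm_num
  rw [id, h1]
  ring

theorem contDiffAt_forceKernel (a : ℝ) {y : ℝ} (hy : y ≠ 0) :
    ContDiffAt ℝ 1 (forceKernel a) y :=
  contDiffAt_id.mul ((contDiffAt_abs hy).rpow_const_of_ne (abs_pos.2 hy).ne')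

/-- A sum over all pairs as a sum over unordered pairs. -/
theorem sum_sum_eq_sum_Ioi (S : Fin n → Fin n → ℝ) (h : ∀ i, S i i = 0) :
    ∑ i, ∑ j, S i j = ∑ i, ∑ j ∈ Finset.Ioi i, (S i j + S j i) := by
  have h1 := Finset.sum_sum_Ioi_add_eq_sum_sum_off_diag (fun i j => S j i)
  rw [h1]
  refine Finset.sum_congr rfl fun i _ => ?_
  rw [← Finset.sum_compl_add_sum {i}, Finset.sum_singleton, h, add_zero]

variable (m : Fin n → ℝ) (a : ℝ)

/-- The gradient of the potential. -/
noncomputable def potGrad (x : Conf n) : Conf n :=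
  WithLp.toLp 2 fun i => ∑ j, -a * (m i * m j) * forceKernel a (x i - x j)

/-- The Hessian of the potential. -/
noncomputable def potHess (x ξ : Conf n) : Conf n :=
  WithLp.toLp 2 fun i => ∑ j, a * (a + 1) * (m i * m j) * |x i - x j| ^ (-a - 2) * (ξ i - ξ j)

theorem potGrad_apply (x : Conf n) (i : Fin n) :
    potGrad m a x i = ∑ j, -a * (m i * m j) * forceKernel a (x i - x j) := rfl

theorem potHess_apply (x ξ : Conf n) (i : Fin n) : potHess m a x ξ i =
    ∑ j, a * (a + 1) * (m i * m j) * |x i - x j| ^ (-a - 2) * (ξ i - ξ j) := rfl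

/-- The kernel is odd, so opposite forces combine into a sum over unordered pairs that sees only
relative displacements. -/
theorem sum_mul_potGrad (x ξ : Conf n) : ∑ i, ξ i * potGrad m a x i =
    ∑ i, ∑ j ∈ Finset.Ioi i, -a * (m i * m j) * forceKernel a (x i - x j) * (ξ i - ξ j) := by
  simp_rw [potGrad_apply, Finset.mul_sum]
  rw [sum_sum_eq_sum_Ioi _ fun i => by simp]
  refine Finset.sum_congr rfl fun i _ => Finset.sum_congr rfl fun j _ => ?_
  rw [← neg_sub (x i) (x j), forceKernel_neg]
  ring

theorem sum_mul_potHess (x ξ η : Conf n) : ∑ i, η i * potHess m a x ξ i =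
    ∑ i, ∑ j ∈ Finset.Ioi i, a * (a + 1) * (m i * m j) * |x i - x j| ^ (-a - 2) *
      ((ξ i - ξ j) * (η i - η j)) := by
  simp_rw [potHess_apply, Finset.mul_sum]
  rw [sum_sum_eq_sum_Ioi _ fun i => by simp]
  refine Finset.sum_congr rfl fun i _ => Finset.sum_congr rfl fun j _ => ?_
  rw [abs_sub_comm (x j) (x i)]
  ring

theorem sum_mul_potHess_comm (x ξ η : Conf n) :
    ∑ i, η i * potHess m a x ξ i = ∑ i, ξ i * potHess m a x η i := by
  simp_rw [sum_mul_potHess, mul_comm]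

theorem sum_potGrad (x : Conf n) : ∑ i, potGrad m a x i = 0 := by
  have := sum_mul_potGrad m a x (WithLp.toLp 2 fun _ => 1)
  simpa using this

variable {m a}

/-- This is where collinearity matters: the Hessian form is a sum of squares of relative
displacements with nonnegative weights, without the negative transversal terms of higher dimensions.
-/
theorem sum_mul_potHess_self_nonneg (hm : ∀ i, 0 < m i) (ha : 0 ≤ a) (x ξ : Conf n) :
    0 ≤ ∑ i, ξ i * potHess m a x ξ i := by
  rw [sum_mul_potHess]
  refine Finset.sum_nonneg fun i _ => Finset.sum_nonneg fun j _ => ?_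
  have h1 := (hm i).le
  have h2 := (hm j).le
  have h3 := mul_self_nonneg (ξ i - ξ j)
  positivity

/-- Euler's identity for the gradient, which is homogeneous of degree `-(a + 1)`. -/
theorem potHess_self (x : Conf n) : potHess m a x x = -(a + 1) • potGrad m a x := by
  ext i
  simp only [potHess_apply, PiLp.smul_apply, potGrad_apply, smul_eq_mul, Finset.mul_sum,
    forceKernel]
  exact Finset.sum_congr rfl fun j _ => by ring

variable (m a) in
theorem potHess_const (x : Conf n) (c : ℝ) : potHess m a x (WithLp.toLp 2 fun _ => c) = 0 := by
  ext i
  simp [potHess_apply]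

/-- Euler's identity for the potential, homogeneous of degree `-a`. -/
theorem sum_mul_potGrad_self {x : Conf n} (hx : x ∈ noCollision n) :
    ∑ i, x i * potGrad m a x i = -a * pot m a x := by
  rw [sum_mul_potGrad, pot]
  simp_rw [Finset.mul_sum]
  refine Finset.sum_congr rfl fun i _ => Finset.sum_congr rfl fun j hj => ?_
  have hij : x i - x j ≠ 0 := sub_ne_zero.2 (hx i j (Finset.mem_Ioi.1 hj).ne)
  have hpos := abs_pos.2 hij
  have h1 : |x i - x j| ^ (-a - 2) * (x i - x j) ^ 2 * |x i - x j| ^ a = 1 := by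
    rw [← sq_abs (x i - x j), ← Real.rpow_natCast, ← Real.rpow_add hpos, ← Real.rpow_add hpos]
    norm_num
  have h2 : |x i - x j| ^ a ≠ 0 := (Real.rpow_pos_of_pos hpos a).ne'
  rw [forceKernel, mul_div_assoc', eq_div_iff h2]
  linear_combination (-a * (m i * m j)) * h1

theorem pot_pos (hn : 2 ≤ n) (hm : ∀ i, 0 < m i) {x : Conf n} (hx : x ∈ noCollision n) :
    0 < pot m a x := by
  have hterm : ∀ i, ∀ j ∈ Finset.Ioi i, 0 < m i * m j / |x i - x j| ^ a := fun i j hj =>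
    div_pos (mul_pos (hm i) (hm j)) (Real.rpow_pos_of_pos
      (abs_pos.2 (sub_ne_zero.2 (hx i j (Finset.mem_Ioi.1 hj).ne))) a)
  refine Finset.sum_pos' (fun i _ => Finset.sum_nonneg fun j hj => (hterm i j hj).le)
    ⟨⟨0, by omega⟩, Finset.mem_univ _, Finset.sum_pos (hterm _) ⟨⟨1, by omega⟩, ?_⟩⟩
  simp [Fin.lt_def]

theorem contDiffOn_pot : ContDiffOn ℝ 1 (pot m a) (noCollision n) := by
  intro x hx
  refine ContDiffAt.contDiffWithinAt ?_
  refine ContDiffAt.sum fun i _ => ContDiffAt.sum fun j hj => ?_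
  have hij : x i - x j ≠ 0 := sub_ne_zero.2 (hx i j (Finset.mem_Ioi.1 hj).ne)
  have hpos := abs_pos.2 hij
  have h1 : ContDiffAt ℝ 1 (fun x : Conf n => x i - x j) x := by fun_prop
  exact contDiffAt_const.div
    ((ContDiffAt.comp x (contDiffAt_abs hij) h1).rpow_const_of_ne hpos.ne')
    (Real.rpow_pos_of_pos hpos a).ne'

theorem contDiffOn_potGrad : ContDiffOn ℝ 1 (potGrad m a) (noCollision n) := by
  intro x hx
  refine ContDiffAt.contDiffWithinAt ?_
  refine contDiffAt_euclidean.2 fun i => ?_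
  simp only [potGrad_apply]
  refine ContDiffAt.sum fun j _ => ?_
  by_cases hij : i = j
  · subst hij
    simpa using contDiffAt_const
  · have h1 : ContDiffAt ℝ 1 (fun x : Conf n => x i - x j) x := by fun_prop
    exact contDiffAt_const.mul
      (ContDiffAt.comp x (contDiffAt_forceKernel a (sub_ne_zero.2 (hx i j hij))) h1)

theorem hasDerivAt_pot {x : Conf n} (hx : x ∈ noCollision n) (ξ : Conf n) :
    HasDerivAt (fun t : ℝ => pot m a (x + t • ξ)) (∑ i, ξ i * potGrad m a x i) 0 := by
  rw [sum_mul_potGrad]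
  refine HasDerivAt.fun_sum fun i _ => HasDerivAt.fun_sum fun j hj => ?_
  have hij : x i - x j ≠ 0 := sub_ne_zero.2 (hx i j (Finset.mem_Ioi.1 hj).ne)
  have h1 : HasDerivAt (fun t : ℝ => x i - x j + t * (ξ i - ξ j)) (ξ i - ξ j) 0 := by
    simpa using ((hasDerivAt_id (0 : ℝ)).mul_const (ξ i - ξ j)).const_add (x i - x j)
  have h2 := ((hasDerivAt_abs_rpow_of_ne (-a) (y := x i - x j + 0 * (ξ i - ξ j)) (by simpa)).comp 0
    h1).const_mul (m i * m j)
  refine (h2.congr_deriv ?_).congr_of_eventuallyEq (Eventually.of_forall fun t => ?_)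
  · simp only [zero_mul, add_zero, forceKernel]
    ring
  · simp only [PiLp.add_apply, PiLp.smul_apply, smul_eq_mul, Function.comp_apply]
    rw [Real.rpow_neg (abs_nonneg _), div_eq_mul_inv]
    ring_nf

theorem fderiv_pot {x : Conf n} (hx : x ∈ noCollision n) (ξ : Conf n) :
    fderiv ℝ (pot m a) x ξ = ∑ i, ξ i * potGrad m a x i := by
  have h1 : DifferentiableAt ℝ (pot m a) x :=
    (contDiffOn_pot.contDiffAt (isOpen_noCollision.mem_nhds hx)).differentiableAt one_ne_zero
  have h2 : HasDerivAt (fun t : ℝ => x + t • ξ) ξ 0 := by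
    simpa using ((hasDerivAt_id (0 : ℝ)).smul_const ξ).const_add x
  have h3 : HasFDerivAt (pot m a) (fderiv ℝ (pot m a) x) (x + (0 : ℝ) • ξ) := by
    simpa using h1.hasFDerivAt
  have h4 := h3.comp_hasDerivAt (0 : ℝ) h2
  exact h4.unique (hasDerivAt_pot (m := m) (a := a) hx ξ)

theorem gradient_pot {x : Conf n} (hx : x ∈ noCollision n) :
    gradient (pot m a) x = potGrad m a x := by
  refine ext_inner_right ℝ fun ξ => ?_
  rw [inner_gradient_left, fderiv_pot hx, PiLp.inner_apply]
  exact Finset.sum_congr rfl fun i _ => by simp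

theorem hasDerivAt_conf {f : ℝ → Conf n} {f' : Conf n} {t : ℝ}
    (h : ∀ i, HasDerivAt (fun t => f t i) (f' i) t) : HasDerivAt f f' t :=
  (PiLp.continuousLinearEquiv 2 ℝ fun _ : Fin n => ℝ).symm.hasFDerivAt.comp_hasDerivAt t
    (hasDerivAt_pi.2 h)

theorem hasDerivAt_potGrad {x : Conf n} (hx : x ∈ noCollision n) (ξ : Conf n) :
    HasDerivAt (fun t : ℝ => potGrad m a (x + t • ξ)) (potHess m a x ξ) 0 := by
  refine hasDerivAt_conf fun i => ?_
  simp only [potGrad_apply, potHess_apply]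
  refine HasDerivAt.fun_sum fun j _ => ?_
  by_cases hij : i = j
  · subst hij
    simpa using hasDerivAt_const (0 : ℝ) (0 : ℝ)
  have hij : x i - x j ≠ 0 := sub_ne_zero.2 (hx i j hij)
  have h1 : HasDerivAt (fun t : ℝ => x i - x j + t * (ξ i - ξ j)) (ξ i - ξ j) 0 := by
    simpa using ((hasDerivAt_id (0 : ℝ)).mul_const (ξ i - ξ j)).const_add (x i - x j)
  have h2 := ((hasDerivAt_forceKernel a (y := x i - x j + 0 * (ξ i - ξ j)) (by simpa)).comp 0
    h1).const_mul (-a * (m i * m j))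
  refine (h2.congr_deriv ?_).congr_of_eventuallyEq (Eventually.of_forall fun t => ?_)
  · simp only [zero_mul, add_zero]
    ring
  · simp only [PiLp.add_apply, PiLp.smul_apply, smul_eq_mul, Function.comp_apply]
    ring_nf

end Potential

/-! ### The vector field and the constraints. -/

section Field

variable {n : ℕ} (m : Fin n → ℝ) (b h : ℝ)

/-- The phase points without collisions, with `ρ` of any sign. -/
def phaseDomain (n : ℕ) : Set (Phase n) := {x | x.2.2.1 ∈ noCollision n}

theorem isOpen_phaseDomain : IsOpen (phaseDomain n) :=
  isOpen_noCollision.preimage (by fun_prop)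

/-- The constraints that define the energy surface. -/
noncomputable def constraint (x : Phase n) : ℝ × ℝ × ℝ × ℝ × ℝ :=
  (∑ i, m i * x.2.2.1 i, ∑ i, x.2.2.2 i, inertia m x.2.2.1 - 1, ∑ i, x.2.2.2 i * x.2.2.1 i,
    (kin m x.2.2.2 + x.2.1 ^ 2) / 2 - x.1 ^ (b - 1) * pot m 1 x.2.2.1 - pot m b x.2.2.1
      - h * x.1 ^ b)

/-- The energy surface extended to all real values of `ρ`. -/
def extSurface : Set (Phase n) := {x | x ∈ phaseDomain n ∧ constraint m b h x = 0}

/-- Splits off the inequality `0 ≤ ρ`, so that the equations can be treated on a surface without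
boundary. -/
theorem mem_energySurface_iff {x : Phase n} :
    x ∈ energySurface m b h ↔ x ∈ extSurface m b h ∧ 0 ≤ x.1 := by
  obtain ⟨ρ, v, s, u⟩ := x
  simp only [energySurface, extSurface, constraint, phaseDomain, noCollision, configSpace,
    mem_ofPred_eq, Prod.mk_eq_zero, sub_eq_zero]
  tauto

theorem extSurface_subset : extSurface m b h ⊆ phaseDomain n := fun _ hx => hx.1

theorem energySurface_subset : energySurface m b h ⊆ extSurface m b h := fun _ hx =>
  ((mem_energySurface_iff m b h).1 hx).1

/-- The derivative of the constraints. -/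
noncomputable def constraintDeriv (x w : Phase n) : ℝ × ℝ × ℝ × ℝ × ℝ :=
  (∑ i, m i * w.2.2.1 i, ∑ i, w.2.2.2 i, 2 * ∑ i, m i * x.2.2.1 i * w.2.2.1 i,
    ∑ i, (w.2.2.2 i * x.2.2.1 i + x.2.2.2 i * w.2.2.1 i),
    ∑ i, x.2.2.2 i * w.2.2.2 i / m i + x.2.1 * w.2.1
      - ((b - 1) * x.1 ^ (b - 2) * w.1 * pot m 1 x.2.2.1
        + x.1 ^ (b - 1) * ∑ i, w.2.2.1 i * potGrad m 1 x.2.2.1 i)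
      - ∑ i, w.2.2.1 i * potGrad m b x.2.2.1 i - h * (b * x.1 ^ (b - 1) * w.1))

variable {m b h}

theorem contDiff_kin : ContDiff ℝ 1 (kin (n := n) m) := by
  unfold kin
  fun_prop

theorem contDiff_rpow_of_le {c : ℝ} (hc : 1 ≤ c) : ContDiff ℝ 1 fun x : ℝ => x ^ c :=
  Real.contDiff_rpow_const_of_le (n := 1) (by simpa using hc)

theorem contDiffOn_pot_phase (a : ℝ) :
    ContDiffOn ℝ 1 (fun x : Phase n => pot m a x.2.2.1) (phaseDomain n) :=
  contDiffOn_pot.comp (by fun_prop) fun _ hx => hx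

theorem contDiffOn_potGrad_phase (a : ℝ) :
    ContDiffOn ℝ 1 (fun x : Phase n => potGrad m a x.2.2.1) (phaseDomain n) :=
  contDiffOn_potGrad.comp (by fun_prop) fun _ hx => hx

theorem contDiffOn_constraint (hb : 2 < b) :
    ContDiffOn ℝ 1 (constraint (n := n) m b h) (phaseDomain n) := by
  have h1 : ContDiff ℝ 1 fun x : Phase n => x.1 ^ (b - 1) :=
    (contDiff_rpow_of_le (by linarith)).comp contDiff_fst
  have h2 : ContDiff ℝ 1 fun x : Phase n => x.1 ^ b :=
    (contDiff_rpow_of_le (by linarith)).comp contDiff_fst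
  have h3 : ContDiff ℝ 1 fun x : Phase n => kin m x.2.2.2 := contDiff_kin.comp (by fun_prop)
  refine ContDiffOn.prodMk (by fun_prop) (ContDiffOn.prodMk (by fun_prop)
    (ContDiffOn.prodMk ?_ (ContDiffOn.prodMk (by fun_prop) ?_)))
  · unfold inertia
    fun_prop
  · exact (((((h3.add (by fun_prop)).div_const 2).contDiffOn).sub
      (h1.contDiffOn.mul (contDiffOn_pot_phase 1))).sub (contDiffOn_pot_phase b)).sub
      (contDiff_const.mul h2).contDiffOn

variable (m b) in
/-- The vector field with explicit gradients. -/
noncomputable def explicitField (x : Phase n) : Phase n :=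
  (x.1 * x.2.1,
   b / 2 * x.2.1 ^ 2 + kin m x.2.2.2 - x.1 ^ (b - 1) * pot m 1 x.2.2.1 - b * pot m b x.2.2.1,
   massInv m x.2.2.2,
   ((b / 2 - 1) * x.2.1) • x.2.2.2 - kin m x.2.2.2 • massMul m x.2.2.1
     + x.1 ^ (b - 1) • (pot m 1 x.2.2.1 • massMul m x.2.2.1 + potGrad m 1 x.2.2.1)
     + (b * pot m b x.2.2.1) • massMul m x.2.2.1 + potGrad m b x.2.2.1)

theorem field_eq {x : Phase n} (hx : x ∈ phaseDomain n) :
    field m b x = explicitField m b x := by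
  obtain ⟨ρ, v, s, u⟩ := x
  simp only [field, explicitField, gradient_pot (show s ∈ noCollision n from hx)]

theorem contDiff_massMul : ContDiff ℝ 1 (massMul (n := n) m) :=
  contDiff_euclidean.2 fun i => by
    simp only [massMul]
    fun_prop

theorem contDiff_massInv : ContDiff ℝ 1 (massInv (n := n) m) :=
  contDiff_euclidean.2 fun i => by
    simp only [massInv]
    fun_prop

theorem contDiffOn_field (hb : 2 < b) : ContDiffOn ℝ 1 (field (n := n) m b) (phaseDomain n) := by
  have h1 : ContDiff ℝ 1 fun x : Phase n => x.1 ^ (b - 1) :=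
    (contDiff_rpow_of_le (by linarith)).comp contDiff_fst
  have h3 : ContDiff ℝ 1 fun x : Phase n => kin m x.2.2.2 := contDiff_kin.comp (by fun_prop)
  have h4 : ContDiff ℝ 1 fun x : Phase n => massMul m x.2.2.1 :=
    contDiff_massMul.comp (by fun_prop)
  have h5 : ContDiff ℝ 1 fun x : Phase n => massInv m x.2.2.2 :=
    contDiff_massInv.comp (by fun_prop)
  have hp := contDiffOn_pot_phase (n := n) (m := m)
  have hg := contDiffOn_potGrad_phase (n := n) (m := m)
  have h6 : ContDiff ℝ 1 fun x : Phase n => b / 2 * x.2.1 ^ 2 := by fun_prop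
  have h7 : ContDiff ℝ 1 fun x : Phase n => (b / 2 - 1) * x.2.1 := by fun_prop
  have h8 : ContDiff ℝ 1 fun x : Phase n => x.2.2.2 := by fun_prop
  have h9 : ContDiff ℝ 1 fun x : Phase n => x.1 * x.2.1 := by fun_prop
  have h10 : ContDiffOn ℝ 1 (fun x : Phase n => x.1 ^ (b - 1) * pot m 1 x.2.2.1)
      (phaseDomain n) := h1.contDiffOn.mul (hp 1)
  have h11 : ContDiffOn ℝ 1 (fun x : Phase n => b * pot m b x.2.2.1) (phaseDomain n) :=
    contDiffOn_const.mul (hp b)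
  have h12 : ContDiffOn ℝ 1 (fun x : Phase n => b / 2 * x.2.1 ^ 2 + kin m x.2.2.2)
      (phaseDomain n) := (h6.add h3).contDiffOn
  have h13 : ContDiffOn ℝ 1 (fun x : Phase n => ((b / 2 - 1) * x.2.1) • x.2.2.2
      - kin m x.2.2.2 • massMul m x.2.2.1) (phaseDomain n) :=
    ((h7.smul h8).sub (h3.smul h4)).contDiffOn
  have h14 : ContDiffOn ℝ 1 (fun x : Phase n => pot m 1 x.2.2.1 • massMul m x.2.2.1
      + potGrad m 1 x.2.2.1) (phaseDomain n) := ((hp 1).smul h4.contDiffOn).add (hg 1)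
  have h15 : ContDiffOn ℝ 1 (fun x : Phase n => x.1 ^ (b - 1) • (pot m 1 x.2.2.1 •
      massMul m x.2.2.1 + potGrad m 1 x.2.2.1)) (phaseDomain n) := h1.contDiffOn.smul h14
  have h16 : ContDiffOn ℝ 1 (fun x : Phase n => (b * pot m b x.2.2.1) • massMul m x.2.2.1)
      (phaseDomain n) := h11.smul h4.contDiffOn
  exact ContDiffOn.congr (h9.contDiffOn.prodMk (((h12.sub h10).sub h11).prodMk
    (h5.contDiffOn.prodMk (((h13.add h15).add h16).add (hg b))))) fun x hx => field_eq hx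

theorem hasDerivAt_line {E : Type*} [NormedAddCommGroup E] [NormedSpace ℝ E] (x w : E) :
    HasDerivAt (fun t : ℝ => x + t • w) w 0 := by
  simpa using ((hasDerivAt_id (0 : ℝ)).smul_const w).const_add x

/-- The derivative of a differentiable map from its derivatives along lines. -/
theorem fderiv_eq_of_hasDerivAt_line {E F : Type*} [NormedAddCommGroup E] [NormedSpace ℝ E]
    [NormedAddCommGroup F] [NormedSpace ℝ F] {f : E → F} {x w : E} {d : F}
    (hf : DifferentiableAt ℝ f x) (hd : HasDerivAt (fun t : ℝ => f (x + t • w)) d 0) :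
    fderiv ℝ f x w = d := by
  have h3 : HasFDerivAt f (fderiv ℝ f x) (x + (0 : ℝ) • w) := by
    simpa using hf.hasFDerivAt
  have h4 := h3.comp_hasDerivAt (0 : ℝ) (hasDerivAt_line x w)
  exact h4.unique hd

theorem hasDerivAt_coord_line (s ξ : Conf n) (i : Fin n) :
    HasDerivAt (fun t : ℝ => (s + t • ξ) i) (ξ i) 0 := by
  simpa using ((hasDerivAt_id (0 : ℝ)).mul_const (ξ i)).const_add (s i)

theorem hasDerivAt_rpow_line {c : ℝ} (hc : 1 ≤ c) (ρ r : ℝ) :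
    HasDerivAt (fun t : ℝ => (ρ + t * r) ^ c) (c * ρ ^ (c - 1) * r) 0 := by
  have h1 : HasDerivAt (fun t : ℝ => ρ + t * r) r 0 := by
    simpa using ((hasDerivAt_id (0 : ℝ)).mul_const r).const_add ρ
  have h2 := h1.rpow_const (p := c) (Or.inr hc)
  refine h2.congr_deriv ?_
  simp only [zero_mul, add_zero]
  ring

theorem hasDerivAt_kin_line (u η : Conf n) :
    HasDerivAt (fun t : ℝ => kin m (u + t • η)) (2 * ∑ i, u i * η i / m i) 0 := by
  unfold kin
  rw [Finset.mul_sum]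
  refine HasDerivAt.fun_sum fun i _ => ?_
  refine (((hasDerivAt_coord_line u η i).pow 2).div_const (m i)).congr_deriv ?_
  simp
  ring

theorem fderiv_constraint (hb : 2 < b) {x : Phase n} (hx : x ∈ phaseDomain n) (w : Phase n) :
    fderiv ℝ (constraint m b h) x w = constraintDeriv m b h x w := by
  refine fderiv_eq_of_hasDerivAt_line (((contDiffOn_constraint hb).contDiffAt
    (isOpen_phaseDomain.mem_nhds hx)).differentiableAt one_ne_zero) ?_
  obtain ⟨ρ, v, s, u⟩ := x
  obtain ⟨r, z, ξ, η⟩ := w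
  have hx' : s ∈ noCollision n := hx
  have hs := hasDerivAt_coord_line s ξ
  have hu := hasDerivAt_coord_line u η
  have hv : HasDerivAt (fun t : ℝ => v + t * z) z 0 := by
    simpa using ((hasDerivAt_id (0 : ℝ)).mul_const z).const_add v
  refine HasDerivAt.prodMk ?_ (HasDerivAt.prodMk ?_ (HasDerivAt.prodMk ?_
    (HasDerivAt.prodMk ?_ ?_)))
  · exact HasDerivAt.fun_sum fun i _ => (hs i).const_mul (m i)
  · exact HasDerivAt.fun_sum fun i _ => hu i
  · unfold inertia
    refine HasDerivAt.sub_const 1 ?_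
    rw [Finset.mul_sum]
    refine HasDerivAt.fun_sum fun i _ => ?_
    refine (((hs i).pow 2).const_mul (m i)).congr_deriv ?_
    simp
    ring
  · refine HasDerivAt.fun_sum fun i _ => ?_
    refine ((hu i).mul (hs i)).congr_deriv ?_
    simp
  · refine (((((hasDerivAt_kin_line u η).add (hv.pow 2)).div_const 2).sub
      ((hasDerivAt_rpow_line (c := b - 1) (by linarith) ρ r).mul (hasDerivAt_pot hx' ξ))).sub
      (hasDerivAt_pot hx' ξ)).sub
      ((hasDerivAt_rpow_line (c := b) (by linarith) ρ r).const_mul h) |>.congr_deriv ?_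
    simp only [zero_smul, zero_mul, add_zero]
    rw [show b - 1 - 1 = b - 2 by ring]
    simp
    ring

end Field

/-! ### Invariance of the energy surface. -/

section Invariance

/-- Grönwall's inequality forward and, after `t ↦ T - t`, backward in time. -/
theorem eq_zero_iff_of_norm_deriv_le {E : Type*} [NormedAddCommGroup E] [NormedSpace ℝ E]
    {c c' : ℝ → E} {K T : ℝ} (hT : 0 ≤ T)
    (hc : ∀ t ∈ Icc 0 T, HasDerivWithinAt c (c' t) (Icc 0 T) t)
    (hK : ∀ t ∈ Icc 0 T, ‖c' t‖ ≤ K * ‖c t‖) : c 0 = 0 ↔ c T = 0 := by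
  have key : ∀ {c c' : ℝ → E}, (∀ t ∈ Icc 0 T, HasDerivWithinAt c (c' t) (Icc 0 T) t) →
      (∀ t ∈ Icc 0 T, ‖c' t‖ ≤ K * ‖c t‖) → c 0 = 0 → c T = 0 := fun {c c'} hc hK h0 =>
    eq_zero_of_abs_deriv_le_mul_abs_self_of_eq_zero_right
      (fun t ht => (hc t ht).continuousWithinAt)
      (fun t ht => (hc t (Ico_subset_Icc_self ht)).mono_of_mem_nhdsWithin
        (Icc_mem_nhdsGE_of_mem ht)) h0 (fun t ht => hK t (Ico_subset_Icc_self ht)) T ⟨hT, le_rfl⟩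
  refine ⟨key hc hK, fun h => ?_⟩
  have hmaps : MapsTo (fun t => T - t) (Icc 0 T) (Icc 0 T) := fun t ht =>
    ⟨sub_nonneg.2 ht.2, sub_le_self _ ht.1⟩
  have h1 := key (c := fun t => c (T - t)) (c' := fun t => -c' (T - t)) (fun t ht => ?_)
    (fun t ht => by simpa using hK _ (hmaps ht)) (by simpa using h)
  · simpa using h1
  · have h2 : HasDerivWithinAt (fun t : ℝ => T - t) (-1) (Icc 0 T) t :=
      ((hasDerivAt_id t).const_sub T).hasDerivWithinAt
    simpa [Function.comp_def] using (hc _ (hmaps ht)).scomp t h2 hmaps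

variable {n : ℕ} {m : Fin n → ℝ} {b h : ℝ}

/-- The rate at which the vector field moves the constraints. -/
theorem constraintDeriv_explicitField (hm : ∀ i, 0 < m i) {x : Phase n}
    (hx : x ∈ phaseDomain n) {P Q : ℝ} (hP : P = (b / 2 - 1) * x.2.1)
    (hQ : Q = -kin m x.2.2.2 + x.1 ^ (b - 1) * pot m 1 x.2.2.1 + b * pot m b x.2.2.1)
    (hb : 2 < b) {c₁ c₂ c₃ c₄ c₅ : ℝ} (hc : constraint m b h x = (c₁, c₂, c₃, c₄, c₅)) :
    constraintDeriv m b h x (explicitField m b x) =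
      (c₂, P * c₂ + Q * c₁, 2 * c₄, P * c₄ + Q * c₃, b * x.2.1 * c₅ + Q * c₄) := by
  obtain ⟨ρ, v, s, u⟩ := x
  have hs : s ∈ noCollision n := hx
  simp only [constraint, Prod.mk.injEq] at hc
  obtain ⟨h1, h2, h3, h4, h5⟩ := hc
  simp only at hP hQ
  -- For real powers this also holds for negative `ρ`; only `ρ = 0` needs the exponents to be
  -- nonzero.
  have hρ : ρ ^ (b - 2) * ρ = ρ ^ (b - 1) := by
    rcases eq_or_ne ρ 0 with rfl | hρ
    · rw [mul_zero, Real.zero_rpow (by linarith)]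
    · rw [← Real.rpow_add_one hρ]
      ring_nf
  have hρ2 : ρ ^ (b - 1) * ρ = ρ ^ b := by
    rcases eq_or_ne ρ 0 with rfl | hρ
    · rw [mul_zero, Real.zero_rpow (by linarith)]
    · rw [← Real.rpow_add_one hρ]
      ring_nf
  have hW0 := sum_potGrad m 1 s
  have hV0 := sum_potGrad m b s
  have hW1 := sum_mul_potGrad_self (m := m) (a := 1) hs
  have hV1 := sum_mul_potGrad_self (m := m) (a := b) hs
  have hmi : ∀ i, m i ≠ 0 := fun i => (hm i).ne'
  have hI : ∑ i, m i * s i * s i = c₃ + 1 := by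
    rw [← h3, inertia, sub_add_cancel]
    exact Finset.sum_congr rfl fun i _ => by ring
  have hk : ∑ i, u i * (u i / m i) = kin m u :=
    Finset.sum_congr rfl fun i _ => by ring
  have hsw (a : ℝ) : ∑ i, u i / m i * potGrad m a s i = ∑ i, u i * potGrad m a s i / m i :=
    Finset.sum_congr rfl fun i _ => by ring
  simp only [constraintDeriv, explicitField, massInv, massMul, Prod.mk.injEq, PiLp.add_apply,
    PiLp.sub_apply, PiLp.smul_apply, smul_eq_mul]
  refine ⟨?_, ?_, ?_, ?_, ?_⟩
  · rw [← h2]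
    exact Finset.sum_congr rfl fun i _ => mul_div_cancel₀ _ (hmi i)
  · simp only [Finset.sum_add_distrib, Finset.sum_sub_distrib, ← Finset.mul_sum]
    rw [hW0, hV0, h1, h2, hP, hQ]
    ring
  · rw [← h4]
    refine congrArg _ (Finset.sum_congr rfl fun i _ => ?_)
    field_simp [hmi i]
  · have : ∀ i, ((b / 2 - 1) * v * u i - kin m u * (m i * s i) +
        ρ ^ (b - 1) * (pot m 1 s * (m i * s i) + potGrad m 1 s i) +
        b * pot m b s * (m i * s i) + potGrad m b s i) * s i + u i * (u i / m i) =
        P * (u i * s i) + Q * (m i * s i * s i) + ρ ^ (b - 1) * (s i * potGrad m 1 s i)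
          + s i * potGrad m b s i + u i * (u i / m i) := fun i => by
      rw [hP, hQ]
      ring
    simp only [this, Finset.sum_add_distrib, ← Finset.mul_sum]
    rw [h4, hI, hW1, hV1, hk, hQ]
    ring
  · have : ∀ i, u i * ((b / 2 - 1) * v * u i - kin m u * (m i * s i) +
        ρ ^ (b - 1) * (pot m 1 s * (m i * s i) + potGrad m 1 s i) +
        b * pot m b s * (m i * s i) + potGrad m b s i) / m i =
        P * (u i * (u i / m i)) + Q * (u i * s i) + ρ ^ (b - 1) * (u i * potGrad m 1 s i / m i)
          + u i * potGrad m b s i / m i := fun i => by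
      rw [hP, hQ]
      field_simp [hmi i]
      ring
    simp only [this, Finset.sum_add_distrib, ← Finset.mul_sum]
    rw [h4, hk, hsw, hsw, hP, ← h5, ← hρ2, ← hρ]
    ring

theorem hasDerivWithinAt_constraint (hb : 2 < b) {γ : ℝ → Phase n} {T t : ℝ}
    (hγ : IsCurveOn (field m b) (phaseDomain n) T γ) (ht : t ∈ Icc 0 T) :
    HasDerivWithinAt (fun t => constraint m b h (γ t))
      (constraintDeriv m b h (γ t) (explicitField m b (γ t))) (Icc 0 T) t := by
  obtain ⟨h1, h2⟩ := hγ t ht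
  have h3 := (((contDiffOn_constraint (h := h) (m := m) hb).contDiffAt
    (isOpen_phaseDomain.mem_nhds h1)).differentiableAt one_ne_zero).hasFDerivAt
  have h4 := h3.comp_hasDerivWithinAt t h2
  rwa [fderiv_constraint hb h1, field_eq h1] at h4

/-- Along the field the constraints satisfy a linear homogeneous system with coefficients bounded on
a compact arc, so they vanish at one end exactly when they vanish at the other. -/
theorem isInvariant_extSurface (hm : ∀ i, 0 < m i) (hb : 2 < b) :
    IsInvariant (field m b) (phaseDomain n) (extSurface m b h) := by
  intro γ T hT hγ
  have hcont : ContinuousOn (fun t => γ t) (Icc 0 T) := hγ.continuousOn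
  have hmem : ∀ t ∈ Icc 0 T, γ t ∈ phaseDomain n := fun t ht => (hγ t ht).1
  have hP : ContinuousOn (fun t => (b / 2 - 1) * (γ t).2.1) (Icc 0 T) := by fun_prop
  have hV : ContinuousOn (fun t => b * (γ t).2.1) (Icc 0 T) := by fun_prop
  have hQ : ContinuousOn (fun t => -kin m (γ t).2.2.2 + (γ t).1 ^ (b - 1) * pot m 1 (γ t).2.2.1
      + b * pot m b (γ t).2.2.1) (Icc 0 T) := by
    have h1 : ContinuousOn (fun t => kin m (γ t).2.2.2) (Icc 0 T) :=
      (contDiff_kin (m := m)).continuous.comp_continuousOn (by fun_prop)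
    have h2 (a : ℝ) : ContinuousOn (fun t => pot m a (γ t).2.2.1) (Icc 0 T) :=
      (contDiffOn_pot_phase (m := m) a).continuousOn.comp hcont hmem
    have h3 : ContinuousOn (fun t => (γ t).1 ^ (b - 1)) (Icc 0 T) :=
      (contDiff_rpow_of_le (c := b - 1) (by linarith)).continuous.comp_continuousOn (by fun_prop)
    exact (h1.neg.add (h3.mul (h2 1))).add (continuousOn_const.mul (h2 b))
  obtain ⟨A, hA⟩ := isCompact_Icc.exists_bound_of_continuousOn hP
  obtain ⟨B, hB⟩ := isCompact_Icc.exists_bound_of_continuousOn hQ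
  obtain ⟨C, hC⟩ := isCompact_Icc.exists_bound_of_continuousOn hV
  -- In the maximum norm `2 + A + B + C` dominates each row of the linear system.
  have key := eq_zero_iff_of_norm_deriv_le (c := fun t => constraint m b h (γ t)) (K := 2 + A + B + C)
    hT (fun t ht => hasDerivWithinAt_constraint hb hγ ht) fun t ht => ?_
  · simp only [extSurface, mem_ofPred_eq, key, hmem 0 ⟨le_rfl, hT⟩, hmem T ⟨hT, le_rfl⟩]
  · specialize hA t ht
    specialize hB t ht
    specialize hC t ht
    rcases hc : constraint m b h (γ t) with ⟨c₁, c₂, c₃, c₄, c₅⟩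
    rw [constraintDeriv_explicitField hm (hmem t ht) rfl rfl hb hc]
    set P := (b / 2 - 1) * (γ t).2.1
    set Q := -kin m (γ t).2.2.2 + (γ t).1 ^ (b - 1) * pot m 1 (γ t).2.2.1
      + b * pot m b (γ t).2.2.1
    set N := ‖(c₁, c₂, c₃, c₄, c₅)‖ with hN
    have hN0 : 0 ≤ N := norm_nonneg _
    have hA0 := (norm_nonneg _).trans hA
    have hB0 := (norm_nonneg _).trans hB
    have hC0 := (norm_nonneg _).trans hC
    simp only [Prod.norm_def] at hN
    have h1 : ‖c₁‖ ≤ N := by simp [hN]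
    have h2 : ‖c₂‖ ≤ N := by simp [hN]
    have h3 : ‖c₃‖ ≤ N := by simp [hN]
    have h4 : ‖c₄‖ ≤ N := by simp [hN]
    have h5 : ‖c₅‖ ≤ N := by simp [hN]
    have hmul {p q P' : ℝ} (hp : ‖p‖ ≤ P') (hq : ‖q‖ ≤ N) : ‖p * q‖ ≤ P' * N := by
      rw [norm_mul]
      exact mul_le_mul hp hq (norm_nonneg _) ((norm_nonneg _).trans hp)
    have hAN := mul_nonneg hA0 hN0
    have hBN := mul_nonneg hB0 hN0
    have hCN := mul_nonneg hC0 hN0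
    have hsum {p q : ℝ} {P' Q' : ℝ} (hp : ‖p‖ ≤ P') (hq : ‖q‖ ≤ Q') : ‖p + q‖ ≤ P' + Q' :=
      (norm_add_le _ _).trans (add_le_add hp hq)
    simp only [Prod.norm_def, sup_le_iff]
    refine ⟨?_, ?_, ?_, ?_, ?_⟩
    · linarith
    · linarith [hsum (hmul hA h2) (hmul hB h1)]
    · linarith [hmul (p := 2) (P' := 2) (by simp) h4]
    · linarith [hsum (hmul hA h4) (hmul hB h3)]
    · linarith [hsum (hmul hC h5) (hmul hB h4)]

theorem hasDerivWithinAt_fst {γ : ℝ → Phase n} {T t : ℝ}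
    (hγ : IsCurveOn (field m b) (phaseDomain n) T γ) (ht : t ∈ Icc 0 T) :
    HasDerivWithinAt (fun t => (γ t).1) ((γ t).1 * (γ t).2.1) (Icc 0 T) t := by
  obtain ⟨h1, h2⟩ := hγ t ht
  have h3 := (ContinuousLinearMap.fst ℝ ℝ (ℝ × Conf n × Conf n)).hasFDerivAt.comp_hasDerivWithinAt
    t h2
  rwa [field_eq h1] at h3

theorem IsCurveOn.fst_eq_zero_iff {γ : ℝ → Phase n} {T : ℝ} (hT : 0 ≤ T)
    (hγ : IsCurveOn (field m b) (phaseDomain n) T γ) : (γ 0).1 = 0 ↔ (γ T).1 = 0 := by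
  have hcont : ContinuousOn (fun t => γ t) (Icc 0 T) := hγ.continuousOn
  obtain ⟨A, hA⟩ := isCompact_Icc.exists_bound_of_continuousOn
    (show ContinuousOn (fun t => (γ t).2.1) (Icc 0 T) by fun_prop)
  refine eq_zero_iff_of_norm_deriv_le (c := fun t => (γ t).1) (K := A) hT
    (fun t ht => hasDerivWithinAt_fst hγ ht) fun t ht => ?_
  rw [norm_mul, mul_comm]
  exact mul_le_mul_of_nonneg_right (hA t ht) (norm_nonneg _)

/-- As `ρ' = ρv`, a curve on which `ρ` vanishes once has `ρ = 0` at both ends; by the intermediate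
value theorem `ρ` cannot change sign. -/
theorem isInvariant_fst_nonneg :
    IsInvariant (field m b) (phaseDomain n) {x | 0 ≤ x.1} := by
  intro γ T hT hγ
  have hcont : ContinuousOn (fun t => (γ t).1) (Icc 0 T) := hγ.continuousOn.fst
  have hz : ∀ t ∈ Icc 0 T, (γ t).1 = 0 → (γ 0).1 = 0 ∧ (γ T).1 = 0 := fun t ht h0 => by
    have h1 := ((hγ.mono_time ht.2).fst_eq_zero_iff ht.1).2 h0
    exact ⟨h1, (hγ.fst_eq_zero_iff hT).1 h1⟩
  simp only [mem_ofPred_eq]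
  constructor <;> intro h0 <;> by_contra! hlt
  · obtain ⟨t, ht, h1⟩ := intermediate_value_Icc' hT hcont ⟨hlt.le, h0⟩
    linarith [(hz t ht h1).2]
  · obtain ⟨t, ht, h1⟩ := intermediate_value_Icc hT hcont ⟨hlt.le, h0⟩
    linarith [(hz t ht h1).1]

theorem isInvariant_energySurface (hm : ∀ i, 0 < m i) (hb : 2 < b) :
    IsInvariant (field m b) (phaseDomain n) (energySurface m b h) := fun γ T hT hγ => by
  rw [mem_energySurface_iff, mem_energySurface_iff, isInvariant_extSurface hm hb γ T hT hγ]
  exact and_congr_right fun _ => isInvariant_fst_nonneg γ T hT hγ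

end Invariance

/-! ### Regular levels and half levels. -/

section Levels

variable {F : Type*} [NormedAddCommGroup F] [NormedSpace ℝ F] [FiniteDimensional ℝ F]
  {W : Type*} [NormedAddCommGroup W] [NormedSpace ℝ W] [FiniteDimensional ℝ W]
  {Y : Type*} [NormedAddCommGroup Y] [NormedSpace ℝ Y] [FiniteDimensional ℝ Y]

/-- A regular level of `G`, or a half of it that is cut out by a linear form transverse to it,
is a submanifold. -/
theorem HasC1Chart.of_level {G : F → W} {L : F →L[ℝ] W} {q : F →L[ℝ] Y} {ℓ : Y →ₗ[ℝ] ℝ}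
    {S : Set F} {x : F} {k : ℕ} (hk : Module.finrank ℝ F = Module.finrank ℝ W + k)
    (hG : ContDiffAt ℝ 1 G x) (hL : HasFDerivAt G L x) (hx : G x = 0)
    (hsurj : Function.Surjective (L.prod q)) (hℓ : 0 ≤ ℓ (q x))
    (hS : ∀ᶠ y in 𝓝 x, y ∈ S ↔ G y = 0 ∧ 0 ≤ ℓ (q y)) : HasC1Chart k S x := by
  have hrange : (L.prod q).range = ⊤ := LinearMap.range_eq_top.2 hsurj
  obtain ⟨P, hP⟩ := ContinuousLinearMap.ker_closedComplemented_of_finiteDimensional_range (L.prod q)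
  have hPr : P.range = ⊤ := LinearMap.range_eq_top.2 fun z => ⟨z, hP z⟩
  let e := (ContinuousLinearMap.equivProdOfSurjectiveOfIsCompl (L.prod q) P hrange hPr
    (LinearMap.isCompl_of_proj hP)).trans (ContinuousLinearEquiv.prodAssoc ℝ W Y _)
  have hfin : Module.finrank ℝ (Y × (L.prod q).ker) = k := by
    have h1 := LinearMap.finrank_range_add_finrank_ker (L.prod q : F →ₗ[ℝ] W × Y)
    have h2 : Module.finrank ℝ (L.prod q : F →ₗ[ℝ] W × Y).range
        = Module.finrank ℝ (W × Y) := by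
      rw [show (L.prod q : F →ₗ[ℝ] W × Y).range = ⊤ from hrange, finrank_top]
    rw [h2, Module.finrank_prod] at h1
    rw [Module.finrank_prod]
    have h3 : Module.finrank ℝ (L.prod q).ker =
      Module.finrank ℝ (L.prod q : F →ₗ[ℝ] W × Y).ker := rfl
    omega
  have := FiniteDimensional.complete ℝ F
  refine HasC1Chart.of_straightening (Ψ := fun y => (G y, q y, P y)) (Ψ' := e) (a := (q x, P x))
    (ℓ := ℓ ∘ₗ LinearMap.fst ℝ Y (L.prod q).ker) hfin
    (hG.prodMk (q.contDiff.prodMk P.contDiff).contDiffAt) ?_ (by simp [hx]) hℓ hS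
  exact hL.prodMk (q.hasFDerivAt.prodMk P.hasFDerivAt)

end Levels

/-! ### The energy surface as a submanifold. -/

section EnergySurface

variable {n : ℕ} {m : Fin n → ℝ} {b h : ℝ}

theorem finrank_phase : Module.finrank ℝ (Phase n) = 2 * n + 2 := by
  simp only [Module.finrank_prod, finrank_euclideanSpace, Fintype.card_fin, Module.finrank_self]
  ring

theorem kin_nonneg (hm : ∀ i, 0 < m i) (u : Conf n) : 0 ≤ kin m u :=
  Finset.sum_nonneg fun i _ => div_nonneg (sq_nonneg _) (hm i).le

/-- At a point of the energy surface, the constraints take all values along the directions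
tangent to `ρ = const`, unless the velocities vanish. -/
theorem exists_constraintDeriv_eq (hn : 2 ≤ n) (hm : ∀ i, 0 < m i) (hb : 2 < b) {x : Phase n}
    (hx : x ∈ extSurface m b h) {e : Phase n} {E : ℝ} (hE : E ≠ 0)
    (he : constraintDeriv m b h x e = (0, 0, 0, 0, E)) (t : ℝ × ℝ × ℝ × ℝ × ℝ) :
    ∃ w : Phase n, ∃ c : ℝ, w.1 = 0 ∧ fderiv ℝ (constraint m b h) x (w + c • e) = t := by
  have hL := fderiv_constraint (m := m) (h := h) hb hx.1
  obtain ⟨ρ, v, s, u⟩ := x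
  obtain ⟨hs, hc⟩ := hx
  simp only [constraint, Prod.mk_eq_zero, sub_eq_zero] at hc
  obtain ⟨h1, h2, h3, h4, -⟩ := hc
  have hn0 : Nonempty (Fin n) := ⟨⟨0, by omega⟩⟩
  have hM : ∑ i, m i ≠ 0 := (Finset.sum_pos (fun i _ => hm i) Finset.univ_nonempty).ne'
  have hI : ∑ i, m i * s i * s i = 1 := by
    rw [← h3, inertia]
    exact Finset.sum_congr rfl fun i _ => by ring
  have hW0 := sum_potGrad m 1 s
  have hV0 := sum_potGrad m b s
  obtain ⟨t₁, t₂, t₃, t₄, t₅⟩ := t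
  set L := fderiv ℝ (constraint m b h) (ρ, v, s, u)
  -- Translations of positions and of velocities, dilation, and the momentum `Ms` each move one of
  -- the first four constraints. Only dilation also disturbs the energy, by `κ`, which the multiple
  -- of `e` corrects.
  have e1 : L (0, 0, WithLp.toLp 2 fun _ => 1, 0) = (∑ i, m i, 0, 0, 0, 0) := by
    simp [hL, constraintDeriv, h1, h2, hW0, hV0]
  have e2 : L (0, 0, 0, WithLp.toLp 2 fun i => m i) = (0, ∑ i, m i, 0, 0, 0) := by
    simp [hL, constraintDeriv, h1, h2, (hm _).ne']
  obtain ⟨κ, e3⟩ : ∃ κ, L (0, 0, s, 0) = (0, 0, 2, 0, κ) := by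
    simp [hL, constraintDeriv, h1, h4, hI]
  have e4 : L (0, 0, 0, massMul m s) = (0, 0, 0, 1, 0) := by
    have h5 : ∀ i, u i * (m i * s i) / m i = u i * s i := fun i => by
      field_simp [(hm i).ne']
    simp [hL, constraintDeriv, h1, h4, hI, massMul, h5]
  have e5 : L e = (0, 0, 0, 0, E) := by rw [hL, he]
  refine ⟨(t₁ / ∑ i, m i) • (0, 0, WithLp.toLp 2 fun _ => 1, 0)
    + (t₂ / ∑ i, m i) • (0, 0, 0, WithLp.toLp 2 fun i => m i) + (t₃ / 2) • (0, 0, s, 0)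
    + t₄ • (0, 0, 0, massMul m s), (t₅ - t₃ / 2 * κ) / E, by simp, ?_⟩
  simp only [map_add, map_smul, e1, e2, e3, e4, e5]
  simp [hM, hE]

theorem constraintDeriv_velocity {x : Phase n} (hx : x ∈ extSurface m b h) :
    constraintDeriv m b h x (0, x.2.1, 0, x.2.2.2) =
      (0, 0, 0, 0, kin m x.2.2.2 + x.2.1 ^ 2) := by
  obtain ⟨ρ, v, s, u⟩ := x
  obtain ⟨hs, hc⟩ := hx
  simp only [constraint, Prod.mk_eq_zero, sub_eq_zero] at hc
  obtain ⟨-, h2, -, h4, -⟩ := hc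
  simp [constraintDeriv, h2, h4, kin, sq]

/-- With nonzero velocity, scaling the velocity moves the energy. At rest the `ρ` direction does: if
the `ρ` derivative vanished too, combining it with the energy equation would give `ρ ^ (b - 1) * W +
b * V = 0`, a sum of positive terms. -/
theorem surjective_fderiv_constraint (hn : 2 ≤ n) (hm : ∀ i, 0 < m i) (hb : 2 < b) {x : Phase n}
    (hx : x ∈ extSurface m b h) (hρ : 0 < x.1) :
    Function.Surjective (fderiv ℝ (constraint m b h) x) := fun t => by
  by_cases hk : kin m x.2.2.2 + x.2.1 ^ 2 = 0
  · obtain ⟨ρ, v, s, u⟩ := x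
    simp only at hρ hk
    have hkin := kin_nonneg hm u
    have hv : v ^ 2 = 0 := by nlinarith [sq_nonneg v]
    have hk0 : kin m u = 0 := by linarith
    have hW := pot_pos (a := 1) hn hm hx.1
    have hV := pot_pos (a := b) hn hm hx.1
    have hE := congrArg (fun c => c.2.2.2.2) hx.2
    simp only [constraint, hv, hk0, Prod.snd_zero] at hE hW hV
    have hne : -((b - 1) * ρ ^ (b - 2) * pot m 1 s) - h * (b * ρ ^ (b - 1)) ≠ 0 := by
      intro h0
      have h1 : ρ ^ (b - 2) * ρ = ρ ^ (b - 1) := by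
        rw [← Real.rpow_add_one hρ.ne']
        ring_nf
      have h2 : ρ ^ (b - 1) * ρ = ρ ^ b := by
        rw [← Real.rpow_add_one hρ.ne']
        ring_nf
      have h3 : 0 < ρ ^ (b - 1) * pot m 1 s := mul_pos (Real.rpow_pos_of_pos hρ _) hW
      have h4 : ρ ^ (b - 1) * pot m 1 s + b * pot m b s = 0 := by
        linear_combination ρ * h0 - b * hE + (b - 1) * pot m 1 s * h1 + h * b * h2
      nlinarith
    obtain ⟨w, c, -, hw⟩ := exists_constraintDeriv_eq hn hm hb hx (e := (1, 0, 0, 0)) hne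
      (by simp [constraintDeriv]) t
    exact ⟨_, hw⟩
  · obtain ⟨w, c, -, hw⟩ := exists_constraintDeriv_eq hn hm hb hx hk (constraintDeriv_velocity hx) t
    exact ⟨_, hw⟩

theorem kin_add_sq_of_fst_eq_zero (hb : 2 < b) {x : Phase n} (hx : x ∈ extSurface m b h)
    (hρ : x.1 = 0) : kin m x.2.2.2 + x.2.1 ^ 2 = 2 * pot m b x.2.2.1 := by
  have hE := congrArg (fun c => c.2.2.2.2) hx.2
  simp only [constraint, hρ, Real.zero_rpow (show b - 1 ≠ 0 by linarith),
    Real.zero_rpow (show b ≠ 0 by linarith)] at hE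
  simp only [Prod.snd_zero] at hE
  linarith

/-- On the collision manifold the velocity is nonzero and its scaling fixes `ρ`, so `ρ` and the
constraints can be prescribed independently. -/
theorem surjective_fderiv_constraint_prod (hn : 2 ≤ n) (hm : ∀ i, 0 < m i) (hb : 2 < b)
    {x : Phase n} (hx : x ∈ extSurface m b h) (hρ : x.1 = 0) :
    Function.Surjective ((fderiv ℝ (constraint m b h) x).prod
      (ContinuousLinearMap.fst ℝ ℝ (ℝ × Conf n × Conf n))) := fun ⟨t, r⟩ => by
  have hk : kin m x.2.2.2 + x.2.1 ^ 2 ≠ 0 := by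
    rw [kin_add_sq_of_fst_eq_zero hb hx hρ]
    exact (mul_pos two_pos (pot_pos hn hm hx.1)).ne'
  obtain ⟨w, c, hw0, hw⟩ := exists_constraintDeriv_eq hn hm hb hx hk (constraintDeriv_velocity hx)
    (t - fderiv ℝ (constraint m b h) x (r, 0, 0, 0))
  refine ⟨(w + c • (0, x.2.1, 0, x.2.2.2)) + (r, 0, 0, 0), ?_⟩
  rw [ContinuousLinearMap.prod_apply, map_add, hw, sub_add_cancel]
  simp [hw0]

theorem isC1Submanifold_energySurface (hn : 2 ≤ n) (hm : ∀ i, 0 < m i) (hb : 2 < b) :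
    IsC1Submanifold (2 * n - 3) (energySurface m b h) := by
  intro x hx
  change HasC1Chart (2 * n - 3) (energySurface m b h) x
  obtain ⟨hxe, hx0⟩ := (mem_energySurface_iff m b h).1 hx
  have hdom : ∀ᶠ y in 𝓝 x, y ∈ phaseDomain n := isOpen_phaseDomain.mem_nhds hxe.1
  have hG := (contDiffOn_constraint (h := h) (m := m) hb).contDiffAt
    (isOpen_phaseDomain.mem_nhds hxe.1)
  have hL := (hG.differentiableAt one_ne_zero).hasFDerivAt
  have hfin : Module.finrank ℝ (Phase n)
      = Module.finrank ℝ (ℝ × ℝ × ℝ × ℝ × ℝ) + (2 * n - 3) := by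
    rw [finrank_phase]
    simp only [Module.finrank_prod, Module.finrank_self]
    omega
  rcases hx0.eq_or_lt with h0 | h0
  · refine HasC1Chart.of_level (q := ContinuousLinearMap.fst ℝ ℝ (ℝ × Conf n × Conf n))
      (ℓ := LinearMap.id) hfin hG hL hxe.2
      (surjective_fderiv_constraint_prod hn hm hb hxe h0.symm) hx0 ?_
    filter_upwards [hdom] with y hy
    rw [mem_energySurface_iff]
    simp [extSurface, hy]
  -- Away from `ρ = 0` there is no boundary: the transverse form takes values in the zero space.
  · refine HasC1Chart.of_level (q := (0 : Phase n →L[ℝ] (Fin 0 → ℝ)))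
      (ℓ := 0) hfin hG hL hxe.2 ?_ (by simp) ?_
    · rintro ⟨t, r⟩
      obtain ⟨w, hw⟩ := surjective_fderiv_constraint hn hm hb hxe h0 t
      exact ⟨w, Prod.ext hw (Subsingleton.elim _ _)⟩
    · filter_upwards [hdom, (isOpen_lt continuous_const continuous_fst).mem_nhds h0] with y hy hy0
      rw [mem_energySurface_iff]
      have hy1 : 0 ≤ y.1 := le_of_lt hy0
      simp [extSurface, hy, hy1]

theorem mem_extSurface_of_equilibrium (hb : 2 < b) {s₀ : Conf n}
    (hs₀ : s₀ ∈ configSpace m) (hI : inertia m s₀ = 1) {v : ℝ} (hv : v ^ 2 = 2 * pot m b s₀) :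
    ((0, v, s₀, 0) : Phase n) ∈ extSurface m b h := by
  refine ⟨hs₀.2, ?_⟩
  simp [constraint, hs₀.1, hI, kin, hv, Real.zero_rpow (show b - 1 ≠ 0 by linarith),
    Real.zero_rpow (show b ≠ 0 by linarith)]

end EnergySurface

/-! ### Normal modes of a central configuration. -/

section NormalModes

variable {n : ℕ} {m : Fin n → ℝ} {b : ℝ} {s₀ : Conf n}

theorem inner_conf (x y : Conf n) : inner ℝ x y = ∑ i, x i * y i := by
  rw [PiLp.inner_apply]
  exact Finset.sum_congr rfl fun i _ => by simp [mul_comm]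

theorem gradient_inertia (x : Conf n) : gradient (inertia m) x = (2 : ℝ) • massMul m x := by
  have hd : ContDiff ℝ 1 (inertia (n := n) m) := by
    unfold inertia
    fun_prop
  refine ext_inner_left ℝ fun ξ => ?_
  have h1 : fderiv ℝ (inertia m) x ξ = 2 * ∑ i, m i * x i * ξ i := by
    refine fderiv_eq_of_hasDerivAt_line (hd.differentiable one_ne_zero x) ?_
    unfold inertia
    rw [Finset.mul_sum]
    refine HasDerivAt.fun_sum fun i _ => ?_
    refine (((hasDerivAt_coord_line x ξ i).pow 2).const_mul (m i)).congr_deriv ?_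
    simp
    ring
  rw [real_inner_comm, gradient, InnerProductSpace.toDual_symm_apply, h1, inner_smul_right,
    inner_conf]
  exact congrArg _ (Finset.sum_congr rfl fun i _ => by simp [massMul]; ring)

/-- Pairing the equation of a central configuration with `s₀` and using Euler's identity determines
the multiplier. -/
theorem IsCentral.potGrad_eq (hs₀ : IsCentral m b s₀) (hI : inertia m s₀ = 1) :
    potGrad m b s₀ = (-(b * pot m b s₀)) • massMul m s₀ := by
  obtain ⟨⟨-, hs⟩, σ, hσ⟩ := hs₀
  rw [gradient_pot hs, gradient_inertia, smul_smul] at hσ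
  have h1 := sum_mul_potGrad_self (m := m) (a := b) hs
  have h2 : ∑ i, s₀ i * potGrad m b s₀ i = σ * 2 * inertia m s₀ := by
    rw [hσ, inertia, Finset.mul_sum]
    exact Finset.sum_congr rfl fun i _ => by simp [massMul]; ring
  rw [hI] at h2
  rw [hσ]
  congr 1
  linarith

variable (m b s₀) in
/-- The Hessian of the potential in the coordinates `√m x`. -/
noncomputable def reducedHess : Conf n →ₗ[ℝ] Conf n where
  toFun x := WithLp.toLp 2 fun i =>
    potHess m b s₀ (WithLp.toLp 2 fun j => x j / √(m j)) i / √(m i)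
  map_add' x y := by
    ext i
    simp only [potHess_apply, PiLp.add_apply, ← add_div, ← Finset.sum_add_distrib]
    congr 1
    exact Finset.sum_congr rfl fun j _ => by ring
  map_smul' c x := by
    ext i
    simp only [potHess_apply, PiLp.smul_apply, smul_eq_mul, RingHom.id_apply, ← mul_div_assoc,
      Finset.mul_sum]
    congr 1
    exact Finset.sum_congr rfl fun j _ => by ring

theorem sum_mul_reducedHess (x y : Conf n) : ∑ i, x i * reducedHess m b s₀ y i =
    ∑ i, (WithLp.toLp 2 fun j => x j / √(m j) : Conf n) i *
      potHess m b s₀ (WithLp.toLp 2 fun j => y j / √(m j)) i :=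
  Finset.sum_congr rfl fun i _ => by simp [reducedHess]; ring

theorem isSymmetric_reducedHess : (reducedHess m b s₀).IsSymmetric := fun x y => by
  rw [real_inner_comm, inner_conf, inner_conf, sum_mul_reducedHess, sum_mul_reducedHess,
    sum_mul_potHess_comm]

variable (m s₀) in
/-- The pairings with the centre of mass and with the configuration, in the coordinates `√m x`. -/
noncomputable def reducedPairing : Conf n →ₗ[ℝ] ℝ × ℝ where
  toFun x := (∑ i, √(m i) * x i, ∑ i, √(m i) * s₀ i * x i)
  map_add' x y := by simp [mul_add, Finset.sum_add_distrib]
  map_smul' c x := by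
    simp only [PiLp.smul_apply, smul_eq_mul, RingHom.id_apply, Prod.smul_mk, Finset.mul_sum,
      Prod.mk.injEq]
    exact ⟨Finset.sum_congr rfl fun i _ => by ring, Finset.sum_congr rfl fun i _ => by ring⟩

theorem reducedPairing_apply (x : Conf n) : reducedPairing m s₀ x =
    (∑ i, √(m i) * x i, ∑ i, √(m i) * s₀ i * x i) := rfl

theorem finrank_ker_reducedPairing (hn : 2 ≤ n) (hm : ∀ i, 0 < m i) (hs : ∑ i, m i * s₀ i = 0)
    (hI : inertia m s₀ = 1) : Module.finrank ℝ (reducedPairing m s₀).ker = n - 2 := by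
  have hr : ∀ i, √(m i) * √(m i) = m i := fun i => Real.mul_self_sqrt (hm i).le
  have hn0 : Nonempty (Fin n) := ⟨⟨0, by omega⟩⟩
  have hM : ∑ i, m i ≠ 0 := (Finset.sum_pos (fun i _ => hm i) Finset.univ_nonempty).ne'
  have h1 : reducedPairing m s₀ (WithLp.toLp 2 fun i => √(m i)) = (∑ i, m i, 0) := by
    rw [reducedPairing_apply, Prod.mk.injEq]
    refine ⟨Finset.sum_congr rfl fun i _ => hr i, Eq.trans ?_ hs⟩
    exact Finset.sum_congr rfl fun i _ => by linear_combination s₀ i * hr i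
  have h2 : reducedPairing m s₀ (WithLp.toLp 2 fun i => √(m i) * s₀ i) = (0, 1) := by
    rw [reducedPairing_apply, Prod.mk.injEq]
    refine ⟨Eq.trans ?_ hs, Eq.trans ?_ hI⟩
    · exact Finset.sum_congr rfl fun i _ => by linear_combination s₀ i * hr i
    · exact Finset.sum_congr rfl fun i _ => by linear_combination s₀ i ^ 2 * hr i
  have hsurj : (reducedPairing m s₀).range = ⊤ := LinearMap.range_eq_top.2 fun ⟨t, r⟩ => by
    refine ⟨(t / ∑ i, m i) • WithLp.toLp 2 (fun i => √(m i))
      + r • WithLp.toLp 2 fun i => √(m i) * s₀ i, ?_⟩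
    rw [map_add, map_smul, map_smul, h1, h2]
    simp [hM]
  have h3 := LinearMap.finrank_range_add_finrank_ker (reducedPairing m s₀)
  rw [hsurj, finrank_top, Module.finrank_prod, Module.finrank_self, finrank_euclideanSpace,
    Fintype.card_fin] at h3
  omega

/-- The Hessian annihilates translations and, by Euler's identity, has `s₀` as an eigenvector
relative to `M`; by symmetry it preserves their common orthogonal complement. -/
theorem reducedHess_mem_ker (hm : ∀ i, 0 < m i) (hs₀ : IsCentral m b s₀)
    (hI : inertia m s₀ = 1) (x : Conf n) (hx : x ∈ (reducedPairing m s₀).ker) :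
    reducedHess m b s₀ x ∈ (reducedPairing m s₀).ker := by
  have hr0 : ∀ i, √(m i) ≠ 0 := fun i => (Real.sqrt_pos.2 (hm i)).ne'
  have hr : ∀ i, √(m i) * √(m i) = m i := fun i => Real.mul_self_sqrt (hm i).le
  rw [LinearMap.mem_ker] at hx ⊢
  rw [reducedPairing_apply, Prod.mk_eq_zero] at hx ⊢
  refine ⟨?_, ?_⟩
  · have h1 := sum_mul_reducedHess (m := m) (b := b) (s₀ := s₀)
      (WithLp.toLp 2 fun i => √(m i)) x
    have h2 : (WithLp.toLp 2 fun j => √(m j) / √(m j) : Conf n) = WithLp.toLp 2 fun _ => 1 := by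
      ext i
      simp [hr0]
    rw [h2, sum_mul_potHess_comm, potHess_const] at h1
    exact h1.trans (by simp)
  · have h1 := sum_mul_reducedHess (m := m) (b := b) (s₀ := s₀)
      (WithLp.toLp 2 fun i => √(m i) * s₀ i) x
    have h2 : (WithLp.toLp 2 fun j => √(m j) * s₀ j / √(m j) : Conf n) = s₀ := by
      ext i
      simp [hr0]
    rw [h2, sum_mul_potHess_comm, potHess_self, hs₀.potGrad_eq hI, smul_smul] at h1
    refine h1.trans ?_
    rw [← mul_zero (-(b + 1) * -(b * pot m b s₀)), ← hx.2, Finset.mul_sum]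
    refine Finset.sum_congr rfl fun i _ => ?_
    simp only [PiLp.smul_apply, massMul, smul_eq_mul]
    rw [div_mul_eq_mul_div, div_eq_iff (hr0 i)]
    linear_combination (-(-(b + 1) * -(b * pot m b s₀) * s₀ i * x i)) * hr i

/-- The normal modes of a central configuration. -/
theorem exists_normalModes (hn : 2 ≤ n) (hm : ∀ i, 0 < m i) (hb : 0 < b)
    (hs₀ : IsCentral m b s₀) (hI : inertia m s₀ = 1) :
    ∃ (e : Fin (n - 2) → Conf n) (α : Fin (n - 2) → ℝ), (∀ i, 0 < α i) ∧
      (∀ i j, ∑ k, m k * e i k * e j k = if i = j then 1 else 0) ∧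
      (∀ i, ∑ k, m k * e i k = 0) ∧ (∀ i, ∑ k, m k * s₀ k * e i k = 0) ∧
      (∀ i, potHess m b s₀ (e i) = (α i - b * pot m b s₀) • massMul m (e i)) ∧
      (∀ ξ : Conf n, ∑ k, m k * ξ k = 0 → ∑ k, m k * s₀ k * ξ k = 0 →
        (∀ i, ∑ k, m k * e i k * ξ k = 0) → ξ = 0) := by
  have hr0 : ∀ i, √(m i) ≠ 0 := fun i => (Real.sqrt_pos.2 (hm i)).ne'
  have hr : ∀ i, √(m i) * √(m i) = m i := fun i => Real.mul_self_sqrt (hm i).le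
  have hfin := finrank_ker_reducedPairing hn hm hs₀.1.1 hI
  have hsym := (isSymmetric_reducedHess (m := m) (b := b) (s₀ := s₀)).restrict_invariant
    (reducedHess_mem_ker hm hs₀ hI)
  set B := hsym.eigenvectorBasis hfin
  set β := hsym.eigenvalues hfin
  have hB : ∀ i, reducedHess m b s₀ (B i : Conf n) = β i • (B i : Conf n) := fun i =>
    congrArg Subtype.val (hsym.apply_eigenvectorBasis hfin i)
  have hBK : ∀ i, (∑ k, √(m k) * (B i : Conf n) k = 0) ∧
      ∑ k, √(m k) * s₀ k * (B i : Conf n) k = 0 := fun i => by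
    have h1 := (B i).2
    rw [LinearMap.mem_ker] at h1
    rwa [reducedPairing_apply, Prod.mk_eq_zero] at h1
  have horth : ∀ i j, ∑ k, (B i : Conf n) k * (B j : Conf n) k = if i = j then 1 else 0 :=
    fun i j => by
      rw [← inner_conf, ← Submodule.coe_inner, orthonormal_iff_ite.1 B.orthonormal]
  let e : Fin (n - 2) → Conf n := fun i => WithLp.toLp 2 fun k => (B i : Conf n) k / √(m k)
  have he : ∀ i k, √(m k) * e i k = (B i : Conf n) k := fun i k => mul_div_cancel₀ _ (hr0 k)
  have hHess : ∀ i, potHess m b s₀ (e i) = β i • massMul m (e i) := fun i => by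
    ext k
    have h1 := congrArg (fun x : Conf n => x k) (hB i)
    simp only [reducedHess, LinearMap.coe_mk, AddHom.coe_mk, PiLp.smul_apply, smul_eq_mul] at h1
    rw [div_eq_iff (hr0 k)] at h1
    simp only [PiLp.smul_apply, smul_eq_mul, massMul]
    refine h1.trans ?_
    rw [← he]
    linear_combination β i * e i k * hr k
  have hβ : ∀ i, 0 ≤ β i := fun i => by
    have h1 := sum_mul_potHess_self_nonneg hm hb.le s₀ (e i)
    rw [hHess] at h1
    have h2 : ∑ k, e i k * (β i • massMul m (e i)) k = β i := by
      have h3 := horth i i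
      rw [if_pos rfl] at h3
      refine Eq.trans ?_ (congrArg (β i * ·) h3 |>.trans (mul_one _))
      rw [Finset.mul_sum]
      refine Finset.sum_congr rfl fun k _ => ?_
      rw [← he, PiLp.smul_apply, smul_eq_mul, massMul]
      linear_combination (-(β i * e i k ^ 2)) * hr k
    rwa [h2] at h1
  have hV := mul_pos hb (pot_pos (a := b) hn hm hs₀.1.2)
  -- The shift by `bV(s₀) > 0` is the term `bV(s)Ms` of the field; it makes the nonnegative
  -- eigenvalues of the Hessian strictly positive.
  refine ⟨e, fun i => β i + b * pot m b s₀, fun i => by linarith [hβ i], ?_, ?_, ?_, ?_, ?_⟩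
  · intro i j
    rw [← horth]
    refine Finset.sum_congr rfl fun k _ => ?_
    rw [← he, ← he]
    linear_combination (-(e i k * e j k)) * hr k
  · intro i
    rw [← (hBK i).1]
    refine Finset.sum_congr rfl fun k _ => ?_
    rw [← he, ← mul_assoc, hr]
  · intro i
    rw [← (hBK i).2]
    refine Finset.sum_congr rfl fun k _ => ?_
    rw [← he]
    linear_combination (-(s₀ k * e i k)) * hr k
  · intro i
    rw [hHess, add_sub_cancel_right]
  · intro ξ h1 h2 h3
    have hmem : (WithLp.toLp 2 fun k => √(m k) * ξ k : Conf n) ∈ (reducedPairing m s₀).ker := by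
      rw [LinearMap.mem_ker]
      rw [reducedPairing_apply, Prod.mk_eq_zero]
      refine ⟨Eq.trans ?_ h1, Eq.trans ?_ h2⟩
      · exact Finset.sum_congr rfl fun k _ => by linear_combination ξ k * hr k
      · exact Finset.sum_congr rfl fun k _ => by linear_combination s₀ k * ξ k * hr k
    have h4 : (⟨_, hmem⟩ : (reducedPairing m s₀).ker) = 0 := by
      refine InnerProductSpace.ext_inner_left_basis B.toBasis fun i => ?_
      rw [inner_zero_right, OrthonormalBasis.coe_toBasis, Submodule.coe_inner, inner_conf, ← h3 i]
      refine Finset.sum_congr rfl fun k _ => ?_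
      rw [← he]
      linear_combination e i k * ξ k * hr k
    ext k
    have h5 := congrArg (fun x : Conf n => x k) (congrArg Subtype.val h4)
    simpa [hr0] using h5

end NormalModes

/-! ### Charts adapted to eigenvectors. -/

section AdaptedChart

variable {F : Type*} [NormedAddCommGroup F] [NormedSpace ℝ F] [FiniteDimensional ℝ F]
  {W : Type*} [NormedAddCommGroup W] [NormedSpace ℝ W] [FiniteDimensional ℝ W]

/-- A regular level has a parametrization with prescribed derivative at a point. -/
theorem exists_adapted_parametrization {Z : Type*} [NormedAddCommGroup Z] [NormedSpace ℝ Z]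
    [FiniteDimensional ℝ Z] {G : F → W} {L : F →L[ℝ] W} {π : F →L[ℝ] Z} {B : Z →L[ℝ] F}
    {p : F} {A : Set F} (hfin : Module.finrank ℝ F = Module.finrank ℝ W + Module.finrank ℝ Z)
    (hG : ContDiffAt ℝ 1 G p) (hL : HasFDerivAt G L p) (hp : G p = 0)
    (hπB : ∀ z, π (B z) = z) (hLB : ∀ z, L (B z) = 0) (hinj : ∀ y, L y = 0 → π y = 0 → y = 0)
    (hA : A ∈ 𝓝 p) :
    ∃ (U : Set Z) (O : Set F) (φ : Z → F), IsOpen U ∧ 0 ∈ U ∧ IsOpen O ∧ O ⊆ A ∧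
      φ 0 = p ∧ MapsTo φ U O ∧ ContDiffOn ℝ 1 φ U ∧ fderiv ℝ φ 0 = B ∧
      (∀ z ∈ U, π (φ z - p) = z) ∧
      (∀ y ∈ O, G y = 0 ↔ π (y - p) ∈ U ∧ φ (π (y - p)) = y) := by
  have := FiniteDimensional.complete ℝ F
  have hinj' : Function.Injective (L.prod π : F →ₗ[ℝ] W × Z) := by
    rw [← LinearMap.ker_eq_bot, LinearMap.ker_eq_bot']
    intro y hy
    exact hinj y (congrArg Prod.fst hy) (congrArg Prod.snd hy)
  let e : F ≃L[ℝ] W × Z := (LinearEquiv.ofInjectiveOfFinrankEq _ hinj'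
    (by rw [hfin, Module.finrank_prod])).toContinuousLinearEquiv
  have he : (e : F →L[ℝ] W × Z) = L.prod π := by
    ext y <;> rfl
  have hΨ' : HasFDerivAt (fun y => (G y, π (y - p))) (e : F →L[ℝ] W × Z) p := by
    rw [he]
    exact hL.prodMk (π.hasFDerivAt.comp p ((hasFDerivAt_id p).sub_const p))
  obtain ⟨U, O, φ, hU, h0U, hO, -, hOA, hφ0, hφO, hφ, -, hr, hl⟩ := exists_parametrization
    (Ψ := fun y => (G y, π (y - p))) (a := 0)
    (hG.prodMk (π.contDiff.comp (contDiff_id.sub contDiff_const)).contDiffAt) hΨ'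
    (by simp [hp]) hA
  refine ⟨U, O, φ, hU, h0U, hO, hOA, hφ0, hφO, hφ, ?_, fun z hz => congrArg Prod.snd (hr z hz),
    fun y hy => ⟨fun h0 => hl y hy h0, fun ⟨h1, h2⟩ => ?_⟩⟩
  · have h1 : HasFDerivAt φ (fderiv ℝ φ 0) 0 :=
      ((hφ.contDiffAt (hU.mem_nhds h0U)).differentiableAt one_ne_zero).hasFDerivAt
    -- Both the derivative of `φ` and `B` are mapped by the injective `(L, π)` to `z ↦ (0, z)`,
    -- hence they coincide.
    have h2 : HasFDerivAt (fun z => ((0 : W), z)) ((e : F →L[ℝ] W × Z).comp (fderiv ℝ φ 0)) 0 := by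
      refine HasFDerivAt.congr_of_eventuallyEq ((hφ0 ▸ hΨ').comp 0 h1) ?_
      filter_upwards [hU.mem_nhds h0U] with z hz
      rw [Function.comp_apply, hφ0, hr z hz]
    have h3 := h2.unique ((hasFDerivAt_const (0 : W) (0 : Z)).prodMk (hasFDerivAt_id (0 : Z)))
    ext1 z
    refine hinj' ?_
    have h4 := congrArg (fun T : Z →L[ℝ] W × Z => T z) h3
    rw [he] at h4
    refine h4.trans ?_
    simp [hπB, hLB]
  · have h3 := hr _ h1
    rw [h2] at h3
    exact congrArg Prod.fst h3

variable {ι κ : Type*} [Fintype ι] [Fintype κ] [DecidableEq ι] [DecidableEq κ]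

/-- The stable manifold theorem for an equilibrium of a vector field on a regular level of `G`, in
terms of eigenvectors `X`, `Y` that span the tangent space, and of a dual system `X'`, `Y'`. -/
theorem immersedDim_stableSetOf_of_eigenvectors {f : F → F} {G : F → W} {Ω S : Set F} {p : F}
    {X : ι → F} {Y : κ → F} {X' : ι → F →L[ℝ] ℝ} {Y' : κ → F →L[ℝ] ℝ} {c : ι → ℝ} {d : κ → ℝ}
    {ℓ : (ι → ℝ) →ₗ[ℝ] ℝ} (hΩ : IsOpen Ω) (hf : ContDiffOn ℝ 1 f Ω) (hG : ContDiffOn ℝ 1 G Ω)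
    (hfp : f p = 0) (hpS : p ∈ S) (hSM : S ⊆ {x | x ∈ Ω ∧ G x = 0})
    (hM : IsInvariant f Ω {x | x ∈ Ω ∧ G x = 0}) (hS : IsInvariant f Ω S)
    (hfin : Module.finrank ℝ F = Module.finrank ℝ W + (Fintype.card ι + Fintype.card κ))
    (hX : ∀ i, fderiv ℝ G p (X i) = 0) (hY : ∀ j, fderiv ℝ G p (Y j) = 0)
    (hXX : ∀ i j, X' i (X j) = if i = j then 1 else 0) (hXY : ∀ i j, X' i (Y j) = 0)
    (hYX : ∀ i j, Y' i (X j) = 0) (hYY : ∀ i j, Y' i (Y j) = if i = j then 1 else 0)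
    (hinj : ∀ y, fderiv ℝ G p y = 0 → (∀ i, X' i y = 0) → (∀ j, Y' j y = 0) → y = 0)
    (hc0 : ∀ i, c i < 0) (hd0 : ∀ i, 0 < d i) (hc : ∀ i, fderiv ℝ f p (X i) = c i • X i)
    (hd : ∀ i, fderiv ℝ f p (Y i) = d i • Y i)
    (hℓ : ∀ᶠ x in 𝓝 p, x ∈ stableSetOf f {x | x ∈ Ω ∧ G x = 0} p →
      (x ∈ S ↔ 0 ≤ ℓ fun i => X' i (x - p))) :
    ImmersedDim (Fintype.card ι) (stableSetOf f S p) := by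
  obtain ⟨hpΩ, hGp⟩ := hSM hpS
  have hGc := hG.contDiffAt (hΩ.mem_nhds hpΩ)
  let π : F →L[ℝ] (ι → ℝ) × (κ → ℝ) :=
    (ContinuousLinearMap.pi X').prod (ContinuousLinearMap.pi Y')
  let B : (ι → ℝ) × (κ → ℝ) →L[ℝ] F :=
    LinearMap.toContinuousLinearMap
      ((Fintype.linearCombination ℝ X).coprod (Fintype.linearCombination ℝ Y))
  have hB : ∀ z, B z = ∑ i, z.1 i • X i + ∑ j, z.2 j • Y j := fun z => rfl
  have hπB : ∀ z, π (B z) = z := fun z => by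
    refine Prod.ext (funext fun i => ?_) (funext fun i => ?_)
    · change X' i (B z) = z.1 i
      simp [hB, hXX, hXY]
    · change Y' i (B z) = z.2 i
      simp [hB, hYX, hYY]
  have hLB : ∀ z, fderiv ℝ G p (B z) = 0 := fun z => by simp [hB, hX, hY]
  obtain ⟨U, O, φ, hU, h0U, hO, hOΩ, hφ0, hφO, hφ, hφB, hψφ, hGO⟩ :=
    exists_adapted_parametrization (π := π) (B := B) (L := fderiv ℝ G p) (A := Ω)
      (by simpa [Module.finrank_prod] using hfin) hGc
      (hGc.differentiableAt one_ne_zero).hasFDerivAt hGp hπB hLB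
      (fun y hy hy2 => hinj y hy (fun i => congrFun (congrArg Prod.fst hy2) i)
        fun j => congrFun (congrArg Prod.snd hy2) j) (hΩ.mem_nhds hpΩ)
  refine immersedDim_stableSetOf_of_hyperbolic (M := {x | x ∈ Ω ∧ G x = 0}) (O₀ := O) (U₀ := U)
    (φ := φ) (ψ := fun x => π (x - p)) (c := c) (d := d) (ℓ := ℓ) hΩ hf hfp hpS hSM
    (fun x hx => hx.1) hM hS hU h0U hO hφ0 hφO hφ ?_ hψφ ?_ hc0 hd0 ?_ ?_ hℓ
  · exact (π.contDiff.comp (contDiff_id.sub contDiff_const)).contDiffOn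
  · intro x hx
    rw [← hGO x hx]
    exact and_iff_right (hOΩ hx)
  · intro i
    have h1 : B (Pi.single i 1, 0) = X i := by simp [hB, Pi.single_apply]
    rw [hφB, h1, hc]
  · intro i
    have h1 : B (0, Pi.single i 1) = Y i := by simp [hB, Pi.single_apply]
    rw [hφB, h1, hd]

end AdaptedChart

/-! ### Linearization at an equilibrium. -/

section Linearization

variable {n : ℕ} {m : Fin n → ℝ} {b h : ℝ} {s₀ : Conf n} {v₀ : ℝ}

theorem hasDerivAt_massMul_line (s ξ : Conf n) :
    HasDerivAt (fun t : ℝ => massMul m (s + t • ξ)) (massMul m ξ) 0 :=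
  hasDerivAt_conf fun i => (hasDerivAt_coord_line s ξ i).const_mul (m i)

theorem hasDerivAt_massInv_line (u η : Conf n) :
    HasDerivAt (fun t : ℝ => massInv m (u + t • η)) (massInv m η) 0 :=
  hasDerivAt_conf fun i => (hasDerivAt_coord_line u η i).div_const (m i)

@[simp]
theorem kin_zero : kin m 0 = 0 := by simp [kin]

@[simp]
theorem massInv_zero : massInv m 0 = 0 := by
  ext i
  simp [massInv]

theorem field_equilibrium (hb : 2 < b) (hs₀ : IsCentral m b s₀) (hI : inertia m s₀ = 1)
    (hv : v₀ ^ 2 = 2 * pot m b s₀) : field m b (0, v₀, s₀, 0) = 0 := by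
  rw [field_eq (show ((0, v₀, s₀, 0) : Phase n) ∈ phaseDomain n from hs₀.1.2)]
  simp only [explicitField, hs₀.potGrad_eq hI, kin_zero, massInv_zero, hv,
    Real.zero_rpow (show b - 1 ≠ 0 by linarith)]
  refine Prod.ext (by simp) (Prod.ext ?_ (Prod.ext rfl ?_))
  · simp only [Prod.snd_zero, Prod.fst_zero]
    ring
  · simp

/-- The linearization of the vector field at an equilibrium. -/
theorem fderiv_field_equilibrium (hb : 2 < b) (hs : s₀ ∈ noCollision n) (w : Phase n) :
    fderiv ℝ (field m b) (0, v₀, s₀, 0) w =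
      (v₀ * w.1, b * v₀ * w.2.1 - b * ∑ i, w.2.2.1 i * potGrad m b s₀ i, massInv m w.2.2.2,
        ((b / 2 - 1) * v₀) • w.2.2.2 + (b * ∑ i, w.2.2.1 i * potGrad m b s₀ i) • massMul m s₀
          + (b * pot m b s₀) • massMul m w.2.2.1 + potHess m b s₀ w.2.2.1) := by
  have hp : ((0, v₀, s₀, 0) : Phase n) ∈ phaseDomain n := hs
  have hnhds := isOpen_phaseDomain.mem_nhds hp
  have heq : field m b =ᶠ[𝓝 (0, v₀, s₀, 0)] explicitField m b := by
    filter_upwards [hnhds] with x hx using field_eq hx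
  refine fderiv_eq_of_hasDerivAt_line (((contDiffOn_field (m := m) hb).contDiffAt
    hnhds).differentiableAt one_ne_zero) ?_
  have hline : Tendsto (fun t : ℝ => ((0, v₀, s₀, 0) : Phase n) + t • w) (𝓝 0)
      (𝓝 (0, v₀, s₀, 0)) := by
    simpa using (hasDerivAt_line ((0, v₀, s₀, 0) : Phase n) w).continuousAt.tendsto
  refine HasDerivAt.congr_of_eventuallyEq (f := fun t : ℝ => explicitField m b
    (((0, v₀, s₀, 0) : Phase n) + t • w)) ?_ (hline.eventually heq)
  obtain ⟨r, z, ξ, η⟩ := w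
  have hv : HasDerivAt (fun t : ℝ => v₀ + t * z) z 0 := by
    simpa using ((hasDerivAt_id (0 : ℝ)).mul_const z).const_add v₀
  have hr : HasDerivAt (fun t : ℝ => (0 : ℝ) + t * r) r 0 := by
    simpa using ((hasDerivAt_id (0 : ℝ)).mul_const r).const_add 0
  -- The exponent `b - 1` exceeds `1`, so this factor has zero derivative at `ρ = 0` and `W` leaves
  -- no trace in the linearization.
  have hρ : HasDerivAt (fun t : ℝ => ((0 : ℝ) + t * r) ^ (b - 1)) 0 0 := by
    refine (hasDerivAt_rpow_line (c := b - 1) (by linarith) 0 r).congr_deriv ?_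
    rw [Real.zero_rpow (show b - 1 - 1 ≠ 0 by linarith)]
    ring
  have hk : HasDerivAt (fun t : ℝ => kin m (0 + t • η)) 0 0 := by
    refine (hasDerivAt_kin_line (0 : Conf n) η).congr_deriv ?_
    simp
  have hu : HasDerivAt (fun t : ℝ => (0 : Conf n) + t • η) η 0 := hasDerivAt_line 0 η
  have hM := hasDerivAt_massMul_line (m := m) s₀ ξ
  have hW := hasDerivAt_pot (m := m) (a := 1) hs ξ
  have hV := hasDerivAt_pot (m := m) (a := b) hs ξ
  have hg (a : ℝ) := hasDerivAt_potGrad (m := m) (a := a) hs ξ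
  have h0 : (0 : ℝ) ^ (b - 1) = 0 := Real.zero_rpow (by linarith)
  refine HasDerivAt.prodMk ?_ (HasDerivAt.prodMk ?_ (HasDerivAt.prodMk
    (hasDerivAt_massInv_line 0 η) ?_))
  · refine (hr.mul hv).congr_deriv ?_
    simp
    ring
  · have h1 := (((hv.pow 2).const_mul (b / 2)).add hk).sub (hρ.mul hW) |>.sub (hV.const_mul b)
    refine h1.congr_deriv ?_
    simp [h0]
    ring
  · have h1 := ((((hv.const_mul (b / 2 - 1)).smul hu).sub (hk.smul hM)).add
      (hρ.smul ((hW.smul hM).add (hg 1)))).add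
      ((hV.const_mul b).smul hM) |>.add (hg b)
    refine h1.congr_deriv ?_
    simp [h0]
    abel

end Linearization

/-! ### Eigenvectors and the dual system. -/

section Modes

variable {n : ℕ} {m : Fin n → ℝ} {b h : ℝ} {s₀ : Conf n} {v₀ : ℝ}

theorem IsCentral.mem_phaseDomain (hs₀ : IsCentral m b s₀) (v₀ : ℝ) :
    ((0, v₀, s₀, 0) : Phase n) ∈ phaseDomain n := hs₀.1.2

/-- The two roots have product `-α < 0`, hence opposite signs whatever the sign of the damping term
`c`. -/
theorem exists_roots (c : ℝ) {α : ℝ} (hα : 0 < α) :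
    ∃ l r : ℝ, l < 0 ∧ 0 < r ∧ l ^ 2 = c * l + α ∧ r ^ 2 = c * r + α := by
  have hsq : √(c ^ 2 + 4 * α) ^ 2 = c ^ 2 + 4 * α := Real.sq_sqrt (by positivity)
  have hlt : |c| < √(c ^ 2 + 4 * α) := by
    rw [← Real.sqrt_sq_eq_abs]
    exact Real.sqrt_lt_sqrt (sq_nonneg c) (by linarith)
  obtain ⟨h1, h2⟩ := abs_lt.1 hlt
  exact ⟨(c - √(c ^ 2 + 4 * α)) / 2, (c + √(c ^ 2 + 4 * α)) / 2, by linarith, by linarith,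
    by linear_combination hsq / 4, by linear_combination hsq / 4⟩

variable (m) in
/-- The tangent vector with the displacement `e` and the velocity `μ e`. -/
noncomputable def modeVec (e : Conf n) (μ : ℝ) : Phase n := (0, 0, e, μ • massMul m e)

variable (m) in
/-- The linear form with the coefficients `μ`, `ν` on the displacement and the velocity along `e`. -/
noncomputable def modeForm (e : Conf n) (μ ν : ℝ) : Phase n →L[ℝ] ℝ :=
  LinearMap.toContinuousLinearMap
    { toFun := fun y => μ * ∑ k, m k * e k * y.2.2.1 k + ν * ∑ k, e k * y.2.2.2 k
      map_add' := fun y z => by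
        simp only [Prod.snd_add, Prod.fst_add, PiLp.add_apply, mul_add, Finset.sum_add_distrib]
        ring
      map_smul' := fun a y => by
        simp only [Prod.smul_snd, Prod.smul_fst, PiLp.smul_apply, smul_eq_mul, RingHom.id_apply,
          mul_left_comm _ a, ← Finset.mul_sum]
        ring }

theorem modeForm_apply (e : Conf n) (μ ν : ℝ) (y : Phase n) : modeForm m e μ ν y =
    μ * ∑ k, m k * e k * y.2.2.1 k + ν * ∑ k, e k * y.2.2.2 k := rfl

theorem modeForm_modeVec (e e' : Conf n) (μ ν r : ℝ) : modeForm m e μ ν (modeVec m e' r) =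
    (μ + ν * r) * ∑ k, m k * e k * e' k := by
  have h1 : ∑ k, e k * (r * (m k * e' k)) = r * ∑ k, m k * e k * e' k := by
    rw [Finset.mul_sum]
    exact Finset.sum_congr rfl fun k _ => by ring
  simp only [modeForm_apply, modeVec, PiLp.smul_apply, massMul, smul_eq_mul, h1]
  ring

theorem modeForm_radial (e : Conf n) (μ ν : ℝ) : modeForm m e μ ν (1, 0, 0, 0) = 0 := by
  simp [modeForm_apply]

theorem massInv_smul_massMul (hm : ∀ i, 0 < m i) (e : Conf n) (r : ℝ) :
    massInv m (r • massMul m e) = r • e := by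
  ext i
  simp only [massInv, massMul, PiLp.smul_apply, smul_eq_mul]
  field_simp [(hm i).ne']

theorem IsCentral.sum_mul_potGrad_eq_zero (hs₀ : IsCentral m b s₀) (hI : inertia m s₀ = 1)
    {ξ : Conf n} (hξ : ∑ k, m k * s₀ k * ξ k = 0) : ∑ k, ξ k * potGrad m b s₀ k = 0 := by
  rw [hs₀.potGrad_eq hI, ← mul_zero (-(b * pot m b s₀)), ← hξ, Finset.mul_sum]
  refine Finset.sum_congr rfl fun k _ => ?_
  simp only [massMul, PiLp.smul_apply, smul_eq_mul]
  ring

/-- On the plane of displacement and velocity along `e` the linearization is a damped linear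
equation of second order, with characteristic equation `hr`. -/
theorem fderiv_field_modeVec (hm : ∀ i, 0 < m i) (hb : 2 < b) (hs₀ : IsCentral m b s₀)
    (hI : inertia m s₀ = 1) {e : Conf n} {α r : ℝ} (he : ∑ k, m k * s₀ k * e k = 0)
    (hα : potHess m b s₀ e = (α - b * pot m b s₀) • massMul m e)
    (hr : r ^ 2 = (b / 2 - 1) * v₀ * r + α) :
    fderiv ℝ (field m b) (0, v₀, s₀, 0) (modeVec m e r) = r • modeVec m e r := by
  rw [fderiv_field_equilibrium hb hs₀.1.2]
  simp only [modeVec, hs₀.sum_mul_potGrad_eq_zero hI he, hα, massInv_smul_massMul hm]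
  refine Prod.ext (by simp) (Prod.ext (by simp) (Prod.ext rfl ?_))
  simp only [Prod.smul_snd, smul_smul, mul_zero, zero_smul, add_zero, ← add_smul]
  congr 1
  linear_combination -hr

theorem fderiv_field_radial (hb : 2 < b) (hs₀ : IsCentral m b s₀) :
    fderiv ℝ (field m b) (0, v₀, s₀, 0) (1, 0, 0, 0) = v₀ • (1, 0, 0, 0) := by
  rw [fderiv_field_equilibrium hb hs₀.1.2]
  have h1 : massMul m (0 : Conf n) = 0 := by
    ext i
    simp [massMul]
  have h2 : potHess m b s₀ (0 : Conf n) = 0 := by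
    ext i
    simp [potHess_apply]
  simp [h1, h2]

theorem fderiv_constraint_modeVec (hb : 2 < b) (hs₀ : IsCentral m b s₀)
    (hI : inertia m s₀ = 1) {e : Conf n} {r : ℝ} (he1 : ∑ k, m k * e k = 0)
    (he : ∑ k, m k * s₀ k * e k = 0) :
    fderiv ℝ (constraint m b h) (0, v₀, s₀, 0) (modeVec m e r) = 0 := by
  rw [fderiv_constraint hb (hs₀.mem_phaseDomain v₀)]
  have h1 : ∑ k, r * (m k * e k) * s₀ k = 0 := by
    rw [← mul_zero r, ← he, Finset.mul_sum]
    exact Finset.sum_congr rfl fun k _ => by ring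
  simp [constraintDeriv, modeVec, massMul, hs₀.sum_mul_potGrad_eq_zero hI he, he1, he, h1,
    ← Finset.mul_sum, Real.zero_rpow (show b - 1 ≠ 0 by linarith)]

theorem fderiv_constraint_radial (hb : 2 < b) (hs₀ : IsCentral m b s₀) :
    fderiv ℝ (constraint m b h) (0, v₀, s₀, 0) (1, 0, 0, 0) = 0 := by
  rw [fderiv_constraint hb (hs₀.mem_phaseDomain v₀)]
  simp [constraintDeriv, Real.zero_rpow (show b - 1 ≠ 0 by linarith),
    Real.zero_rpow (show b - 2 ≠ 0 by linarith)]

/-- The hyperbolic structure of an equilibrium in the collision manifold: the eigenvectors of the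
linearization that are tangent to `ρ = 0`, with a dual system. -/
theorem exists_tangent_eigenvectors (hn : 2 ≤ n) (hm : ∀ i, 0 < m i) (hb : 2 < b)
    (hs₀ : IsCentral m b s₀) (hI : inertia m s₀ = 1) (hv : v₀ ≠ 0) :
    ∃ (X Y : Fin (n - 2) → Phase n) (X' Y' : Fin (n - 2) → Phase n →L[ℝ] ℝ)
      (c d : Fin (n - 2) → ℝ), (∀ i, c i < 0) ∧ (∀ i, 0 < d i) ∧
      (∀ i, fderiv ℝ (constraint m b h) (0, v₀, s₀, 0) (X i) = 0) ∧
      (∀ i, fderiv ℝ (constraint m b h) (0, v₀, s₀, 0) (Y i) = 0) ∧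
      (∀ i, fderiv ℝ (field m b) (0, v₀, s₀, 0) (X i) = c i • X i) ∧
      (∀ i, fderiv ℝ (field m b) (0, v₀, s₀, 0) (Y i) = d i • Y i) ∧
      (∀ i j, X' i (X j) = if i = j then 1 else 0) ∧ (∀ i j, X' i (Y j) = 0) ∧
      (∀ i j, Y' i (X j) = 0) ∧ (∀ i j, Y' i (Y j) = if i = j then 1 else 0) ∧
      (∀ i, X' i (1, 0, 0, 0) = 0) ∧ (∀ i, Y' i (1, 0, 0, 0) = 0) ∧
      (∀ i, (X i).1 = 0) ∧ (∀ i, (Y i).1 = 0) ∧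
      (∀ y, fderiv ℝ (constraint m b h) (0, v₀, s₀, 0) y = 0 → y.1 = 0 →
        (∀ i, X' i y = 0) → (∀ i, Y' i y = 0) → y = 0) := by
  obtain ⟨e, α, hα, horth, he1, hes, hHess, hcomp⟩ :=
    exists_normalModes hn hm (by linarith) hs₀ hI
  choose l r hl hr hl2 hr2 using fun i => exists_roots ((b / 2 - 1) * v₀) (hα i)
  have hrl : ∀ i, r i - l i ≠ 0 := fun i => by
    have := hl i
    have := hr i
    exact ne_of_gt (by linarith)
  -- With `A` and `D` the components of displacement and velocity along `e i`, the dual forms are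
  -- `(r A - D) / (r - l)` and `(D - l A) / (r - l)`.
  refine ⟨fun i => modeVec m (e i) (l i), fun i => modeVec m (e i) (r i),
    fun i => modeForm m (e i) (r i / (r i - l i)) (-1 / (r i - l i)),
    fun i => modeForm m (e i) (-l i / (r i - l i)) (1 / (r i - l i)), l, r, hl, hr,
    fun i => fderiv_constraint_modeVec hb hs₀ hI (he1 i) (hes i),
    fun i => fderiv_constraint_modeVec hb hs₀ hI (he1 i) (hes i),
    fun i => fderiv_field_modeVec hm hb hs₀ hI (hes i) (hHess i) (hl2 i),
    fun i => fderiv_field_modeVec hm hb hs₀ hI (hes i) (hHess i) (hr2 i),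
    fun i j => ?_, fun i j => ?_, fun i j => ?_, fun i j => ?_, fun i => modeForm_radial _ _ _,
    fun i => modeForm_radial _ _ _, fun i => rfl, fun i => rfl, ?_⟩
  iterate 4
    rw [modeForm_modeVec, horth]
    split_ifs with hij
    · subst hij
      field_simp [hrl i]
      try ring
    · simp
  intro y hy hy0 hX hY
  rw [fderiv_constraint hb (hs₀.mem_phaseDomain v₀)] at hy
  obtain ⟨ρ, z, ξ, η⟩ := y
  simp only at hy0
  subst hy0
  simp only [modeForm_apply] at hX hY
  simp only [constraintDeriv, Prod.mk_eq_zero] at hy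
  obtain ⟨h1, h2, h3, h4, h5⟩ := hy
  have hξs : ∑ k, m k * s₀ k * ξ k = 0 := by linarith
  have hpair : ∀ i, ∑ k, m k * e i k * ξ k = 0 ∧ ∑ k, e i k * η k = 0 := fun i => by
    have hXi := hX i
    have hYi := hY i
    set A := ∑ k, m k * e i k * ξ k
    set D := ∑ k, e i k * η k
    have hi := hrl i
    have h6 : r i * A - D = 0 := by
      field_simp at hXi
      linarith
    have h7 : D - l i * A = 0 := by
      field_simp at hYi
      linarith
    have h8 : A = 0 := (mul_eq_zero.1 (show (r i - l i) * A = 0 by linarith)).resolve_left hi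
    exact ⟨h8, by rw [h8] at h6; linarith⟩
  have hξ : ξ = 0 := hcomp ξ h1 hξs fun i => (hpair i).1
  have hmi : ∀ k, m k ≠ 0 := fun k => (hm k).ne'
  have hη' : massInv m η = 0 := by
    refine hcomp _ ?_ ?_ fun i => ?_
    · refine Eq.trans (Finset.sum_congr rfl fun k _ => ?_) h2
      exact mul_div_cancel₀ _ (hmi k)
    · refine Eq.trans (Finset.sum_congr rfl fun k _ => ?_) h4
      simp only [massInv, PiLp.zero_apply]
      field_simp [hmi k]
      ring
    · refine Eq.trans (Finset.sum_congr rfl fun k _ => ?_) (hpair i).2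
      simp only [massInv]
      field_simp [hmi k]
  have hη : η = 0 := by
    ext k
    have h6 := congrArg (fun x : Conf n => x k) hη'
    simpa [massInv, hmi k] using h6
  -- With the other components zero, the energy constraint reduces to `v₀ z = 0`.
  have hz : z = 0 := by
    subst hξ hη
    simpa [hv] using h5
  rw [hξ, hη, hz]
  rfl

end Modes

/-! ### Stable and unstable sets of the equilibria. -/

section Main

variable {n : ℕ} {m : Fin n → ℝ} {b h : ℝ} {s₀ : Conf n} {v₀ : ℝ}

theorem finrank_phase_eq (hn : 2 ≤ n) : Module.finrank ℝ (Phase n) =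
    Module.finrank ℝ (ℝ × ℝ × ℝ × ℝ × ℝ) + (1 + (n - 2) + (n - 2)) := by
  rw [finrank_phase]
  simp only [Module.finrank_prod, Module.finrank_self]
  omega

theorem equilibrium_mem_energySurface (hb : 2 < b) (hs₀ : IsCentral m b s₀)
    (hI : inertia m s₀ = 1) (hv : v₀ ^ 2 = 2 * pot m b s₀) :
    ((0, v₀, s₀, 0) : Phase n) ∈ energySurface m b h :=
  (mem_energySurface_iff m b h).2 ⟨mem_extSurface_of_equilibrium hb hs₀.1 hI hv, le_rfl⟩

theorem stableSet_eq (p : Phase n) :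
    stableSet m b h p = stableSetOf (field m b) (energySurface m b h) p := rfl

/-- The radial eigenvalue `v₀` is negative, so the radial direction joins the `n - 2` stable modes,
and `ρ` itself is the linear form that cuts out the half in the energy surface. -/
theorem immersedDim_stableSet_of_neg (hn : 2 ≤ n) (hm : ∀ i, 0 < m i) (hb : 2 < b)
    (hs₀ : IsCentral m b s₀) (hI : inertia m s₀ = 1) (hv : v₀ ^ 2 = 2 * pot m b s₀)
    (hv0 : v₀ < 0) : ImmersedDim (n - 1) (stableSet m b h (0, v₀, s₀, 0)) := by
  obtain ⟨X, Y, X', Y', c, d, hc, hd, hGX, hGY, hfX, hfY, hXX, hXY, hYX, hYY, hX0, hY0, hX1, hY1,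
    hinj⟩ := exists_tangent_eigenvectors (h := h) hn hm hb hs₀ hI hv0.ne
  have hcard : Fintype.card (Unit ⊕ Fin (n - 2)) = n - 1 := by
    simp only [Fintype.card_sum, Fintype.card_unit, Fintype.card_fin]
    omega
  rw [stableSet_eq, ← hcard]
  refine immersedDim_stableSetOf_of_eigenvectors (G := constraint m b h)
    (X := Sum.elim (fun _ => (1, 0, 0, 0)) X) (Y := Y)
    (X' := Sum.elim (fun _ => ContinuousLinearMap.fst ℝ ℝ (ℝ × Conf n × Conf n)) X') (Y' := Y')
    (c := Sum.elim (fun _ => v₀) c) (d := d) (ℓ := LinearMap.proj (Sum.inl ()))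
    isOpen_phaseDomain (contDiffOn_field hb) (contDiffOn_constraint hb)
    (field_equilibrium hb hs₀ hI hv) (equilibrium_mem_energySurface hb hs₀ hI hv)
    (energySurface_subset m b h) (isInvariant_extSurface hm hb) (isInvariant_energySurface hm hb)
    ?_ ?_ hGY ?_ ?_ ?_ hYY ?_ ?_ hd ?_ hfY ?_
  · simpa using finrank_phase_eq hn
  · rintro (_ | i)
    · exact fderiv_constraint_radial hb hs₀
    · exact hGX i
  · rintro (_ | i) (_ | j)
    · simp
    · simpa using hX1 j
    · simpa using hX0 i
    · simpa using hXX i j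
  · rintro (_ | i) j
    · exact hY1 j
    · exact hXY i j
  · rintro i (_ | j)
    · exact hY0 i
    · exact hYX i j
  · exact fun y hy hy1 hy2 => hinj y hy (hy1 (Sum.inl ())) (fun i => hy1 (Sum.inr i)) hy2
  · rintro (_ | i)
    · exact hv0
    · exact hc i
  · rintro (_ | i)
    · exact fderiv_field_radial hb hs₀
    · exact hfX i
  · refine Eventually.of_forall fun x ⟨γ, hγ, hγs⟩ => ?_
    have hx : x ∈ extSurface m b h := hγ ▸ (hγs.1 0 (mem_Ici.2 le_rfl)).1
    rw [mem_energySurface_iff]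
    simp [hx]

/-- The orbits that converge to an equilibrium with positive `v` remain in `ρ = 0`. -/
theorem IsStableCurve.fst_eq_zero {γ : ℝ → Phase n} {S : Set (Phase n)} (hS : S ⊆ phaseDomain n)
    (hγ : IsStableCurve (field m b) S (0, v₀, s₀, 0) γ) (hv0 : 0 < v₀) : (γ 0).1 = 0 := by
  -- The square is used because `ρ` may have any sign here. It eventually grows, as `v > 0` near the
  -- limit, and yet tends to zero, so it vanishes from some time on, and hence always.
  have h1 : Tendsto (fun t => (γ t).1 ^ 2) atTop (𝓝 0) := by
    have := ((continuous_fst.tendsto _).comp hγ.2).pow 2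
    simpa using this
  have h2 : ∀ᶠ t in atTop, 0 < (γ t).2.1 :=
    (((continuous_fst.comp continuous_snd).tendsto _).comp hγ.2).eventually (lt_mem_nhds hv0)
  obtain ⟨T, hT⟩ := eventually_atTop.1 (h2.and (eventually_ge_atTop 0))
  have hT0 : 0 ≤ T := (hT T le_rfl).2
  have hder : ∀ t ∈ Ici (0 : ℝ), HasDerivWithinAt (fun t => (γ t).1 ^ 2)
      (2 * (γ t).1 * ((γ t).1 * (γ t).2.1)) (Ici 0) t := fun t ht => by
    obtain ⟨h3, h4⟩ := hγ.1 t ht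
    have h5 := (ContinuousLinearMap.fst ℝ ℝ (ℝ × Conf n × Conf n)).hasFDerivAt.comp_hasDerivWithinAt
      t h4
    rw [field_eq (hS h3)] at h5
    refine (h5.pow 2).congr_deriv ?_
    simp [explicitField]
  have hint : ∀ t ∈ interior (Ici T), HasDerivAt (fun t => (γ t).1 ^ 2)
      (2 * (γ t).1 * ((γ t).1 * (γ t).2.1)) t := fun t ht => by
    rw [interior_Ici] at ht
    have ht0 : 0 < t := hT0.trans_lt ht
    exact (hder t ht0.le).hasDerivAt (Ici_mem_nhds ht0)
  have hmono : MonotoneOn (fun t => (γ t).1 ^ 2) (Ici T) := by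
    refine monotoneOn_of_deriv_nonneg (convex_Ici T)
      (fun t ht => ((hder t (hT0.trans ht)).continuousWithinAt.mono (Ici_subset_Ici.2 hT0)))
      (fun t ht => (hint t ht).differentiableAt.differentiableWithinAt) fun t ht => ?_
    rw [(hint t ht).deriv]
    have h3 := (hT t (interior_subset ht)).1
    nlinarith [mul_nonneg (sq_nonneg (γ t).1) h3.le]
  have h3 : (γ T).1 ^ 2 ≤ 0 := ge_of_tendsto h1 (by
    filter_upwards [eventually_ge_atTop T] with t ht using hmono self_mem_Ici ht ht)
  have h4 : (γ T).1 = 0 := by nlinarith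
  exact (((hγ.mono_set hS).isCurveOn T).fst_eq_zero_iff hT0).2 h4

/-- The radial direction is now unstable, and all stable orbits lie in `ρ = 0`, so the inequality
costs nothing and `ℓ = 0` describes the energy surface among stable points. -/
theorem immersedDim_stableSet_of_pos (hn : 2 ≤ n) (hm : ∀ i, 0 < m i) (hb : 2 < b)
    (hs₀ : IsCentral m b s₀) (hI : inertia m s₀ = 1) (hv : v₀ ^ 2 = 2 * pot m b s₀)
    (hv0 : 0 < v₀) : ImmersedDim (n - 2) (stableSet m b h (0, v₀, s₀, 0)) := by
  obtain ⟨X, Y, X', Y', c, d, hc, hd, hGX, hGY, hfX, hfY, hXX, hXY, hYX, hYY, hX0, hY0, hX1, hY1,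
    hinj⟩ := exists_tangent_eigenvectors (h := h) hn hm hb hs₀ hI hv0.ne'
  rw [stableSet_eq, ← Fintype.card_fin (n - 2)]
  refine immersedDim_stableSetOf_of_eigenvectors (G := constraint m b h)
    (X := X) (Y := Sum.elim (fun _ : Unit => (1, 0, 0, 0)) Y) (X' := X')
    (Y' := Sum.elim (fun _ => ContinuousLinearMap.fst ℝ ℝ (ℝ × Conf n × Conf n)) Y')
    (c := c) (d := Sum.elim (fun _ => v₀) d) (ℓ := 0)
    isOpen_phaseDomain (contDiffOn_field hb) (contDiffOn_constraint hb)
    (field_equilibrium hb hs₀ hI hv) (equilibrium_mem_energySurface hb hs₀ hI hv)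
    (energySurface_subset m b h) (isInvariant_extSurface hm hb) (isInvariant_energySurface hm hb)
    ?_ hGX ?_ hXX ?_ ?_ ?_ ?_ hc ?_ hfX ?_ ?_
  · rw [finrank_phase_eq hn]
    simp only [Fintype.card_sum, Fintype.card_unit, Fintype.card_fin]
    omega
  · rintro (_ | i)
    · exact fderiv_constraint_radial hb hs₀
    · exact hGY i
  · rintro i (_ | j)
    · exact hX0 i
    · exact hXY i j
  · rintro (_ | i) j
    · exact hX1 j
    · exact hYX i j
  · rintro (_ | i) (_ | j)
    · simp
    · simpa using hY1 j
    · simpa using hY0 i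
    · simpa using hYY i j
  · exact fun y hy hy1 hy2 => hinj y hy (hy2 (Sum.inl ())) hy1 fun i => hy2 (Sum.inr i)
  · rintro (_ | i)
    · exact hv0
    · exact hd i
  · rintro (_ | i)
    · exact fderiv_field_radial hb hs₀
    · exact hfY i
  · refine Eventually.of_forall fun x ⟨γ, hγ, hγs⟩ => ?_
    have hx : x ∈ extSurface m b h := hγ ▸ (hγs.1 0 (mem_Ici.2 le_rfl)).1
    have hx0 : x.1 = 0 := hγ ▸ hγs.fst_eq_zero (extSurface_subset m b h) hv0
    rw [mem_energySurface_iff]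
    simp [hx, hx0]

variable (n) in
/-- The reversal of the velocities. -/
noncomputable def reversal : Phase n ≃L[ℝ] Phase n :=
  (ContinuousLinearEquiv.refl ℝ ℝ).prodCongr ((ContinuousLinearEquiv.neg ℝ).prodCongr
    ((ContinuousLinearEquiv.refl ℝ (Conf n)).prodCongr (ContinuousLinearEquiv.neg ℝ)))

theorem reversal_apply (x : Phase n) : reversal n x = (x.1, -x.2.1, x.2.2.1, -x.2.2.2) := rfl

@[simp]
theorem reversal_reversal (x : Phase n) : reversal n (reversal n x) = x := by
  simp [reversal_apply]

theorem kin_neg (u : Conf n) : kin m (-u) = kin m u := by simp [kin]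

theorem field_reversal (x : Phase n) :
    field m b (reversal n x) = -reversal n (field m b x) := by
  obtain ⟨ρ, v, s, u⟩ := x
  have h1 : massInv m (-u) = -massInv m u := by
    ext i
    simp [massInv, neg_div]
  simp [reversal_apply, field, kin_neg, h1]

theorem reversal_mem_energySurface {x : Phase n} (hx : x ∈ energySurface m b h) :
    reversal n x ∈ energySurface m b h := by
  obtain ⟨ρ, v, s, u⟩ := x
  simpa [reversal_apply, energySurface, kin_neg] using hx

/-- The reversal of time exchanges the stable sets and the unstable sets. -/
theorem unstableSet_eq_image (p : Phase n) :
    unstableSet m b h p = reversal n '' stableSet m b h (reversal n p) := by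
  have hneg : ∀ {A : Set ℝ} {t : ℝ}, HasDerivWithinAt (fun t : ℝ => -t) (-1) A t := fun {A t} =>
    (hasDerivAt_neg t).hasDerivWithinAt
  ext x
  constructor
  · rintro ⟨γ, rfl, hγ, hlim⟩
    refine ⟨reversal n (γ 0), ⟨fun t => reversal n (γ (-t)), by simp, fun t ht => ?_, ?_⟩, by simp⟩
    · have ht' : -t ∈ Iic (0 : ℝ) := mem_Iic.2 (neg_nonpos.2 (mem_Ici.1 ht))
      obtain ⟨h1, h2⟩ := hγ _ ht'
      refine ⟨reversal_mem_energySurface h1, ?_⟩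
      have h3 := h2.scomp t (hneg (A := Ici 0)) fun r hr => mem_Iic.2 (neg_nonpos.2 (mem_Ici.1 hr))
      have h4 := (reversal n).hasFDerivAt.comp_hasDerivWithinAt t h3
      rw [field_reversal]
      simpa [Function.comp_def] using h4
    · exact ((reversal n).continuous.tendsto p).comp (hlim.comp tendsto_neg_atTop_atBot)
  · rintro ⟨_, ⟨γ, rfl, hγ, hlim⟩, rfl⟩
    refine ⟨fun t => reversal n (γ (-t)), by simp, fun t ht => ?_, ?_⟩
    · have ht' : -t ∈ Ici (0 : ℝ) := mem_Ici.2 (neg_nonneg.2 (mem_Iic.1 ht))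
      obtain ⟨h1, h2⟩ := hγ _ ht'
      refine ⟨reversal_mem_energySurface h1, ?_⟩
      have h3 := h2.scomp t (hneg (A := Iic 0)) fun r hr => mem_Ici.2 (neg_nonneg.2 (mem_Iic.1 hr))
      have h4 := (reversal n).hasFDerivAt.comp_hasDerivWithinAt t h3
      rw [field_reversal]
      simpa [Function.comp_def] using h4
    · have h1 := ((reversal n).continuous.tendsto _).comp (hlim.comp tendsto_neg_atBot_atTop)
      rwa [reversal_reversal] at h1

end Main

end CollinearNBody


theorem theorem4 (n : ℕ) (hn : 2 ≤ n) (m : Fin n → ℝ) (hm : ∀ i, 0 < m i)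
    (b : ℝ) (hb : 2 < b) (h : ℝ) (s₀ : CollinearNBody.Conf n)
    (hs₀ : CollinearNBody.IsCentral m b s₀) (hI : CollinearNBody.inertia m s₀ = 1) :
    CollinearNBody.EmbeddedDim (2 * n - 3) (CollinearNBody.energySurface m b h) ∧
    CollinearNBody.ImmersedDim (n - 1)
      (CollinearNBody.unstableSet m b h (CollinearNBody.eqPlus m b s₀)) ∧
    CollinearNBody.ImmersedDim (n - 1)
      (CollinearNBody.stableSet m b h (CollinearNBody.eqMinus m b s₀)) ∧
    CollinearNBody.ImmersedDim (n - 2)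
      (CollinearNBody.stableSet m b h (CollinearNBody.eqPlus m b s₀)) ∧
    CollinearNBody.ImmersedDim (n - 2)
      (CollinearNBody.unstableSet m b h (CollinearNBody.eqMinus m b s₀)) := by
  have hV : 0 < 2 * CollinearNBody.pot m b s₀ :=
    mul_pos two_pos (CollinearNBody.pot_pos hn hm hs₀.1.2)
  have hv : √(2 * CollinearNBody.pot m b s₀) ^ 2 = 2 * CollinearNBody.pot m b s₀ :=
    Real.sq_sqrt hV.le
  have hv' : (-√(2 * CollinearNBody.pot m b s₀)) ^ 2 = 2 * CollinearNBody.pot m b s₀ := by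
    rw [neg_sq, hv]
  have hpos := Real.sqrt_pos.2 hV
  have hneg := neg_lt_zero.2 hpos
  have hminus := CollinearNBody.immersedDim_stableSet_of_neg (h := h) hn hm hb hs₀ hI hv' hneg
  have hplus := CollinearNBody.immersedDim_stableSet_of_pos (h := h) hn hm hb hs₀ hI hv hpos
  refine ⟨⟨⟨_, CollinearNBody.equilibrium_mem_energySurface hb hs₀ hI hv⟩,
    CollinearNBody.isC1Submanifold_energySurface hn hm hb⟩, ?_, hminus, hplus, ?_⟩
  · rw [CollinearNBody.unstableSet_eq_image]
    refine CollinearNBody.ImmersedDim.image_equiv ?_ _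
    simpa [CollinearNBody.reversal_apply, CollinearNBody.eqPlus] using hminus
  · rw [CollinearNBody.unstableSet_eq_image]
    refine CollinearNBody.ImmersedDim.image_equiv ?_ _
    simpa [CollinearNBody.reversal_apply, CollinearNBody.eqMinus] using hplus
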